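/- Let $K$ be a compact quantum group, with Hopf $*$-algebra of matrix coefficients $\mathfrak{C}^\infty(K)$, Haar state $\varphi$, GNS space $L^2(K)$ and GNS map $\Lambda$. Let $W$ be its Kac--Takesaki operator, $W^*(\Lambda(f)\otimes\Lambda(g))=(\Lambda\otimes\Lambda)(\Delta(g)(f\otimes 1))$. Let $VN(K)$ be the group von Neumann algebra on $L^2(K)$ generated by the operators $(\omega\otimes\mathrm{id})(W)$, with comultiplication $\widehat\Delta(x)=\widehat W^*(1\otimes x)\widehat W$, where $\widehat W=\Sigma W^*\Sigma$ and $\Sigma$ is the tensor flip, unitary antipode $\widehat R$ and scaling group $(\widehat\tau_t)_{t\in\mathbb R}$. Thus $VN(K)\cong\ell^\infty\text{-}\prod_{\mu\in\mathrm{Irr}(K)}\mathrm{End}(V(\mu))$, where $\mathrm{Irr}(K)$ is the set of equivalence classes of irreducible unitary representations. A weight on the dual of $K$ is a densely defined operator $w$ on $L^2(K)$ such that $w$ is strictly positive and self-adjoint, $w^{-1}\in VN(K)$ and $w^{-2}\otimes w^{-2}\le\widehat\Delta(w^{-2})$. It is called central if $w^{-1}$ lies in the center of $VN(K)$, and symmetric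 if $\widehat\tau_t(w^{-1})=w^{-1}$ for all $t\in\mathbb R$ and $\widehat R(w^{-1})=w^{-1}$. Let $w:\mathrm{Irr}(K)\to(0,\infty)$ be a function, identified with the (possibly unbounded) operator on $L^2(K)$ that acts as the scalar $w(\mu)$ on the block of $\mu$, that is, on the range of the unit of $\mathrm{End}(V(\mu))\subseteq VN(K)$, for each $\mu\in\mathrm{Irr}(K)$, with its maximal domain. Then $w$ is a central weight on the dual of $K$ if and only if 1. $w(\mu)\ge 1$ for all $\mu\in\mathrm{Irr}(K)$, and 2. $w(\nu)\le w(\lambda)w(\mu)$ for all $\lambda,\mu,\nu\in\mathrm{Irr}(K)$ such that $\nu\subseteq\lambda\otimes\mu$. Moreover, if $w$ is a central weight on the dual of $K$, then it is symmetric if and only if $w(\mu)=w(\overline\mu)$ for all $\mu\in\mathrm{Irr}(K)$, where $\overline\mu$ is the conjugate of $\mu$, the unique element of $\mathrm{Irr}(K)$ such that $\mu\otimes\overline\mu$ contains the trivial representation. -/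

import Mathlib

open scoped TensorProduct InnerProductSpace
open UniformSpace

/-- A compact quantum group `K`, given by its Hopf `*`-algebra `A = 𝔠^∞(K)` of matrix coefficients:
a Hopf `*`-algebra over `ℂ` with a faithful, positive, invariant, normalised functional, the Haar
state. (The conjugate linearity of the involution is the assumption `StarModule ℂ A`.) -/
class CompactQuantumGroup (A : Type*) [Ring A] [StarRing A] [HopfAlgebra ℂ A] [StarModule ℂ A] where
  /-- the comultiplication preserves the involution -/
  comul_star : ∀ a : A, Coalgebra.comul (R := ℂ) (star a) = star (Coalgebra.comul (R := ℂ) a)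
  /-- the Haar state `φ` -/
  haar : A →ₗ[ℂ] ℂ
  haar_one : haar 1 = 1
  haar_pos : ∀ a : A, 0 ≤ (haar (star a * a)).re ∧ (haar (star a * a)).im = 0
  haar_faithful : ∀ a : A, haar (star a * a) = 0 → a = 0
  /-- left invariance `(id ⊗ φ) Δ(a) = φ(a) 1` -/
  haar_left : ∀ a : A,
    TensorProduct.rid ℂ A (haar.lTensor A (Coalgebra.comul (R := ℂ) a)) = haar a • (1 : A)
  /-- right invariance `(φ ⊗ id) Δ(a) = φ(a) 1` -/
  haar_right : ∀ a : A,
    TensorProduct.lid ℂ A (haar.rTensor A (Coalgebra.comul (R := ℂ) a)) = haar a • (1 : A)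

namespace CompactQuantumGroup

/-- The von Neumann algebra generated by a set of bounded operators: the double commutant of the
set and its adjoints. -/
noncomputable def generatedVN {H : Type*} [NormedAddCommGroup H] [InnerProductSpace ℂ H]
    [CompleteSpace H] (S : Set (H →L[ℂ] H)) : VonNeumannAlgebra H where
  toStarSubalgebra :=
    StarSubalgebra.centralizer ℂ (StarSubalgebra.centralizer ℂ S : Set (H →L[ℂ] H))
  centralizer_centralizer' := by
    change Set.centralizer (Set.centralizer ((StarSubalgebra.centralizer ℂ
      (StarSubalgebra.centralizer ℂ S : Set (H →L[ℂ] H)) : StarSubalgebra ℂ (H →L[ℂ] H)) :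
        Set (H →L[ℂ] H))) = ((StarSubalgebra.centralizer ℂ
      (StarSubalgebra.centralizer ℂ S : Set (H →L[ℂ] H)) : StarSubalgebra ℂ (H →L[ℂ] H)) :
        Set (H →L[ℂ] H))
    rw [StarSubalgebra.coe_centralizer_centralizer]
    simp

/-! ### Unitary representations and `Irr(K)` -/

section Representations

variable {A : Type*} [Ring A] [HopfAlgebra ℂ A]

/-- A matrix `u` over `A` acts on `ℂ^I` through the functionals `f` on `A`: the operator with
matrix `(f(u i j))`. For a representation `u` this is the associated representation of the dual
algebra of `A`. -/
def act {I : Type*} [Fintype I] (u : Matrix I I A) (f : A →ₗ[ℂ] ℂ) : (I → ℂ) →ₗ[ℂ] (I → ℂ) :=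
  (u.map f).mulVecLin

/-- `T` is a morphism (intertwiner) from the representation `u` to the representation `v`. -/
def Intertwines {I J : Type*} [Fintype I] [Fintype J] (u : Matrix I I A) (v : Matrix J J A)
    (T : (I → ℂ) →ₗ[ℂ] (J → ℂ)) : Prop :=
  ∀ f : A →ₗ[ℂ] ℂ, T ∘ₗ act u f = act v f ∘ₗ T

/-- The matrix of `π_λ ⊗ π_μ`, where `u`, `v` are the matrices of `λ`, `μ`. The dual
comultiplication satisfies `(Δ̂(f), u_{kl} ⊗ v_{mn}) = f(v_{mn} u_{kl})`. -/
def tensorMatrix {I J : Type*} (u : Matrix I I A) (v : Matrix J J A) :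
    Matrix (I × J) (I × J) A :=
  Matrix.of fun p q => v p.2 q.2 * u p.1 q.1

variable (A) [StarRing A]

/-- An irreducible unitary representation of `K`: a unitary corepresentation matrix without
proper invariant subspaces. -/
structure IrrRep where
  dim : ℕ
  dim_pos : 0 < dim
  coeff : Matrix (Fin dim) (Fin dim) A
  comul_coeff : ∀ i j, Coalgebra.comul (R := ℂ) (coeff i j) = ∑ k, coeff i k ⊗ₜ[ℂ] coeff k j
  mem_unitary : coeff ∈ unitary (Matrix (Fin dim) (Fin dim) A)
  irreducible : ∀ V : Submodule ℂ (Fin dim → ℂ),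
    (∀ f : A →ₗ[ℂ] ℂ, ∀ x ∈ V, act coeff f x ∈ V) → V = ⊥ ∨ V = ⊤

/-- Equivalence of irreducible unitary representations. -/
instance irrSetoid : Setoid (IrrRep A) where
  r u v := ∃ T : (Fin u.dim → ℂ) ≃ₗ[ℂ] (Fin v.dim → ℂ), Intertwines u.coeff v.coeff T.toLinearMap
  iseqv := by
    refine ⟨fun u => ⟨LinearEquiv.refl _ _, fun f => by ext; simp⟩, ?_, ?_⟩
    · rintro u v ⟨T, hT⟩
      refine ⟨T.symm, fun f => LinearMap.ext fun x => T.injective ?_⟩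
      have := LinearMap.congr_fun (hT f) (T.symm x)
      simp only [LinearMap.comp_apply, LinearEquiv.coe_coe, LinearEquiv.apply_symm_apply] at this ⊢
      exact this.symm
    · rintro u v w ⟨T, hT⟩ ⟨S, hS⟩
      refine ⟨T.trans S, fun f => LinearMap.ext fun x => ?_⟩
      have h1 := LinearMap.congr_fun (hT f) x
      have h2 := LinearMap.congr_fun (hS f) (T x)
      simp only [LinearMap.comp_apply, LinearEquiv.coe_coe, LinearEquiv.trans_apply] at h1 h2 ⊢
      rw [h1, h2]

/-- The set `Irr(K)` of equivalence classes of irreducible unitary representations. -/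
def Irr := Quotient (irrSetoid A)

variable {A}

/-- The class in `Irr(K)` of an irreducible unitary representation. -/
def IrrRep.cls (u : IrrRep A) : Irr A := Quotient.mk (irrSetoid A) u

/-- `ν ⊆ lam ⊗ μ`: the representation `ν` embeds into the tensor product of `lam` and `μ`. -/
def SubTensor (ν lam μ : Irr A) : Prop :=
  ∃ x u v : IrrRep A, x.cls = ν ∧ u.cls = lam ∧ v.cls = μ ∧
    ∃ T : (Fin x.dim → ℂ) →ₗ[ℂ] (Fin u.dim × Fin v.dim → ℂ),
      Function.Injective T ∧ Intertwines x.coeff (tensorMatrix u.coeff v.coeff) T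

variable (A) in
/-- The trivial representation. -/
def trivialRep : IrrRep A where
  dim := 1
  dim_pos := one_pos
  coeff := 1
  comul_coeff i j := by
    obtain rfl : i = 0 := Subsingleton.elim _ _
    obtain rfl : j = 0 := Subsingleton.elim _ _
    simp [Algebra.TensorProduct.one_def]
  mem_unitary := one_mem _
  irreducible V _ := by
    have h : Module.finrank ℂ (Fin 1 → ℂ) = 1 := by simp
    have : IsSimpleOrder (Submodule ℂ (Fin 1 → ℂ)) := is_simple_module_of_finrank_eq_one h
    exact IsSimpleOrder.eq_bot_or_eq_top V

/-- `μ'` is the conjugate `μ̄` of `μ`: the trivial representation is contained in `μ ⊗ μ'`. -/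
def IsConj (μ μ' : Irr A) : Prop := SubTensor (trivialRep A).cls μ μ'

end Representations

variable (A : Type*) [Ring A] [StarRing A] [HopfAlgebra ℂ A] [StarModule ℂ A]
  [CompactQuantumGroup A]

/-! ### The Hilbert spaces `L²(K)` and `L²(K) ⊗ L²(K)` -/

/-- The algebra `A`, equipped with the inner product `⟪a, b⟫ = φ(a* b)`. -/
def PreL2 := A

instance : AddCommGroup (PreL2 A) := inferInstanceAs (AddCommGroup A)

noncomputable instance : Module ℂ (PreL2 A) := inferInstanceAs (Module ℂ A)

variable {A} in
/-- The identity map. -/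
noncomputable def toPre : A ≃ₗ[ℂ] PreL2 A := LinearEquiv.refl ℂ A

variable {A} in
theorem haar_star (a : A) : haar (star a) = (starRingEnd ℂ) (haar a) := by
  have key : ∀ z : ℂ, (z * haar a + (starRingEnd ℂ) z * haar (star a)).im = 0 := by
    intro z
    have h := (haar_pos (1 + z • a)).2
    have h0 := (haar_pos a).2
    have e : star (1 + z • a) * (1 + z • a)
        = 1 + z • a + ((starRingEnd ℂ) z • star a + ((starRingEnd ℂ) z * z) • (star a * a)) := by
      simp [star_add, star_smul, mul_add, add_mul, smul_smul, mul_comm]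
      abel
    have e2 : (starRingEnd ℂ) z * z = ((Complex.normSq z : ℝ) : ℂ) := by
      rw [mul_comm, Complex.mul_conj]
    rw [e, e2] at h
    simp only [map_add, map_smul, haar_one, smul_eq_mul, Complex.add_im, Complex.one_im,
      Complex.im_ofReal_mul, h0, mul_zero, add_zero, zero_add] at h
    rw [Complex.add_im]
    exact h
  have h1 := key 1
  have h2 := key Complex.I
  simp at h1 h2
  apply Complex.ext
  · simp; linarith
  · simp; linarith

/-- The inner product `⟪a, b⟫ = φ(a* b)`. -/
@[reducible]
noncomputable def preL2Core : InnerProductSpace.Core ℂ (PreL2 A) where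
  inner a b := haar (star (toPre.symm a) * toPre.symm b)
  conj_inner_symm a b := by rw [← haar_star]; simp
  re_inner_nonneg a := (haar_pos (toPre.symm a)).1
  add_left a b c := by simp [add_mul]
  smul_left a b z := by simp
  definite a h := by simpa using haar_faithful (toPre.symm a) h

noncomputable instance : NormedAddCommGroup (PreL2 A) := (preL2Core A).toNormedAddCommGroup

noncomputable instance : InnerProductSpace ℂ (PreL2 A) := .ofCore (preL2Core A).toCore

/-- The GNS Hilbert space `L²(K)` of the Haar state. -/
abbrev L2 := Completion (PreL2 A)

variable {A} in
/-- The GNS map `Λ`. -/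
noncomputable def Lam : A →ₗ[ℂ] L2 A := (Completion.toComplₗᵢ (𝕜 := ℂ)).toLinearMap ∘ₗ toPre.toLinearMap

variable {A} in
theorem inner_Lam (a b : A) : ⟪Lam a, Lam b⟫_ℂ = haar (star a * b) := by
  simp only [Lam, LinearMap.comp_apply, LinearIsometry.coe_toLinearMap, LinearIsometry.inner_map_map]
  rfl

variable {A} in
theorem denseRange_Lam : DenseRange (Lam : A → L2 A) := by
  have : (Lam : A → L2 A) = ((↑) : PreL2 A → L2 A) ∘ (toPre : A → PreL2 A) := rfl
  rw [this]
  exact Completion.denseRange_coe.comp toPre.surjective.denseRange (Completion.continuous_coe _)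

/-- The Hilbert space tensor product `L²(K) ⊗ L²(K)`. -/
abbrev L2L2 := Completion (L2 A ⊗[ℂ] L2 A)

/-- The map `Λ ⊗ Λ`. -/
noncomputable def LamLam : A ⊗[ℂ] A →ₗ[ℂ] L2L2 A :=
  (Completion.toComplₗᵢ (𝕜 := ℂ)).toLinearMap ∘ₗ TensorProduct.map Lam Lam

variable {A}

/-- `tens ξ η = ξ ⊗ η`, as a bounded operator in `η`. -/
noncomputable def tens (ξ : L2 A) : L2 A →L[ℂ] L2L2 A :=
  Completion.toComplL.comp (TensorProduct.mkL ℂ (L2 A) (L2 A) ξ)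

/-- The bounded operator `x ⊗ y` on `L²(K) ⊗ L²(K)`. -/
noncomputable def opTensor (x y : L2 A →L[ℂ] L2 A) : L2L2 A →L[ℂ] L2L2 A :=
  (TensorProduct.mapL x y).completion

variable (A) in
/-- The tensor flip `Σ`. -/
noncomputable def flip : L2L2 A →L[ℂ] L2L2 A :=
  ((TensorProduct.commIsometry ℂ (L2 A) (L2 A)).toContinuousLinearEquiv :
    L2 A ⊗[ℂ] L2 A →L[ℂ] L2 A ⊗[ℂ] L2 A).completion

/-! ### The Kac-Takesaki operator -/

variable (A) in
/-- The linear map `a ⊗ b ↦ Δ(b)(a ⊗ 1)`. -/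
noncomputable def Wpre : A ⊗[ℂ] A →ₗ[ℂ] A ⊗[ℂ] A :=
  TensorProduct.lift (LinearMap.mk₂ ℂ (fun a b => Coalgebra.comul (R := ℂ) b * (a ⊗ₜ[ℂ] (1 : A)))
    (fun a a' b => by simp [TensorProduct.add_tmul, mul_add])
    (fun z a b => by simp [← TensorProduct.smul_tmul'])
    (fun a b b' => by simp [add_mul])
    (fun z a b => by simp))

variable (A) in
/-- The adjoint `W*` of the Kac-Takesaki operator, the bounded operator on `L²(K) ⊗ L²(K)` such that
`W*(Λ(a) ⊗ Λ(b)) = (Λ ⊗ Λ)(Δ(b)(a ⊗ 1))`, i.e. `((ω ⊗ id) W*) Λ(b) = Λ((ω ⊗ id) Δ(b))`. -/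
noncomputable def Wstar : L2L2 A →L[ℂ] L2L2 A :=
  (LamLam A ∘ₗ Wpre A).extendOfNorm (LamLam A)

theorem denseRange_LamLam : DenseRange (LamLam A) := by
  have h : DenseRange (TensorProduct.map (Lam (A := A)) (Lam (A := A))) := by
    have hcl : ∀ t : L2 A ⊗[ℂ] L2 A, t ∈
        (LinearMap.range (TensorProduct.map (Lam (A := A)) (Lam (A := A)))).topologicalClosure := by
      intro t
      induction t with
      | zero => exact zero_mem _
      | add x y hx hy => exact add_mem hx hy
      | tmul x y =>
        have hd : DenseRange (Prod.map (Lam (A := A)) (Lam (A := A))) :=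
          denseRange_Lam.prodMap denseRange_Lam
        have hc : Continuous fun p : L2 A × L2 A => p.1 ⊗ₜ[ℂ] p.2 := TensorProduct.continuous_tmul
        refine hd.induction_on (p := fun p : L2 A × L2 A => p.1 ⊗ₜ[ℂ] p.2 ∈ _) (x, y) ?_ ?_
        · exact (Submodule.isClosed_topologicalClosure _).preimage hc
        · rintro ⟨a, b⟩
          exact Submodule.le_topologicalClosure _ ⟨a ⊗ₜ b, by simp⟩
    intro t
    have ht := hcl t
    rwa [← SetLike.mem_coe, Submodule.topologicalClosure_coe, LinearMap.coe_range] at ht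
  exact Completion.denseRange_coe.comp h (Completion.continuous_coe _)

theorem tensor_star_mul (x y : A ⊗[ℂ] A) : star (x * y) = star y * star x := by
  induction x with
  | zero => simp
  | add x x' hx hx' => simp [add_mul, mul_add, hx, hx']
  | tmul a b =>
    induction y with
    | zero => simp
    | add y y' hy hy' => simp [add_mul, mul_add, hy, hy']
    | tmul c d => simp

theorem inner_LamLam (x y : A ⊗[ℂ] A) : ⟪LamLam A x, LamLam A y⟫_ℂ =
    haar (TensorProduct.rid ℂ A ((haar (A := A)).lTensor A (star x * y))) := by
  simp only [LamLam, LinearMap.comp_apply, LinearIsometry.coe_toLinearMap,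
    LinearIsometry.inner_map_map]
  induction x with
  | zero => simp
  | add x x' hx hx' => simp [add_mul, inner_add_left, hx, hx']
  | tmul a b =>
    induction y with
    | zero => simp
    | add y y' hy hy' => rw [map_add, inner_add_right, hy, hy', mul_add]; simp
    | tmul c d => simp [inner_Lam, mul_comm]

theorem slice_mul (c d : A) (z : A ⊗[ℂ] A) :
    TensorProduct.rid ℂ A ((haar (A := A)).lTensor A ((c ⊗ₜ 1) * (z * (d ⊗ₜ 1)))) =
      c * TensorProduct.rid ℂ A ((haar (A := A)).lTensor A z) * d := by
  induction z with
  | zero => simp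
  | add z z' hz hz' => simp [add_mul, mul_add, hz, hz']
  | tmul a b => simp [mul_assoc]

theorem inner_Wpre (x y : A ⊗[ℂ] A) :
    ⟪LamLam A (Wpre A x), LamLam A (Wpre A y)⟫_ℂ = ⟪LamLam A x, LamLam A y⟫_ℂ := by
  induction x with
  | zero => simp
  | add x x' hx hx' => simp [inner_add_left, hx, hx']
  | tmul a b =>
    induction y with
    | zero => simp
    | add y y' hy hy' => simp only [map_add, inner_add_right, hy, hy']
    | tmul c d =>
      rw [inner_LamLam, inner_LamLam]
      have e : star (Wpre A (a ⊗ₜ b)) * Wpre A (c ⊗ₜ d) =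
          (star a ⊗ₜ 1) * (Coalgebra.comul (R := ℂ) (star b * d) * (c ⊗ₜ 1)) := by
        simp [Wpre, tensor_star_mul, Bialgebra.comul_mul, comul_star, mul_assoc]
      rw [e, slice_mul, haar_left]
      simp

theorem norm_Wpre (x : A ⊗[ℂ] A) : ‖LamLam A (Wpre A x)‖ = ‖LamLam A x‖ := by
  have h := inner_Wpre x x
  rw [inner_self_eq_norm_sq_to_K, inner_self_eq_norm_sq_to_K] at h
  have h' : ‖LamLam A (Wpre A x)‖ ^ 2 = ‖LamLam A x‖ ^ 2 := by exact_mod_cast h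
  exact (sq_eq_sq₀ (norm_nonneg _) (norm_nonneg _)).1 h'

theorem Wstar_LamLam (x : A ⊗[ℂ] A) : Wstar A (LamLam A x) = LamLam A (Wpre A x) := by
  have h : ∃ C : ℝ, ∀ y, ‖(LamLam A ∘ₗ Wpre A) y‖ ≤ C * ‖LamLam A y‖ :=
    ⟨1, fun y => by rw [one_mul]; exact (norm_Wpre y).le⟩
  exact LinearMap.extendOfNorm_eq (f := LamLam A ∘ₗ Wpre A) denseRange_LamLam h x

variable (A) in
/-- The Kac-Takesaki operator `W` of `K`. -/
noncomputable def W : L2L2 A →L[ℂ] L2L2 A := ContinuousLinearMap.adjoint (Wstar A)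

variable (A) in
/-- The Kac-Takesaki operator `Ŵ = Σ W* Σ` of the dual. -/
noncomputable def What : L2L2 A →L[ℂ] L2L2 A := flip A * Wstar A * flip A

/-- `leftSlice ξ η X = (ω_{ξ,η} ⊗ id)(X)`, where `ω_{ξ,η}(T) = ⟪ξ, T η⟫`. -/
noncomputable def leftSlice (ξ η : L2 A) (X : L2L2 A →L[ℂ] L2L2 A) : L2 A →L[ℂ] L2 A :=
  (ContinuousLinearMap.adjoint (tens ξ)).comp (X.comp (tens η))

/-- `rightSlice ξ η X = (id ⊗ ω_{ξ,η})(X)`. -/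
noncomputable def rightSlice (ξ η : L2 A) (X : L2L2 A →L[ℂ] L2L2 A) : L2 A →L[ℂ] L2 A :=
  leftSlice ξ η (flip A * X * flip A)

/-! ### The group von Neumann algebra `VN(K)` -/

variable (A) in
/-- The group von Neumann algebra `VN(K) = L^∞(K̂)`: the von Neumann algebra on `L²(K)` generated
by the operators `(ω ⊗ id)(W)` for normal functionals `ω` on `L^∞(K)`. -/
noncomputable def VN : VonNeumannAlgebra (L2 A) :=
  generatedVN {T | ∃ ξ η : L2 A, T = leftSlice ξ η (W A)}

variable (A) in
/-- The elements of `VN(K)`. -/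
noncomputable abbrev VNElem := (VN A).toStarSubalgebra

/-- The comultiplication `Δ̂(x) = Ŵ* (1 ⊗ x) Ŵ` of `VN(K)`. -/
noncomputable def dualComul (x : L2 A →L[ℂ] L2 A) : L2L2 A →L[ℂ] L2L2 A :=
  ContinuousLinearMap.adjoint (What A) * opTensor 1 x * What A

/-- The unitary antipode `R̂` and the scaling group `(τ̂_t)` of `VN(K)`: `R̂` is an antimultiplicative
`*`-preserving map, `τ̂` is a pointwise weakly continuous one-parameter group of `*`-automorphisms,
and `Ŝ = R̂ τ̂_{-i/2}`, where `Ŝ` is the antipode `(id ⊗ ω)(Ŵ) ↦ (id ⊗ ω)(Ŵ*)`; here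
`τ̂_{-i/2}(F(0)) = F(-i/2)` is defined by analytic continuation of `t ↦ τ̂_t(F(0))` to the strip.
By uniqueness of the polar decomposition of `Ŝ` the pair `(R̂, τ̂)` is uniquely determined. -/
structure IsAntipodeDecomposition (R : VNElem A →ₗ[ℂ] VNElem A)
    (τ : ℝ → (VNElem A ≃⋆ₐ[ℂ] VNElem A)) : Prop where
  map_mul : ∀ x y, R (x * y) = R y * R x
  map_star : ∀ x, R (star x) = star (R x)
  scaling_zero : ∀ x, τ 0 x = x
  scaling_add : ∀ s t x, τ (s + t) x = τ s (τ t x)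
  scaling_continuous : ∀ (x : VNElem A) (α β : L2 A),
    Continuous fun t => ⟪α, (τ t x : L2 A →L[ℂ] L2 A) β⟫_ℂ
  antipode_eq : ∀ ξ η : L2 A, ∃ F : ℂ → VNElem A,
    (∃ C : ℝ, ∀ z : ℂ, -(1 / 2) ≤ z.im → z.im ≤ 0 → ‖(F z : L2 A →L[ℂ] L2 A)‖ ≤ C) ∧
    (∀ α β : L2 A, ContinuousOn (fun z => ⟪α, (F z : L2 A →L[ℂ] L2 A) β⟫_ℂ)
      {z : ℂ | -(1 / 2) ≤ z.im ∧ z.im ≤ 0}) ∧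
    (∀ α β : L2 A, DifferentiableOn ℂ (fun z => ⟪α, (F z : L2 A →L[ℂ] L2 A) β⟫_ℂ)
      {z : ℂ | -(1 / 2) < z.im ∧ z.im < 0}) ∧
    (∀ t : ℝ, F (t : ℂ) = τ t (F 0)) ∧
    (F 0 : L2 A →L[ℂ] L2 A) = rightSlice ξ η (What A) ∧
    (R (F (-(Complex.I / 2))) : L2 A →L[ℂ] L2 A) =
      rightSlice ξ η (ContinuousLinearMap.adjoint (What A))

/-! ### Weights on the dual -/

/-- The bounded operator `x` is the inverse of the unbounded operator `w`. -/
def IsBoundedInverse (w : L2 A →ₗ.[ℂ] L2 A) (x : L2 A →L[ℂ] L2 A) : Prop :=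
  (∀ ξ : w.domain, x (w ξ) = ξ) ∧ ∀ ξ : L2 A, ∃ h : x ξ ∈ w.domain, w ⟨x ξ, h⟩ = ξ

/-- The unbounded operator `w` on `L²(K)` is a weight on the dual of `K`: it is strictly positive
and self-adjoint, `w⁻¹ ∈ VN(K)`, and `w⁻² ⊗ w⁻² ≤ Δ̂(w⁻²)`. -/
structure IsWeight (w : L2 A →ₗ.[ℂ] L2 A) : Prop where
  dense_domain : Dense (w.domain : Set (L2 A))
  selfAdjoint : IsSelfAdjoint w
  strictly_pos : ∀ ξ : w.domain, ξ ≠ 0 → 0 < (⟪(ξ : L2 A), w ξ⟫_ℂ).re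
  inverse : ∃ x ∈ VN A, IsBoundedInverse w x ∧ opTensor (x ^ 2) (x ^ 2) ≤ dualComul (x ^ 2)

/-- A weight is central if `w⁻¹` belongs to the center of `VN(K)`. -/
def IsCentralWeight (w : L2 A →ₗ.[ℂ] L2 A) : Prop :=
  IsWeight w ∧ ∃ x ∈ VN A, IsBoundedInverse w x ∧ ∀ y ∈ VN A, x * y = y * x

/-- A weight is symmetric if `w⁻¹` is invariant under the scaling group and the unitary antipode
of `VN(K)`. -/
def IsSymmetricWeight (w : L2 A →ₗ.[ℂ] L2 A) : Prop :=
  IsWeight w ∧ ∃ x : VNElem A, IsBoundedInverse w x ∧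
    ∃ (R : VNElem A →ₗ[ℂ] VNElem A) (τ : ℝ → (VNElem A ≃⋆ₐ[ℂ] VNElem A)),
      IsAntipodeDecomposition R τ ∧ (∀ t, τ t x = x) ∧ R x = x

/-! ### The operator given by a function on `Irr(K)` -/

/-- The subspace of `L²(K)` on which the block `End(V(μ))` of `VN(K) = ℓ^∞-∏_μ End(V(μ))` acts. By
the formula `ω Λ(g) = Λ((ω S⁻¹ ⊗ id) Δ(g))` for the action of functionals `ω`, it is spanned by the
vectors `Λ(S(u_{ij})) = Λ(u_{ji}*)`, where `u` represents `μ`. (The span is finite-dimensional, so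
that the closure changes nothing.) -/
noncomputable def block (μ : Irr A) : Submodule ℂ (L2 A) :=
  (Submodule.span ℂ {ξ | ∃ u : IrrRep A, u.cls = μ ∧
    ∃ i j, ξ = Lam (star (u.coeff i j))}).topologicalClosure

instance (μ : Irr A) : CompleteSpace (block μ) :=
  (Submodule.isClosed_topologicalClosure _).completeSpace_coe

/-- The unit of the block `End(V(μ))` of `VN(K)`. -/
noncomputable def blockProj (μ : Irr A) : L2 A →L[ℂ] L2 A := (block μ).starProjection

/-- The unbounded operator `w = (w(μ))_μ` on `L²(K)` which acts as the scalar `w(μ)` on the block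
belonging to `μ`; its domain consists of the vectors `ξ` such that `∑_μ w(μ) p_μ ξ` converges. -/
noncomputable def diagOp (w : Irr A → ℝ) : L2 A →ₗ.[ℂ] L2 A where
  domain :=
    { carrier := {ξ | Summable fun μ => (w μ : ℂ) • blockProj μ ξ}
      add_mem' := fun {a b} ha hb => by
        have h := Summable.add (α := L2 A) ha hb
        simpa [smul_add] using h
      zero_mem' := by simp
      smul_mem' := fun c a ha => by
        have h := Summable.const_smul (α := L2 A) c ha
        simpa [smul_comm c] using h }
  toFun :=
    { toFun := fun ξ => ∑' μ, (w μ : ℂ) • blockProj μ (ξ : L2 A)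
      map_add' := fun a b => by
        rw [← Summable.tsum_add a.2 b.2]
        simp [smul_add]
      map_smul' := fun c a => by
        have h := Summable.tsum_const_smul (α := L2 A) c a.2
        simpa [smul_comm c] using h }

end CompactQuantumGroup

open scoped TensorProduct InnerProductSpace
open UniformSpace

set_option linter.unusedSectionVars false
set_option linter.unusedDecidableInType false
set_option linter.unusedFintypeInType false

/-! By Peter-Weyl theory `A` is the direct sum of the finite-dimensional spaces `starCoeffs μ`,
which are orthogonal for the Haar state. The elements of VN(K) are exactly the bounded left
convolution operators `a ↦ (f ⊗ id) Δ(a)` (`mem_VN_of_Lc`, `exists_Lc_of_mem_VN`), so they preserve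
the blocks. A bounded inverse of `diagOp w` can only be the operator that acts as `w(μ)⁻¹` on each
block, and this operator is central.

Central weights. On the tensor block of `(λ, μ)` the operator `w⁻² ⊗ w⁻²` is the scalar `(w(λ)
w(μ))⁻²`. The isometry `Ŵ : a ⊗ b ↦ a₍₂₎ ⊗ a₍₁₎ b` turns `Δ̂(w⁻²)` into `1 ⊗ w⁻²`, and the product
`starCoeffs λ * starCoeffs μ` lies in the sum of the `starCoeffs ν` with `ν ⊆ λ ⊗ μ` and contains
each of them. So the eigenvalues of `Δ̂(w⁻²)` on that block are the `w(ν)⁻²` with `ν ⊆ λ ⊗ μ`, and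
the operator inequality becomes `w(ν) ≤ w(λ) w(μ)` (`exists_conv₂_eq_smul`,
`opTensor_le_dualComul`). The bound `w ≥ 1` also follows from it: with `y = w⁻²` one has `y ⊗ y ≤
Δ̂(y) ≤ ‖y‖`, whence `‖y‖² ≤ ‖y‖`. Conversely `w ≥ 1` makes `w⁻¹` bounded.

Symmetric implies conjugation invariant. The antipode maps `(ω ⊗ id)(W*)` to `(ω ⊗ id)(W)`. If `x =
w⁻¹` is fixed by the scaling group and the unitary antipode, an identity `x L = c L` for a slice `L`
survives analytic continuation and is reversed by the antipode
(`IsAntipodeDecomposition.map_smul_eq`). Taking for `L` the projection onto the block of `μ`, the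
result can be read off on the block of the conjugate.

Conjugation invariant implies symmetric. Here a scaling group and a unitary antipode have to be
constructed. With the modular operator `D` of the Haar state, `⟪a, D b⟫ = φ(b a*)`, and the modular
conjugation `J`, they are `x ↦ D^{it} x D^{-it}` and `x ↦ J x* J`. That they preserve VN(K) is
checked algebraically for natural powers of `D` and extended to all powers, because exponential sums
are determined by their values on the natural numbers (`exists_modPow_conj_Lc`). The continuation of
`D^{it} L D^{-it}` to the strip is bounded by the three lines theorem, since on the lower edge it
is, up to conjugation by the unitaries `D^{it}`, of the form `J L' J` with another slice `L'`
(`isAntipodeDecomposition`). Finally `D` preserves every block, and `J` exchanges the blocks of `μ`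
and of its conjugate. -/

namespace CompactQuantumGroup

/-! ### Corepresentation matrices, intertwiners and Schur's lemma -/

section Corepresentations

variable {A : Type*} [Ring A] [HopfAlgebra ℂ A]

/-- A matrix over `A` is a corepresentation if `Δ(t i j) = ∑ t i k ⊗ t k j` and `ε(t i j) = δ i j`. -/
structure IsCorep {I : Type*} [Fintype I] [DecidableEq I] (t : Matrix I I A) : Prop where
  comul : ∀ i j, Coalgebra.comul (R := ℂ) (t i j) = ∑ k, t i k ⊗ₜ[ℂ] t k j
  counit : ∀ i j, Coalgebra.counit (R := ℂ) (t i j) = (1 : Matrix I I ℂ) i j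

variable {I J : Type*} [Fintype I] [Fintype J] [DecidableEq I] [DecidableEq J]

variable (A) in
/-- A scalar matrix, considered as a matrix over `A`. -/
def scal {I J : Type*} (T : Matrix I J ℂ) : Matrix I J A := T.map (algebraMap ℂ A)

theorem scal_mul {K : Type*} (S : Matrix I J ℂ) (T : Matrix J K ℂ) :
    scal A (S * T) = scal A S * scal A T := by
  simp [scal, Matrix.map_mul]

theorem scal_one : scal A (1 : Matrix I I ℂ) = 1 := by
  simp [scal]

theorem scal_mul_apply {K : Type*} (T : Matrix J I ℂ) (u : Matrix I K A) (j : J) (k : K) :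
    (scal A T * u) j k = ∑ i, T j i • u i k := by
  simp [scal, Matrix.mul_apply, Algebra.smul_def]

theorem mul_scal_apply {K : Type*} (T : Matrix I J ℂ) (u : Matrix K I A) (k : K) (j : J) :
    (u * scal A T) k j = ∑ i, T i j • u k i := by
  simp [scal, Matrix.mul_apply, Algebra.smul_def, Algebra.commutes]

theorem matrix_ext_functional {u v : Matrix I J A}
    (h : ∀ f : A →ₗ[ℂ] ℂ, u.map f = v.map f) : u = v := by
  ext i j
  rw [← sub_eq_zero, ← Module.forall_dual_apply_eq_zero_iff ℂ]
  intro f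
  have := congrFun (congrFun (h f) i) j
  simpa [sub_eq_zero] using this

theorem map_scal_mul {K : Type*} (f : A →ₗ[ℂ] ℂ) (T : Matrix J I ℂ) (u : Matrix I K A) :
    (scal A T * u).map f = T * u.map f := by
  ext j k
  rw [Matrix.map_apply, scal_mul_apply]
  simp [Matrix.mul_apply]

theorem map_mul_scal {K : Type*} (f : A →ₗ[ℂ] ℂ) (T : Matrix I J ℂ) (u : Matrix K I A) :
    (u * scal A T).map f = u.map f * T := by
  ext j k
  rw [Matrix.map_apply, mul_scal_apply]
  simp [Matrix.mul_apply, mul_comm]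

/-- Functionals separate the points of `A`, so the scalar identities for all of them amount to one
matrix identity over `A`. Averaging with the Haar state produces intertwiners in this second form.
-/
theorem intertwines_iff (u : Matrix I I A) (v : Matrix J J A) (T : (I → ℂ) →ₗ[ℂ] (J → ℂ)) :
    Intertwines u v T ↔ scal A (LinearMap.toMatrix' T) * u = v * scal A (LinearMap.toMatrix' T) := by
  have key : ∀ f : A →ₗ[ℂ] ℂ, (T ∘ₗ act u f = act v f ∘ₗ T ↔
      LinearMap.toMatrix' T * u.map f = v.map f * LinearMap.toMatrix' T) := by
    intro f
    rw [← LinearMap.toMatrix'.injective.eq_iff, LinearMap.toMatrix'_comp, LinearMap.toMatrix'_comp]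
    simp [act, ← Matrix.toLin'_apply']
  constructor
  · intro h
    refine matrix_ext_functional fun f => ?_
    rw [map_scal_mul, map_mul_scal]
    exact (key f).1 (h f)
  · intro h f
    rw [key f, ← map_scal_mul, ← map_mul_scal, h]

theorem intertwines_toLin' (u : Matrix I I A) (v : Matrix J J A) (T : Matrix J I ℂ) :
    Intertwines u v (Matrix.toLin' T) ↔ scal A T * u = v * scal A T := by
  rw [intertwines_iff, LinearMap.toMatrix'_toLin']

/-- Irreducibility of a matrix over `A`, that is, absence of proper invariant subspaces. -/
def IsIrred (u : Matrix I I A) : Prop :=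
  ∀ V : Submodule ℂ (I → ℂ), (∀ f : A →ₗ[ℂ] ℂ, ∀ x ∈ V, act u f x ∈ V) → V = ⊥ ∨ V = ⊤

/-- Schur's lemma: kernel and range of an intertwiner are invariant subspaces. -/
theorem IsIrred.bijective {u : Matrix I I A} {v : Matrix J J A} (hu : IsIrred u) (hv : IsIrred v)
    {T : (I → ℂ) →ₗ[ℂ] (J → ℂ)} (hT : Intertwines u v T) (h0 : T ≠ 0) : Function.Bijective T := by
  constructor
  · rw [← LinearMap.ker_eq_bot]
    refine (hu (LinearMap.ker T) fun f x hx => ?_).resolve_right fun h => h0 ?_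
    · have := LinearMap.congr_fun (hT f) x
      simp only [LinearMap.comp_apply, LinearMap.mem_ker.1 hx, map_zero] at this
      exact this
    · exact LinearMap.ker_eq_top.1 h
  · rw [← LinearMap.range_eq_top]
    refine (hv (LinearMap.range T) ?_).resolve_left fun h => h0 ?_
    · rintro f _ ⟨x, rfl⟩
      have := LinearMap.congr_fun (hT f) x
      simp only [LinearMap.comp_apply] at this
      exact ⟨_, this⟩
    · exact LinearMap.range_eq_bot.1 h

theorem Intertwines.symm {u : Matrix I I A} {v : Matrix J J A} {T : (I → ℂ) ≃ₗ[ℂ] (J → ℂ)}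
    (h : Intertwines u v T.toLinearMap) : Intertwines v u T.symm.toLinearMap := by
  intro f
  refine LinearMap.ext fun x => T.injective ?_
  have := LinearMap.congr_fun (h f) (T.symm x)
  simp only [LinearMap.comp_apply, LinearEquiv.coe_coe, LinearEquiv.apply_symm_apply] at this ⊢
  exact this.symm

/-- The linear span of the entries of a matrix over `A`. -/
def coeffSpan {I J : Type*} (u : Matrix I J A) : Submodule ℂ A :=
  Submodule.span ℂ (Set.range fun p : I × J => u p.1 p.2)

theorem mem_coeffSpan {I J : Type*} (u : Matrix I J A) (i : I) (j : J) : u i j ∈ coeffSpan u :=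
  Submodule.subset_span ⟨(i, j), rfl⟩

theorem coeffSpan_le {I J : Type*} {u : Matrix I J A} {V : Submodule ℂ A} :
    coeffSpan u ≤ V ↔ ∀ i j, u i j ∈ V := by
  rw [coeffSpan, Submodule.span_le]
  constructor
  · intro h i j
    exact h ⟨(i, j), rfl⟩
  · rintro h _ ⟨p, rfl⟩
    exact h _ _

theorem coeffSpan_scal_mul_le {K : Type*} (T : Matrix J I ℂ) (u : Matrix I K A) :
    coeffSpan (scal A T * u) ≤ coeffSpan u := by
  rw [coeffSpan_le]
  intro i j
  rw [scal_mul_apply]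
  exact Submodule.sum_mem _ fun k _ => Submodule.smul_mem _ _ (mem_coeffSpan _ _ _)

theorem coeffSpan_mul_scal_le {K : Type*} (T : Matrix I J ℂ) (u : Matrix K I A) :
    coeffSpan (u * scal A T) ≤ coeffSpan u := by
  rw [coeffSpan_le]
  intro i j
  rw [mul_scal_apply]
  exact Submodule.sum_mem _ fun k _ => Submodule.smul_mem _ _ (mem_coeffSpan _ _ _)

/-- If `u` embeds into `v`, the coefficients of `u` are among those of `v`. -/
theorem coeffSpan_le_of_injective {u : Matrix I I A} {v : Matrix J J A}
    {T : (I → ℂ) →ₗ[ℂ] (J → ℂ)} (h : Intertwines u v T) (hT : Function.Injective T) :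
    coeffSpan u ≤ coeffSpan v := by
  obtain ⟨S, hS⟩ := T.exists_leftInverse_of_injective (LinearMap.ker_eq_bot.2 hT)
  have h1 := (intertwines_iff u v T).1 h
  have h2 : u = scal A (LinearMap.toMatrix' S) * (v * scal A (LinearMap.toMatrix' T)) := by
    rw [← h1, ← Matrix.mul_assoc, ← scal_mul, ← LinearMap.toMatrix'_comp, hS, LinearMap.toMatrix'_id,
      scal_one, Matrix.one_mul]
  rw [h2]
  exact (coeffSpan_scal_mul_le _ _).trans (coeffSpan_mul_scal_le _ _)

/-- The antipode axiom, read entrywise. With it, a one-sided inverse `star t` must be the antipode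
of `t`, hence a two-sided inverse. -/
theorem IsCorep.mul_antipode {t : Matrix I I A} (ht : IsCorep t) :
    t * t.map (HopfAlgebra.antipode ℂ) = 1 := by
  ext i j
  have h := HopfAlgebra.mul_antipode_lTensor_comul_apply (R := ℂ) (t i j)
  rw [ht.comul, ht.counit] at h
  simp only [map_sum, LinearMap.lTensor_tmul, LinearMap.mul'_apply] at h
  rw [Matrix.mul_apply]
  refine h.trans ?_
  by_cases hij : i = j
  · subst hij; simp
  · simp [hij]

variable [StarRing A]

theorem IsCorep.star_eq_antipode {t : Matrix I I A} (ht : IsCorep t) (h : star t * t = 1) :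
    star t = t.map (HopfAlgebra.antipode ℂ) :=
  left_inv_eq_right_inv h ht.mul_antipode

theorem IsCorep.mem_unitary {t : Matrix I I A} (ht : IsCorep t) (h : star t * t = 1) :
    t ∈ unitary (Matrix I I A) := by
  refine Unitary.mem_iff.2 ⟨h, ?_⟩
  rw [ht.star_eq_antipode h, ht.mul_antipode]

/-- The counit law gives `E t = t` for the scalar matrix `E = ε(t)`; unitarity allows cancelling
`t`, so `E = 1`. -/
theorem isCorep_of_mem_unitary {t : Matrix I I A}
    (h : ∀ i j, Coalgebra.comul (R := ℂ) (t i j) = ∑ k, t i k ⊗ₜ[ℂ] t k j)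
    (hu : t ∈ unitary (Matrix I I A)) : IsCorep t := by
  refine ⟨h, fun i j => ?_⟩
  set E : Matrix I I ℂ := t.map (Coalgebra.counit (R := ℂ)) with hE
  have h1 : scal A E * t = t := by
    ext i j
    have := Coalgebra.rTensor_counit_comul (R := ℂ) (t i j)
    rw [h] at this
    have := congrArg (TensorProduct.lid ℂ A) this
    simp only [map_sum, LinearMap.rTensor_tmul, TensorProduct.lid_tmul, one_smul] at this
    rw [scal_mul_apply]
    exact this
  have h2 : scal A E = 1 := by
    have := congrArg (· * star t) h1
    simpa [mul_assoc, Unitary.mul_star_self_of_mem hu] using this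
  have h3 : E = 1 := by
    have := congrArg (fun m => Matrix.map m (Coalgebra.counit (R := ℂ))) h2
    ext a b
    have := congrFun (congrFun this a) b
    have h4 : Coalgebra.counit (R := ℂ) (algebraMap ℂ A (E a b)) = _ := this
    rw [Bialgebra.counit_algebraMap] at h4
    refine h4.trans ?_
    by_cases hab : a = b
    · subst hab; simp
    · simp [hab]
  exact congrFun (congrFun h3 i) j

end Corepresentations

end CompactQuantumGroup

namespace CompactQuantumGroup

/-! ### Complete reducibility of unitary corepresentations -/

section Decomposition

variable {A : Type*} [Ring A] [HopfAlgebra ℂ A]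
variable {I J K : Type*} [Fintype I] [Fintype J] [Fintype K] [DecidableEq I] [DecidableEq J]
  [DecidableEq K]

theorem scal_add (S T : Matrix I J ℂ) : scal A (S + T) = scal A S + scal A T := by
  ext i j
  simp [scal]

theorem sum_mul_scal_tmul (u : Matrix K I A) (T : Matrix I J ℂ) (v : Matrix J K A) (k l : K) :
    ∑ j, (u * scal A T) k j ⊗ₜ[ℂ] v j l = ∑ i, u k i ⊗ₜ[ℂ] (scal A T * v) i l := by
  simp only [mul_scal_apply, scal_mul_apply, TensorProduct.sum_tmul, TensorProduct.tmul_sum,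
    TensorProduct.smul_tmul]
  exact Finset.sum_comm

theorem comul_scal_mul_mul_scal {t : Matrix I I A} (ht : IsCorep t) (S : Matrix J I ℂ)
    (T : Matrix I K ℂ) (j : J) (k : K) :
    Coalgebra.comul (R := ℂ) ((scal A S * t * scal A T) j k) =
      ∑ i, (scal A S * t) j i ⊗ₜ[ℂ] (t * scal A T) i k := by
  simp only [mul_scal_apply, scal_mul_apply, map_sum, map_smul, ht.comul, TensorProduct.sum_tmul,
    TensorProduct.tmul_sum, Finset.smul_sum, TensorProduct.smul_tmul]
  rw [Finset.sum_comm]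
  simp only [TensorProduct.tmul_smul]
  calc _ = ∑ y, ∑ x, ∑ x_1, T x k • S j y • t y x_1 ⊗ₜ[ℂ] t x_1 x := rfl
    _ = ∑ y, ∑ x_1, ∑ x, T x k • S j y • t y x_1 ⊗ₜ[ℂ] t x_1 x := by
        refine Finset.sum_congr rfl fun _ _ => Finset.sum_comm
    _ = ∑ x_1, ∑ y, ∑ x, T x k • S j y • t y x_1 ⊗ₜ[ℂ] t x_1 x := Finset.sum_comm
    _ = _ := by
        refine Finset.sum_congr rfl fun _ _ => ?_
        rw [Finset.sum_comm]
        exact Finset.sum_congr rfl fun _ _ => Finset.sum_congr rfl fun _ _ => smul_comm _ _ _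

/-- The hypothesis `h` says that the range of `T` is invariant. It makes the middle sum in the
coproduct of `S t T` factor through the range of `T`, where `S T = 1` lets it collapse. -/
theorem IsCorep.compress {t : Matrix I I A} (ht : IsCorep t) {T : Matrix I J ℂ}
    {S : Matrix J I ℂ} (hST : S * T = 1) (h : t * scal A T = scal A T * (scal A S * t * scal A T)) :
    IsCorep (scal A S * t * scal A T) := by
  refine ⟨fun i j => ?_, fun i j => ?_⟩
  · rw [comul_scal_mul_mul_scal ht, h]
    rw [← sum_mul_scal_tmul]
  · have : (t.map (Coalgebra.counit (R := ℂ) (A := A))) = 1 := by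
      ext a b; exact ht.counit a b
    have h2 : (scal A S * t * scal A T).map (Coalgebra.counit (R := ℂ) (A := A)) = 1 := by
      rw [map_mul_scal, map_scal_mul, this, Matrix.mul_one, hST]
    exact congrFun (congrFun h2 i) j

/-- An orthonormal basis of a subspace of `ℂ^I` and one of its complement, as isometries. -/
theorem exists_isometries (X : Submodule ℂ (I → ℂ)) :
    ∃ (m n : ℕ) (T : Matrix I (Fin m) ℂ) (S : Matrix I (Fin n) ℂ),
      m = Module.finrank ℂ X ∧ m + n = Fintype.card I ∧
      T.conjTranspose * T = 1 ∧ S.conjTranspose * S = 1 ∧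
      T * T.conjTranspose + S * S.conjTranspose = 1 ∧ T.conjTranspose * S = 0 ∧
      (∀ v, T.mulVec v ∈ X) ∧ ∀ v ∈ X, (T * T.conjTranspose).mulVec v = v := by
  let L : EuclideanSpace ℂ I ≃ₗ[ℂ] (I → ℂ) := WithLp.linearEquiv 2 ℂ (I → ℂ)
  let Y : Submodule ℂ (EuclideanSpace ℂ I) := X.comap L.toLinearMap
  let b := stdOrthonormalBasis ℂ Y
  let c := stdOrthonormalBasis ℂ Yᗮ
  let T : Matrix I (Fin (Module.finrank ℂ Y)) ℂ := Matrix.of fun i k => (b k : EuclideanSpace ℂ I) i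
  let S : Matrix I (Fin (Module.finrank ℂ Yᗮ)) ℂ := Matrix.of fun i k => (c k : EuclideanSpace ℂ I) i
  have hin : ∀ x y : EuclideanSpace ℂ I, ⟪x, y⟫_ℂ = ∑ i, star (x i) * y i := by
    intro x y
    simp [PiLp.inner_apply, mul_comm]
  have hTv : ∀ v : I → ℂ, (T * T.conjTranspose).mulVec v = L (Y.starProjection (L.symm v)) := by
    intro v
    ext i
    rw [Y.starProjection_apply, ← b.sum_repr (Y.orthogonalProjectionOnto (L.symm v))]
    simp only [AddSubmonoidClass.coe_finsetSum, Submodule.coe_smul, map_sum, map_smul,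
      Finset.sum_apply, Pi.smul_apply, smul_eq_mul]
    rw [← Matrix.mulVec_mulVec]
    simp only [Matrix.mulVec, dotProduct]
    refine Finset.sum_congr rfl fun k _ => ?_
    rw [mul_comm]
    congr 1
    rw [b.repr_apply_apply, Submodule.coe_inner, ← Submodule.starProjection_apply,
      ← Submodule.inner_starProjection_left_eq_right,
      Submodule.starProjection_eq_self_iff.2 (b k).2, hin]
    rfl
  have hSv : ∀ v : I → ℂ, (S * S.conjTranspose).mulVec v = L (Yᗮ.starProjection (L.symm v)) := by
    intro v
    ext i
    rw [Yᗮ.starProjection_apply, ← c.sum_repr (Yᗮ.orthogonalProjectionOnto (L.symm v))]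
    simp only [AddSubmonoidClass.coe_finsetSum, Submodule.coe_smul, map_sum, map_smul,
      Finset.sum_apply, Pi.smul_apply, smul_eq_mul]
    rw [← Matrix.mulVec_mulVec]
    simp only [Matrix.mulVec, dotProduct]
    refine Finset.sum_congr rfl fun k _ => ?_
    rw [mul_comm]
    congr 1
    rw [c.repr_apply_apply, Submodule.coe_inner, ← Submodule.starProjection_apply,
      ← Submodule.inner_starProjection_left_eq_right,
      Submodule.starProjection_eq_self_iff.2 (c k).2, hin]
    rfl
  have hYX : Module.finrank ℂ Y = Module.finrank ℂ X :=
    LinearEquiv.finrank_eq (L.submoduleMap Y |>.trans (LinearEquiv.ofEq _ _ (by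
      simp [Y, Submodule.map_comap_eq_of_surjective L.surjective])))
  refine ⟨_, _, T, S, hYX, ?_, ?_, ?_, ?_, ?_, ?_, ?_⟩
  · rw [Submodule.finrank_add_finrank_orthogonal, finrank_euclideanSpace]
  · ext k l
    have := orthonormal_iff_ite.1 b.orthonormal k l
    rw [Submodule.coe_inner, hin] at this
    rw [Matrix.mul_apply, Matrix.one_apply]
    exact this
  · ext k l
    have := orthonormal_iff_ite.1 c.orthonormal k l
    rw [Submodule.coe_inner, hin] at this
    rw [Matrix.mul_apply, Matrix.one_apply]
    exact this
  · apply Matrix.toLin'.injective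
    ext1 v
    ext1
    simp only [LinearMap.comp_apply, Matrix.toLin'_apply, Matrix.add_mulVec, Matrix.one_mulVec, hTv, hSv]
    rw [← map_add, Submodule.starProjection_add_starProjection_orthogonal]
    simp
  · ext k l
    have : ⟪(b k : EuclideanSpace ℂ I), (c l : EuclideanSpace ℂ I)⟫_ℂ = 0 :=
      (c l).2 _ (b k).2
    rw [hin] at this
    exact this
  · intro v
    have : T.mulVec v = L (∑ k, v k • (b k : EuclideanSpace ℂ I)) := by
      ext i
      simp only [Matrix.mulVec, dotProduct, map_sum, map_smul, Finset.sum_apply, Pi.smul_apply,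
        smul_eq_mul]
      exact Finset.sum_congr rfl fun k _ => mul_comm _ _
    rw [this]
    have h2 : (∑ k, v k • (b k : EuclideanSpace ℂ I)) ∈ Y :=
      Submodule.sum_mem _ fun k _ => Submodule.smul_mem _ _ (b k).2
    exact h2
  · intro v hv
    rw [hTv, Submodule.starProjection_eq_self_iff.2 (show L.symm v ∈ Y by simpa [Y] using hv)]
    simp

variable [StarRing A] [StarModule ℂ A]

theorem star_scal (T : Matrix I J ℂ) : (scal A T).conjTranspose = scal A T.conjTranspose := by
  ext i j
  simp [scal, Matrix.conjTranspose_apply, Algebra.algebraMap_eq_smul_one]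

/-- `t` is a unitary corepresentation. -/
structure IsUnitaryCorep (t : Matrix I I A) : Prop extends IsCorep t where
  star_mul_self : star t * t = 1

theorem IsUnitaryCorep.mul_star_self {t : Matrix I I A} (ht : IsUnitaryCorep t) :
    t * star t = 1 :=
  Unitary.mul_star_self_of_mem (ht.mem_unitary ht.star_mul_self)

theorem IrrRep.isUnitaryCorep (x : IrrRep A) : IsUnitaryCorep x.coeff :=
  ⟨isCorep_of_mem_unitary x.comul_coeff x.mem_unitary, Unitary.star_mul_self_of_mem x.mem_unitary⟩

/-- The restriction of a unitary corepresentation to an invariant subspace. -/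
theorem IsUnitaryCorep.compress {t : Matrix I I A} (ht : IsUnitaryCorep t) {T : Matrix I J ℂ}
    (hT : T.conjTranspose * T = 1)
    (h : t * scal A T = scal A T * (scal A T.conjTranspose * t * scal A T)) :
    IsUnitaryCorep (scal A T.conjTranspose * t * scal A T) := by
  refine ⟨ht.toIsCorep.compress hT h, ?_⟩
  set x := scal A T.conjTranspose * t * scal A T with hx
  have e : star x = scal A T.conjTranspose * star t * scal A T := by
    rw [Matrix.star_eq_conjTranspose, hx, Matrix.conjTranspose_mul, Matrix.conjTranspose_mul,
      star_scal, star_scal, Matrix.conjTranspose_conjTranspose, Matrix.mul_assoc]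
    rfl
  calc star x * x = scal A T.conjTranspose * star t * (scal A T * x) := by
        rw [e, Matrix.mul_assoc]
    _ = scal A T.conjTranspose * (star t * t) * scal A T := by
        rw [← h]; simp only [Matrix.mul_assoc]
    _ = 1 := by rw [ht.star_mul_self, Matrix.mul_one, ← scal_mul, hT, scal_one]

/-- For a unitary corepresentation an invariant subspace is reducing: the restriction is itself
unitary, so the subspace is invariant under `star t` as well. Taking adjoints gives the claim. -/
theorem IsUnitaryCorep.conjTranspose_mul {t : Matrix I I A} (ht : IsUnitaryCorep t)
    {T : Matrix I J ℂ} (hT : T.conjTranspose * T = 1)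
    (h : t * scal A T = scal A T * (scal A T.conjTranspose * t * scal A T)) :
    scal A T.conjTranspose * t =
      (scal A T.conjTranspose * t * scal A T) * scal A T.conjTranspose := by
  have hx := ht.compress hT h
  set x := scal A T.conjTranspose * t * scal A T
  have h1 : star t * scal A T = scal A T * star x := by
    calc star t * scal A T = star t * (scal A T * (x * star x)) := by
          rw [hx.mul_star_self, Matrix.mul_one]
      _ = star t * (t * scal A T) * star x := by
          rw [h]; simp only [Matrix.mul_assoc]
      _ = scal A T * star x := by
          rw [← Matrix.mul_assoc (star t), ht.star_mul_self, Matrix.one_mul]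
  have h2 := congrArg Matrix.conjTranspose h1
  rw [Matrix.conjTranspose_mul, Matrix.conjTranspose_mul, star_scal] at h2
  simpa [Matrix.star_eq_conjTranspose] using h2

/-- `x` embeds into `t`. -/
def Embeds (x : Matrix J J A) (t : Matrix I I A) : Prop :=
  ∃ T : (J → ℂ) →ₗ[ℂ] (I → ℂ), Function.Injective T ∧ Intertwines x t T

theorem Embeds.trans {x : Matrix J J A} {t : Matrix I I A} {s : Matrix K K A}
    (h : Embeds x t) (h' : Embeds t s) : Embeds x s := by
  obtain ⟨T, hT, hxt⟩ := h
  obtain ⟨S, hS, hts⟩ := h'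
  refine ⟨S ∘ₗ T, hS.comp hT, fun f => ?_⟩
  rw [LinearMap.comp_assoc, hxt f, ← LinearMap.comp_assoc, hts f, LinearMap.comp_assoc]

theorem embeds_of_isometry {x : Matrix J J A} {t : Matrix I I A} {T : Matrix I J ℂ}
    (hT : T.conjTranspose * T = 1) (h : t * scal A T = scal A T * x) : Embeds x t := by
  refine ⟨Matrix.toLin' T, ?_, (intertwines_toLin' _ _ _).2 h.symm⟩
  refine Function.LeftInverse.injective (g := Matrix.toLin' T.conjTranspose) fun v => ?_
  simp [hT]

/-- Given an invariant subspace, a unitary corepresentation is a direct sum of two unitary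
corepresentations. -/
theorem IsUnitaryCorep.exists_split {t : Matrix I I A} (ht : IsUnitaryCorep t)
    (X : Submodule ℂ (I → ℂ)) (hX : ∀ f : A →ₗ[ℂ] ℂ, ∀ x ∈ X, act t f x ∈ X) :
    ∃ (m n : ℕ) (x : Matrix (Fin m) (Fin m) A) (y : Matrix (Fin n) (Fin n) A),
      m = Module.finrank ℂ X ∧ m + n = Fintype.card I ∧ IsUnitaryCorep x ∧ IsUnitaryCorep y ∧
      Embeds x t ∧ Embeds y t ∧ coeffSpan t ≤ coeffSpan x ⊔ coeffSpan y := by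
  obtain ⟨m, n, T, S, hm, hmn, hT, hS, hTS, hTS0, hTX, hXT⟩ := exists_isometries X
  -- `T T*` is the projection onto `X` and fixes the vectors that `t` produces from the range of
  -- `T`.
  have h1 : t * scal A T = scal A T * (scal A T.conjTranspose * t * scal A T) := by
    refine matrix_ext_functional fun f => ?_
    simp only [map_mul_scal, map_scal_mul]
    simp only [← Matrix.mul_assoc]
    apply Matrix.toLin'.injective
    ext1 v
    ext1
    simp only [LinearMap.comp_apply, Matrix.toLin'_mul, Matrix.toLin'_apply]
    rw [Matrix.mulVec_mulVec _ T]
    exact (hXT _ (hX f _ (hTX _))).symm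
  have hx := ht.compress hT h1
  have h2 := ht.conjTranspose_mul hT h1
  have hsum : scal A T * scal A T.conjTranspose + scal A S * scal A S.conjTranspose = 1 := by
    rw [← scal_mul, ← scal_mul, ← scal_add, hTS, scal_one]
  -- The off-diagonal corner `T* t S` vanishes, because `T* t` factors through `T*` on the right and
  -- `T* S = 0`.
  have h3 : t * scal A S = scal A S * (scal A S.conjTranspose * t * scal A S) := by
    have h0 : scal A T.conjTranspose * scal A S = 0 := by
      rw [← scal_mul, hTS0]; ext; simp [scal]
    calc t * scal A S = (scal A T * scal A T.conjTranspose + scal A S * scal A S.conjTranspose) *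
          (t * scal A S) := by rw [hsum, Matrix.one_mul]
      _ = scal A T * ((scal A T.conjTranspose * t) * scal A S) +
          scal A S * (scal A S.conjTranspose * t * scal A S) := by
          rw [Matrix.add_mul]; simp only [Matrix.mul_assoc]
      _ = _ := by
          rw [h2, Matrix.mul_assoc _ (scal A T.conjTranspose), h0]
          simp
  have hy := ht.compress hS h3
  refine ⟨m, n, _, _, hm, hmn, hx, hy, embeds_of_isometry hT h1, embeds_of_isometry hS h3, ?_⟩
  have h4 := ht.conjTranspose_mul hS h3
  rw [coeffSpan_le]
  intro i j
  have h5 : t = scal A T * ((scal A T.conjTranspose * t * scal A T) * scal A T.conjTranspose) +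
      scal A S * ((scal A S.conjTranspose * t * scal A S) * scal A S.conjTranspose) := by
    rw [← h2, ← h4, ← Matrix.mul_assoc, ← Matrix.mul_assoc, ← Matrix.add_mul, hsum, Matrix.one_mul]
  have h6 := congrFun (congrFun h5 i) j
  rw [Matrix.add_apply] at h6
  rw [h6]
  refine add_mem ?_ ?_
  · exact Submodule.mem_sup_left (coeffSpan_mul_scal_le _ _ (coeffSpan_scal_mul_le _ _
      (mem_coeffSpan _ _ _)))
  · exact Submodule.mem_sup_right (coeffSpan_mul_scal_le _ _ (coeffSpan_scal_mul_le _ _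
      (mem_coeffSpan _ _ _)))

/-- Complete reducibility: the coefficients of a unitary corepresentation are sums of coefficients
of the irreducible unitary representations contained in it. -/
theorem IsUnitaryCorep.coeffSpan_le_iSup {t : Matrix I I A} (ht : IsUnitaryCorep t) :
    coeffSpan t ≤ ⨆ (x : IrrRep A) (_ : Embeds x.coeff t), coeffSpan x.coeff := by
  have key : ∀ (n : ℕ) (s : Matrix (Fin n) (Fin n) A), IsUnitaryCorep s →
      coeffSpan s ≤ ⨆ (x : IrrRep A) (_ : Embeds x.coeff s), coeffSpan x.coeff := by
    intro n
    induction n using Nat.strong_induction_on with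
    | _ n ih =>
      intro s hs
      rcases Nat.eq_zero_or_pos n with rfl | hn
      · rw [coeffSpan_le]
        intro i
        exact i.elim0
      by_cases hirr : IsIrred s
      · let x : IrrRep A := ⟨n, hn, s, hs.comul, hs.mem_unitary hs.star_mul_self, hirr⟩
        exact le_iSup₂_of_le x ⟨LinearMap.id, Function.injective_id, fun f => rfl⟩ le_rfl
      · obtain ⟨X, hX, h0⟩ := by simpa [IsIrred] using hirr
        obtain ⟨m, k, x, y, hm, hmk, hx, hy, hxs, hys, hle⟩ := hs.exists_split X hX
        have h1 : 0 < m := by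
          rw [hm, Module.finrank_pos_iff, Submodule.nontrivial_iff_ne_bot]
          exact h0.1
        have h2 : m < n := by
          rw [hm]
          simpa using Submodule.finrank_lt h0.2
        rw [Fintype.card_fin] at hmk
        refine hle.trans (sup_le ?_ ?_)
        · refine (ih m h2 x hx).trans (iSup₂_le fun z hz => ?_)
          exact le_iSup₂_of_le z (hz.trans hxs) le_rfl
        · refine (ih k (by omega) y hy).trans (iSup₂_le fun z hz => ?_)
          exact le_iSup₂_of_le z (hz.trans hys) le_rfl
  -- Splitting along the whole space merely replaces the index type `I` by some `Fin m`, to which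
  -- the induction on the size applies.
  obtain ⟨m, k, x, y, -, -, hx, hy, hxs, hys, hle⟩ := ht.exists_split ⊤ (by simp)
  refine hle.trans (sup_le ?_ ?_)
  · refine (key m x hx).trans (iSup₂_le fun z hz => ?_)
    exact le_iSup₂_of_le z (hz.trans hxs) le_rfl
  · refine (key k y hy).trans (iSup₂_le fun z hz => ?_)
    exact le_iSup₂_of_le z (hz.trans hys) le_rfl

end Decomposition

end CompactQuantumGroup

namespace CompactQuantumGroup

/-! ### Left and right convolution operators -/

section Convolution

variable {A : Type*} [Ring A] [HopfAlgebra ℂ A]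
variable {I J : Type*} [Fintype I] [Fintype J] [DecidableEq I] [DecidableEq J]

/-- The left convolution operator `a ↦ (f ⊗ id) Δ(a)`. -/
noncomputable def Lc (f : A →ₗ[ℂ] ℂ) : A →ₗ[ℂ] A :=
  (TensorProduct.lid ℂ A).toLinearMap ∘ₗ f.rTensor A ∘ₗ Coalgebra.comul

/-- The right convolution operator `a ↦ (id ⊗ f) Δ(a)`. -/
noncomputable def Rc (f : A →ₗ[ℂ] ℂ) : A →ₗ[ℂ] A :=
  (TensorProduct.rid ℂ A).toLinearMap ∘ₗ f.lTensor A ∘ₗ Coalgebra.comul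

theorem Lc_apply (f : A →ₗ[ℂ] ℂ) (a : A) :
    Lc f a = TensorProduct.lid ℂ A (f.rTensor A (Coalgebra.comul (R := ℂ) a)) := rfl

theorem Rc_apply (f : A →ₗ[ℂ] ℂ) (a : A) :
    Rc f a = TensorProduct.rid ℂ A (f.lTensor A (Coalgebra.comul (R := ℂ) a)) := rfl

theorem IsCorep.Lc {t : Matrix I I A} (ht : IsCorep t) (f : A →ₗ[ℂ] ℂ) (i j : I) :
    Lc f (t i j) = ∑ k, f (t i k) • t k j := by
  simp [Lc_apply, ht.comul]

theorem Lc_counit (a : A) : Lc (Coalgebra.counit (R := ℂ)) a = a := by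
  rw [Lc_apply, Coalgebra.rTensor_counit_comul]
  simp

theorem Rc_counit (a : A) : Rc (Coalgebra.counit (R := ℂ)) a = a := by
  rw [Rc_apply, Coalgebra.lTensor_counit_comul]
  simp

/-- Both sides are `(g ⊗ f) Δ(a)`. This exchange rule reduces identities between convolution
operators to identities between functionals. -/
theorem apply_Lc (f g : A →ₗ[ℂ] ℂ) (a : A) : f (Lc g a) = g (Rc f a) := by
  rw [Lc_apply, Rc_apply]
  induction Coalgebra.comul (R := ℂ) a with
  | zero => simp
  | add x y hx hy => simp only [map_add, hx, hy]
  | tmul x y => simp [mul_comm]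

theorem counit_Lc (f : A →ₗ[ℂ] ℂ) (a : A) : Coalgebra.counit (R := ℂ) (Lc f a) = f a := by
  rw [apply_Lc, Rc_counit]

theorem Lc_injective {f g : A →ₗ[ℂ] ℂ} (h : ∀ a, Lc f a = Lc g a) : f = g :=
  LinearMap.ext fun a => by rw [← counit_Lc, h, counit_Lc]

theorem comul_Lc (f : A →ₗ[ℂ] ℂ) (a : A) :
    Coalgebra.comul (R := ℂ) (Lc f a) = (Lc f).rTensor A (Coalgebra.comul (R := ℂ) a) := by
  have h1 : ∀ z : A ⊗[ℂ] A, Coalgebra.comul (R := ℂ) (TensorProduct.lid ℂ A (f.rTensor A z)) =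
      TensorProduct.lid ℂ (A ⊗[ℂ] A) (f.rTensor (A ⊗[ℂ] A)
        ((Coalgebra.comul (R := ℂ)).lTensor A z)) := by
    intro z
    induction z with
    | zero => simp
    | add x y hx hy => simp only [map_add, hx, hy]
    | tmul x y => simp
  have h2 : ∀ z : A ⊗[ℂ] A, TensorProduct.lid ℂ (A ⊗[ℂ] A) (f.rTensor (A ⊗[ℂ] A)
      (TensorProduct.assoc ℂ A A A ((Coalgebra.comul (R := ℂ)).rTensor A z))) =
        (Lc f).rTensor A z := by
    intro z
    induction z with
    | zero => simp
    | add x y hx hy => simp only [map_add, hx, hy]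
    | tmul x y =>
      simp only [LinearMap.rTensor_tmul, Lc_apply]
      induction Coalgebra.comul (R := ℂ) x with
      | zero => simp
      | add x y hx hy => simp only [map_add, TensorProduct.add_tmul, hx, hy]
      | tmul x y => simp [TensorProduct.smul_tmul']
  rw [Lc_apply, h1, ← Coalgebra.coassoc_apply, h2]

/-- The maps `id ⊗ f` separate the points of `M ⊗ A`. -/
theorem tensor_ext {M : Type*} [AddCommGroup M] [Module ℂ M] {x y : M ⊗[ℂ] A}
    (h : ∀ f : A →ₗ[ℂ] ℂ, TensorProduct.rid ℂ M (f.lTensor M x) =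
      TensorProduct.rid ℂ M (f.lTensor M y)) : x = y := by
  classical
  let b := Module.Basis.ofVectorSpace ℂ A
  apply (TensorProduct.equivFinsuppOfBasisRight b).injective
  have key : ∀ (z : M ⊗[ℂ] A) i, TensorProduct.equivFinsuppOfBasisRight b z i =
      TensorProduct.rid ℂ M ((b.coord i).lTensor M z) := by
    intro z i
    induction z with
    | zero => simp
    | add x y hx hy => simp only [map_add, Finsupp.add_apply, hx, hy]
    | tmul x y => simp
  ext i
  rw [key, key, h]

/-- Coassociativity. Commutation with right convolutions is what will characterise left
convolutions, and so the elements of VN(K). -/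
theorem Rc_Lc (f g : A →ₗ[ℂ] ℂ) (a : A) : Rc f (Lc g a) = Lc g (Rc f a) := by
  rw [Rc_apply, comul_Lc, Rc_apply]
  induction Coalgebra.comul (R := ℂ) a with
  | zero => simp
  | add x y hx hy => simp only [map_add, hx, hy]
  | tmul x y => simp

theorem Rc_Rc (f g : A →ₗ[ℂ] ℂ) (a : A) : Rc f (Rc g a) = Rc (f ∘ₗ Rc g) a := by
  rw [← sub_eq_zero, ← Module.forall_dual_apply_eq_zero_iff ℂ]
  intro k
  rw [map_sub, sub_eq_zero, ← apply_Lc, ← apply_Lc, ← Rc_Lc, LinearMap.comp_apply]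

/-- The space of all `Rc f a` works: `Δ(a)` is a finite sum of elementary tensors, whose left legs
span a finite-dimensional space; `a` itself comes from the counit. -/
theorem finite_range_Rc (a : A) : ∃ V : Submodule ℂ A, Module.Finite ℂ V ∧ a ∈ V ∧
    ∀ f : A →ₗ[ℂ] ℂ, ∀ x ∈ V, Rc f x ∈ V := by
  let φ : (A →ₗ[ℂ] ℂ) →ₗ[ℂ] A :=
    { toFun := fun f => Rc f a
      map_add' := fun f g => by simp [Rc_apply, LinearMap.lTensor_add]
      map_smul' := fun c f => by simp [Rc_apply, LinearMap.lTensor_smul] }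
  refine ⟨LinearMap.range φ, ?_, ⟨Coalgebra.counit, Rc_counit a⟩, ?_⟩
  · have h : ∀ z : A ⊗[ℂ] A, ∃ W : Submodule ℂ A, Module.Finite ℂ W ∧
        ∀ f : A →ₗ[ℂ] ℂ, TensorProduct.rid ℂ A (f.lTensor A z) ∈ W := by
      intro z
      induction z with
      | zero => exact ⟨⊥, inferInstance, fun f => by simp⟩
      | add x y hx hy =>
        obtain ⟨W, hW, h⟩ := hx
        obtain ⟨W', hW', h'⟩ := hy
        refine ⟨W ⊔ W', inferInstance, fun f => ?_⟩
        rw [map_add, map_add]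
        exact Submodule.add_mem_sup (h f) (h' f)
      | tmul x y =>
        refine ⟨ℂ ∙ x, inferInstance, fun f => ?_⟩
        simpa using Submodule.smul_mem _ _ (Submodule.mem_span_singleton_self x)
    obtain ⟨W, hW, h⟩ := h (Coalgebra.comul (R := ℂ) a)
    refine Submodule.finiteDimensional_of_le (S₂ := W) ?_
    rintro _ ⟨f, rfl⟩
    exact h f
  · rintro f _ ⟨g, rfl⟩
    exact ⟨f ∘ₗ Rc g, (Rc_Rc f g a).symm⟩

end Convolution

/-! ### Peter-Weyl theorem and orthogonality relations -/

section PeterWeyl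

variable {A : Type*} [Ring A] [StarRing A] [HopfAlgebra ℂ A] [StarModule ℂ A]
  [CompactQuantumGroup A]
variable {I J : Type*} [Fintype I] [Fintype J] [DecidableEq I] [DecidableEq J]

/-- The functional `b ↦ φ(a* b)`. -/
noncomputable def haarForm (a : A) : A →ₗ[ℂ] ℂ := haar ∘ₗ LinearMap.mulLeft ℂ (star a)

theorem haarForm_apply (a b : A) : haarForm a b = haar (star a * b) := rfl

/-- Every element of `A` is a coefficient of a unitary corepresentation. -/
theorem exists_isUnitaryCorep (a : A) :
    ∃ (n : ℕ) (t : Matrix (Fin n) (Fin n) A), IsUnitaryCorep t ∧ a ∈ coeffSpan t := by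
  obtain ⟨V, hVfin, haV, hV⟩ := finite_range_Rc a
  let V' : Submodule ℂ (PreL2 A) := V.map (toPre : A ≃ₗ[ℂ] PreL2 A).toLinearMap
  have : Module.Finite ℂ V' := inferInstance
  let b := stdOrthonormalBasis ℂ V'
  let e : Fin (Module.finrank ℂ V') → A := fun i => toPre.symm (b i : PreL2 A)
  have heV : ∀ i, e i ∈ V := by
    intro i
    obtain ⟨x, hx, hxe⟩ := (b i).2
    have : e i = x := by simp only [e]; rw [← hxe]; exact LinearEquiv.symm_apply_apply _ _
    rwa [this]
  have he : ∀ i j, haar (star (e i) * e j) = if i = j then (1 : ℂ) else 0 := by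
    intro i j
    have h := orthonormal_iff_ite.1 b.orthonormal i j
    rw [Submodule.coe_inner] at h
    exact h
  have hexp : ∀ v ∈ V, v = ∑ i, haarForm (e i) v • e i := by
    intro v hv
    have h := b.sum_repr' ⟨toPre v, v, hv, rfl⟩
    have h2 := congrArg (fun x : V' => toPre.symm (x : PreL2 A)) h
    simp only [AddSubmonoidClass.coe_finsetSum, Submodule.coe_smul, map_sum, map_smul,
      LinearEquiv.symm_apply_apply] at h2
    exact h2.symm
  -- These are the coefficients in `Δ(e j) = ∑ e i ⊗ t i j`, extracted by pairing the left leg with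
  -- the orthonormal basis.
  let t : Matrix (Fin (Module.finrank ℂ V')) (Fin (Module.finrank ℂ V')) A :=
    Matrix.of fun i j => Lc (haarForm (e i)) (e j)
  have hcomul : ∀ j, Coalgebra.comul (R := ℂ) (e j) = ∑ i, e i ⊗ₜ[ℂ] t i j := by
    intro j
    refine tensor_ext fun f => ?_
    have h := hexp _ (hV f _ (heV j))
    rw [Rc_apply] at h
    rw [h]
    simp only [map_sum, LinearMap.lTensor_tmul, TensorProduct.rid_tmul]
    refine Finset.sum_congr rfl fun i _ => ?_
    congr 1
    exact (apply_Lc _ _ _).symm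
  have ht : IsCorep t := by
    refine ⟨fun i j => ?_, fun i j => ?_⟩
    · change Coalgebra.comul (R := ℂ) (Lc (haarForm (e i)) (e j)) = _
      rw [comul_Lc, hcomul, map_sum]
      rfl
    · change Coalgebra.counit (R := ℂ) (Lc (haarForm (e i)) (e j)) = _
      rw [counit_Lc, haarForm_apply, he, Matrix.one_apply]
  refine ⟨_, t, ⟨ht, ?_⟩, ?_⟩
  -- Unitarity is right invariance of the Haar state, applied to `(e j)* (e l)`: orthonormality
  -- leaves `∑ (t i j)* (t i l)` on one side and `δ` on the other.
  · ext j l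
    have h := haar_right (star (e j) * e l)
    rw [Bialgebra.comul_mul, comul_star, hcomul, hcomul, star_sum, Finset.sum_mul] at h
    simp only [TensorProduct.star_tmul, Finset.mul_sum, Algebra.TensorProduct.tmul_mul_tmul, map_sum,
      LinearMap.rTensor_tmul, TensorProduct.lid_tmul, he, ite_smul, one_smul, zero_smul] at h
    simp only [Finset.sum_ite_eq, Finset.mem_univ, if_true] at h
    rw [Matrix.mul_apply, Matrix.one_apply]
    exact h
  -- Applying `ε ⊗ id` to `Δ(e j)` writes `e j` in terms of the entries of `t`.
  · rw [hexp a haV]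
    refine Submodule.sum_mem _ fun j _ => Submodule.smul_mem _ _ ?_
    have h := Lc_counit (e j)
    rw [Lc_apply, hcomul] at h
    rw [← h]
    simp only [map_sum, LinearMap.rTensor_tmul, TensorProduct.lid_tmul]
    exact Submodule.sum_mem _ fun j _ => Submodule.smul_mem _ _ (mem_coeffSpan _ _ _)

/-- The Peter-Weyl theorem: `A` is spanned by the coefficients of irreducible unitary
representations. -/
theorem iSup_coeffSpan : ⨆ x : IrrRep A, coeffSpan x.coeff = ⊤ := by
  rw [eq_top_iff]
  intro a _
  obtain ⟨n, t, ht, ha⟩ := exists_isUnitaryCorep a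
  exact (iSup₂_le fun x _ => le_iSup (fun x : IrrRep A => coeffSpan x.coeff) x)
    (ht.coeffSpan_le_iSup ha)

/-- Right invariance, applied to `(v k i)* (u l j)`, says that the averaged scalar matrix `T`
satisfies `v* T u = T`; multiply by `v`. Only `v` has to be unitary, so `u` may be the entrywise
adjoint of an irreducible representation. -/
theorem haar_intertwines {u : Matrix I I A} {v : Matrix J J A} (hu : IsCorep u)
    (hv : IsUnitaryCorep v) (k : J) (l : I) :
    scal A (Matrix.of fun p n => haar (star (v k p) * u l n)) * u =
      v * scal A (Matrix.of fun p n => haar (star (v k p) * u l n)) := by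
  have h1 : ∀ i j, ∑ m, ∑ n, haar (star (v k m) * u l n) • (star (v m i) * u n j) =
      haar (star (v k i) * u l j) • (1 : A) := by
    intro i j
    have h := haar_right (star (v k i) * u l j)
    rw [Bialgebra.comul_mul, comul_star, hu.comul, hv.comul, star_sum, Finset.sum_mul] at h
    simpa only [TensorProduct.star_tmul, Finset.mul_sum, Algebra.TensorProduct.tmul_mul_tmul,
      map_sum, LinearMap.rTensor_tmul, TensorProduct.lid_tmul] using h
  have h2 : star v * (scal A (Matrix.of fun p n => haar (star (v k p) * u l n)) * u) =
      scal A (Matrix.of fun p n => haar (star (v k p) * u l n)) := by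
    ext i j
    rw [Matrix.mul_apply]
    simp only [scal_mul_apply, Matrix.star_apply, Matrix.of_apply, Finset.mul_sum, mul_smul_comm]
    rw [h1 i j, scal, Matrix.map_apply, Algebra.algebraMap_eq_smul_one, Matrix.of_apply]
  calc _ = v * (star v * (scal A (Matrix.of fun p n => haar (star (v k p) * u l n)) * u)) := by
        rw [← Matrix.mul_assoc, hv.mul_star_self, Matrix.one_mul]
    _ = _ := by rw [h2]

/-- The counterpart for the form `φ(b a*)`: left invariance gives `u T v* = T`. -/
theorem haar_intertwines_star {u : Matrix I I A} {v : Matrix J J A} (hu : IsCorep u)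
    (hv : IsUnitaryCorep v) (j : I) (i : J) :
    u * scal A (Matrix.of fun n p => haar (u n j * star (v p i))) =
      scal A (Matrix.of fun n p => haar (u n j * star (v p i))) * v := by
  have h1 : ∀ l k, ∑ n, ∑ m, haar (u n j * star (v m i)) • (u l n * star (v k m)) =
      haar (u l j * star (v k i)) • (1 : A) := by
    intro l k
    have h := haar_left (u l j * star (v k i))
    rw [Bialgebra.comul_mul, comul_star, hu.comul, hv.comul, star_sum, Finset.sum_mul] at h
    simpa only [TensorProduct.star_tmul, Finset.mul_sum, Algebra.TensorProduct.tmul_mul_tmul,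
      map_sum, LinearMap.lTensor_tmul, TensorProduct.rid_tmul] using h
  have h2 : (u * scal A (Matrix.of fun n p => haar (u n j * star (v p i)))) * star v =
      scal A (Matrix.of fun n p => haar (u n j * star (v p i))) := by
    ext l k
    rw [Matrix.mul_apply]
    simp only [mul_scal_apply, Matrix.star_apply, Matrix.of_apply, Finset.sum_mul, smul_mul_assoc]
    rw [Finset.sum_comm, h1 l k, scal, Matrix.map_apply, Algebra.algebraMap_eq_smul_one,
      Matrix.of_apply]
  calc _ = ((u * scal A (Matrix.of fun n p => haar (u n j * star (v p i)))) * star v) * v := by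
        rw [Matrix.mul_assoc _ (star v), hv.star_mul_self, Matrix.mul_one]
    _ = _ := by rw [h2]

theorem IrrRep.isIrred (x : IrrRep A) : IsIrred x.coeff := x.irreducible

theorem eq_zero_of_intertwines {x y : IrrRep A} (h : x.cls ≠ y.cls)
    {T : Matrix (Fin y.dim) (Fin x.dim) ℂ} (hT : scal A T * x.coeff = y.coeff * scal A T) :
    T = 0 := by
  by_contra h0
  refine h (Quotient.sound ?_)
  have h1 := (intertwines_toLin' _ _ _).2 hT
  have h2 := x.isIrred.bijective y.isIrred h1 (by simpa using h0)
  exact ⟨LinearEquiv.ofBijective _ h2, h1⟩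

theorem haar_star_mul_eq_zero {x y : IrrRep A} (h : x.cls ≠ y.cls) (k p : Fin x.dim)
    (l n : Fin y.dim) : haar (star (x.coeff k p) * y.coeff l n) = 0 :=
  congrFun (congrFun (eq_zero_of_intertwines h.symm
    (haar_intertwines y.isUnitaryCorep.toIsCorep x.isUnitaryCorep k l)) p) n

theorem haar_mul_star_eq_zero {x y : IrrRep A} (h : x.cls ≠ y.cls) (n j : Fin x.dim)
    (p i : Fin y.dim) : haar (x.coeff n j * star (y.coeff p i)) = 0 :=
  congrFun (congrFun (eq_zero_of_intertwines h.symm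
    (haar_intertwines_star x.isUnitaryCorep.toIsCorep y.isUnitaryCorep j i).symm) n) p

end PeterWeyl

end CompactQuantumGroup

/-! ### Adjoints of coefficients and the decomposition of `A` into blocks -/

namespace CompactQuantumGroup

variable {A : Type*} [Ring A] [StarRing A] [HopfAlgebra ℂ A] [StarModule ℂ A]
  [CompactQuantumGroup A]
variable {I J : Type*} [Fintype I] [Fintype J] [DecidableEq I] [DecidableEq J]

/-- The functional `a ↦ conj f(a*)`. -/
noncomputable def starFunctional (f : A →ₗ[ℂ] ℂ) : A →ₗ[ℂ] ℂ where
  toFun a := (starRingEnd ℂ) (f (star a))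
  map_add' a b := by simp
  map_smul' c a := by simp

theorem starFunctional_apply (f : A →ₗ[ℂ] ℂ) (a : A) :
    starFunctional f a = (starRingEnd ℂ) (f (star a)) := rfl

theorem Lc_starFunctional (f : A →ₗ[ℂ] ℂ) (a : A) :
    Lc (starFunctional f) a = star (Lc f (star a)) := by
  rw [Lc_apply, Lc_apply, comul_star]
  induction Coalgebra.comul (R := ℂ) a with
  | zero => simp
  | add x y hx hy => simp only [map_add, star_add, hx, hy]
  | tmul x y => simp [starFunctional_apply]

/-- The functional `a ↦ conj ε(a*)` also acts as the identity by left convolution, and a functional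
is determined by its convolution operator. -/
theorem counit_star (a : A) :
    Coalgebra.counit (R := ℂ) (star a) = (starRingEnd ℂ) (Coalgebra.counit (R := ℂ) a) := by
  have h : starFunctional (Coalgebra.counit (R := ℂ)) = Coalgebra.counit (R := ℂ) (A := A) := by
    refine Lc_injective fun a => ?_
    rw [Lc_starFunctional, Lc_counit, Lc_counit, star_star]
  rw [← h, starFunctional_apply, star_star]
  simp [h]

/-- The conjugate matrix is a corepresentation, but it need not be unitary. -/
theorem IsCorep.map_star {t : Matrix I I A} (ht : IsCorep t) : IsCorep (t.map star) := by
  refine ⟨fun i j => ?_, fun i j => ?_⟩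
  · simp [comul_star, ht.comul]
  · rw [Matrix.map_apply, counit_star, ht.counit]
    by_cases hij : i = j <;> simp [hij, Matrix.one_apply]

theorem act_star (t : Matrix I I A) (f : A →ₗ[ℂ] ℂ) (x : I → ℂ) :
    act t f (star x) = star (act (t.map star) (starFunctional f) x) := by
  ext i
  simp [act, Matrix.mulVec, dotProduct, starFunctional_apply]

theorem IsIrred.map_star {t : Matrix I I A} (ht : IsIrred t) : IsIrred (t.map star) := by
  intro V hV
  let V' : Submodule ℂ (I → ℂ) :=
    { carrier := {x | star x ∈ V}
      add_mem' := fun {a b} ha hb => by simpa using V.add_mem ha hb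
      zero_mem' := by simp
      smul_mem' := fun c x hx => by simpa [star_smul] using V.smul_mem (star c) hx }
  have hmem : ∀ x, x ∈ V' ↔ star x ∈ V := fun x => Iff.rfl
  rcases ht V' (fun f x hx => by
    have := hV (starFunctional f) _ hx
    rw [hmem]
    have h2 := act_star t f (star x)
    rw [star_star] at h2
    rwa [h2, star_star]) with h | h
  · left
    rw [eq_bot_iff] at h ⊢
    intro x hx
    have := h ((hmem (star x)).2 (by simpa using hx))
    simpa using this
  · right
    rw [eq_top_iff] at h ⊢
    intro x _
    have := (hmem (star x)).1 (h trivial)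
    simpa using this

theorem mem_coeffSpan_map_star {I J : Type*} (t : Matrix I J A) (a : A) :
    a ∈ coeffSpan (t.map star) ↔ star a ∈ coeffSpan t := by
  have key : ∀ (s : Matrix I J A) (b : A), b ∈ coeffSpan s → star b ∈ coeffSpan (s.map star) := by
    intro s b hb
    induction hb using Submodule.span_induction with
    | mem x hx =>
      obtain ⟨p, rfl⟩ := hx
      exact mem_coeffSpan (s.map star) p.1 p.2
    | zero => simp
    | add x y _ _ hx hy => rw [star_add]; exact add_mem hx hy
    | smul c x _ hx => rw [star_smul]; exact Submodule.smul_mem _ _ hx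
  constructor
  · intro h
    have := key _ _ h
    rwa [Matrix.map_map, show (star ∘ star : A → A) = id from funext star_star, Matrix.map_id] at this
  · intro h
    simpa using key _ _ h

theorem coeffSpan_eq_of_bijective {u : Matrix I I A} {v : Matrix J J A}
    {T : (I → ℂ) →ₗ[ℂ] (J → ℂ)} (h : Intertwines u v T) (hT : Function.Bijective T) :
    coeffSpan u = coeffSpan v := by
  refine le_antisymm (coeffSpan_le_of_injective h hT.1) ?_
  have h' : Intertwines u v (LinearEquiv.ofBijective T hT).toLinearMap := h
  exact coeffSpan_le_of_injective h'.symm (LinearEquiv.injective _)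

theorem coeffSpan_eq_of_cls_eq {x y : IrrRep A} (h : x.cls = y.cls) :
    coeffSpan x.coeff = coeffSpan y.coeff := by
  obtain ⟨T, hT⟩ := Quotient.exact h
  exact coeffSpan_eq_of_bijective hT T.bijective

/-- A representative of a class in `Irr(K)`. -/
noncomputable def rep (μ : Irr A) : IrrRep A := Quotient.out μ

theorem rep_cls (μ : Irr A) : (rep μ).cls = μ := Quotient.out_eq μ

/-- The coefficients of `μ`. -/
noncomputable def coeffs (μ : Irr A) : Submodule ℂ A := coeffSpan (rep μ).coeff

/-- The matrix with entries `u i j *`, where `u` represents `μ`. -/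
noncomputable def conjCoeff (μ : Irr A) : Matrix (Fin (rep μ).dim) (Fin (rep μ).dim) A :=
  (rep μ).coeff.map star

/-- The adjoints of the coefficients of `μ`. -/
noncomputable def starCoeffs (μ : Irr A) : Submodule ℂ A := coeffSpan (conjCoeff μ)

theorem coeffSpan_eq_coeffs (x : IrrRep A) : coeffSpan x.coeff = coeffs x.cls :=
  coeffSpan_eq_of_cls_eq (rep_cls _).symm

theorem mem_starCoeffs {μ : Irr A} {a : A} : a ∈ starCoeffs μ ↔ star a ∈ coeffs μ :=
  mem_coeffSpan_map_star _ _

theorem star_mem_starCoeffs {μ : Irr A} {a : A} : star a ∈ starCoeffs μ ↔ a ∈ coeffs μ := by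
  rw [mem_starCoeffs, star_star]

theorem isCorep_conjCoeff (μ : Irr A) : IsCorep (conjCoeff μ) :=
  (rep μ).isUnitaryCorep.toIsCorep.map_star

instance (μ : Irr A) : Module.Finite ℂ (starCoeffs μ) := by
  unfold starCoeffs coeffSpan
  exact Module.Finite.span_of_finite ℂ (Set.finite_range _)

theorem starCoeffs_induction {μ : Irr A} {p : A → Prop} (h : ∀ i j, p (conjCoeff μ i j))
    (h0 : p 0) (hadd : ∀ a b, p a → p b → p (a + b)) (hsmul : ∀ (c : ℂ) a, p a → p (c • a))
    {a : A} (ha : a ∈ starCoeffs μ) : p a := by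
  induction ha using Submodule.span_induction with
  | mem x hx => obtain ⟨q, rfl⟩ := hx; exact h _ _
  | zero => exact h0
  | add x y _ _ hx hy => exact hadd _ _ hx hy
  | smul c x _ hx => exact hsmul _ _ hx

theorem iSup_coeffs : ⨆ μ : Irr A, coeffs μ = ⊤ := by
  rw [eq_top_iff, ← iSup_coeffSpan]
  exact iSup_le fun x => (coeffSpan_eq_coeffs x).le.trans (le_iSup coeffs x.cls)

theorem iSup_starCoeffs : ⨆ μ : Irr A, starCoeffs μ = ⊤ := by
  have key : ∀ b ∈ ⨆ μ : Irr A, coeffs μ, star b ∈ ⨆ μ : Irr A, starCoeffs μ := by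
    intro b hb
    induction hb using Submodule.iSup_induction' with
    | mem μ x hx => exact Submodule.mem_iSup_of_mem μ (star_mem_starCoeffs.2 hx)
    | zero => simp
    | add x y _ _ hx hy => rw [star_add]; exact add_mem hx hy
  rw [eq_top_iff]
  intro a _
  rw [← star_star a]
  exact key _ (by rw [iSup_coeffs]; trivial)

/-- To prove a statement about all elements of `A`, consider the matrix entries. -/
theorem induction_conjCoeff {p : A → Prop} (h : ∀ μ i j, p (conjCoeff μ i j))
    (h0 : p 0) (hadd : ∀ a b, p a → p b → p (a + b)) (hsmul : ∀ (c : ℂ) a, p a → p (c • a))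
    (a : A) : p a := by
  have ha : a ∈ ⨆ μ : Irr A, starCoeffs μ := by rw [iSup_starCoeffs]; trivial
  induction ha using Submodule.iSup_induction' with
  | mem μ x hx => exact starCoeffs_induction (h μ) h0 hadd hsmul hx
  | zero => exact h0
  | add x y _ _ hx hy => exact hadd _ _ hx hy

theorem Lc_mem_starCoeffs (f : A →ₗ[ℂ] ℂ) {μ : Irr A} {a : A} (ha : a ∈ starCoeffs μ) :
    Lc f a ∈ starCoeffs μ := by
  refine starCoeffs_induction (p := fun a => Lc f a ∈ starCoeffs μ) (fun i j => ?_) (by simp)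
    (fun a b h h' => by rw [map_add]; exact add_mem h h')
    (fun c a h => by rw [map_smul]; exact Submodule.smul_mem _ _ h) ha
  rw [(isCorep_conjCoeff μ).Lc]
  exact Submodule.sum_mem _ fun k _ => Submodule.smul_mem _ _ (mem_coeffSpan _ _ _)

/-- As the elements are adjoints of coefficients, this uses the orthogonality relation for `φ(b
a*)`; the next statement uses the one for `φ(a* b)`. Both are needed to diagonalise the modular
operator block by block. -/
theorem haar_star_mul_of_mem {μ ν : Irr A} (h : μ ≠ ν) {a b : A} (ha : a ∈ starCoeffs μ)
    (hb : b ∈ starCoeffs ν) : haar (star a * b) = 0 := by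
  refine starCoeffs_induction (p := fun a => haar (star a * b) = 0) (fun i j => ?_) (by simp) (fun a b h h' => by simp [add_mul, h, h'])
    (fun c a h => by simp [h]) ha
  refine starCoeffs_induction (p := fun b => haar (star (conjCoeff μ i j) * b) = 0) (fun k l => ?_) (by simp) (fun a b h h' => by simp [mul_add, h, h'])
    (fun c a h => by simp [h]) hb
  simpa [conjCoeff] using haar_mul_star_eq_zero (x := rep μ) (y := rep ν)
    (by rwa [rep_cls, rep_cls]) i j k l

theorem haar_mul_star_of_mem {μ ν : Irr A} (h : μ ≠ ν) {a b : A} (ha : a ∈ starCoeffs μ)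
    (hb : b ∈ starCoeffs ν) : haar (a * star b) = 0 := by
  refine starCoeffs_induction (p := fun a => haar (a * star b) = 0) (fun i j => ?_) (by simp) (fun a b h h' => by simp [add_mul, h, h'])
    (fun c a h => by simp [h]) ha
  refine starCoeffs_induction (p := fun b => haar (conjCoeff μ i j * star b) = 0) (fun k l => ?_) (by simp) (fun a b h h' => by simp [mul_add, h, h'])
    (fun c a h => by simp [h]) hb
  simpa [conjCoeff] using haar_star_mul_eq_zero (x := rep μ) (y := rep ν)
    (by rwa [rep_cls, rep_cls]) i j k l

theorem starCoeffs_ne_bot (μ : Irr A) : starCoeffs μ ≠ ⊥ := by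
  intro h
  let i : Fin (rep μ).dim := ⟨0, (rep μ).dim_pos⟩
  have h1 : conjCoeff μ i i ∈ starCoeffs μ := mem_coeffSpan _ _ _
  rw [h, Submodule.mem_bot] at h1
  have h2 := (isCorep_conjCoeff μ).counit i i
  simp [h1] at h2

/-! ### Tensor products and conjugates -/

theorem isUnitaryCorep_tensorMatrix {u : Matrix I I A} {v : Matrix J J A} (hu : IsUnitaryCorep u)
    (hv : IsUnitaryCorep v) : IsUnitaryCorep (tensorMatrix u v) := by
  refine ⟨⟨fun p q => ?_, fun p q => ?_⟩, ?_⟩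
  · simp only [tensorMatrix, Matrix.of_apply, Bialgebra.comul_mul, hu.comul, hv.comul,
      Finset.sum_mul_sum, Algebra.TensorProduct.tmul_mul_tmul, Fintype.sum_prod_type]
    exact Finset.sum_comm
  · simp only [tensorMatrix, Matrix.of_apply, Bialgebra.counit_mul, hu.counit, hv.counit,
      Matrix.one_apply, Prod.ext_iff]
    by_cases h1 : p.1 = q.1 <;> by_cases h2 : p.2 = q.2 <;> simp [h1, h2]
  · ext p q
    have h1 : ∀ i j, ∑ k, star (u k i) * u k j = (1 : Matrix I I A) i j := fun i j => by
      rw [← hu.star_mul_self, Matrix.mul_apply]; rfl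
    have h2 : ∀ i j, ∑ k, star (v k i) * v k j = (1 : Matrix J J A) i j := fun i j => by
      rw [← hv.star_mul_self, Matrix.mul_apply]; rfl
    rw [Matrix.mul_apply, Fintype.sum_prod_type]
    simp only [Matrix.star_apply, tensorMatrix, Matrix.of_apply, star_mul]
    have h3 : ∀ x, ∑ y, star (u x p.1) * star (v y p.2) * (v y q.2 * u x q.1) =
        star (u x p.1) * (1 : Matrix J J A) p.2 q.2 * u x q.1 := by
      intro x
      rw [← h2, Finset.mul_sum, Finset.sum_mul]
      exact Finset.sum_congr rfl fun y _ => by simp only [mul_assoc]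
    simp only [h3]
    by_cases h : p.2 = q.2
    · rw [h]
      simp only [Matrix.one_apply_eq, mul_one, h1]
      simp [Matrix.one_apply, Prod.ext_iff, h]
    · simp [Prod.ext_iff, h]

/-- The adjoint of `(u i j)* (v k l)*` is `v k l * u i j`, an entry of `tensorMatrix`. The reversed
order there therefore makes the products of adjoints come in the order `lam`, `μ`. Then decompose
the tensor product into irreducibles. -/
theorem starCoeffs_mul_le (lam μ : Irr A) :
    starCoeffs lam * starCoeffs μ ≤ ⨆ (ν : Irr A) (_ : SubTensor ν lam μ), starCoeffs ν := by
  rw [Submodule.mul_le]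
  intro a ha b hb
  refine starCoeffs_induction
    (p := fun a => a * b ∈ ⨆ (ν : Irr A) (_ : SubTensor ν lam μ), starCoeffs ν) (fun i j => ?_) (by simp)
    (fun a b h h' => by rw [add_mul]; exact add_mem h h')
    (fun c a h => by rw [smul_mul_assoc]; exact Submodule.smul_mem _ _ h) ha
  refine starCoeffs_induction (p := fun b => conjCoeff lam i j * b ∈
    ⨆ (ν : Irr A) (_ : SubTensor ν lam μ), starCoeffs ν) (fun k l => ?_) (by simp)
    (fun a b h h' => by rw [mul_add]; exact add_mem h h')
    (fun c a h => by rw [mul_smul_comm]; exact Submodule.smul_mem _ _ h) hb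
  have h1 : star (conjCoeff lam i j * conjCoeff μ k l) ∈
      coeffSpan (tensorMatrix (rep lam).coeff (rep μ).coeff) := by
    have := mem_coeffSpan (tensorMatrix (rep lam).coeff (rep μ).coeff) (i, k) (j, l)
    simpa [tensorMatrix, conjCoeff] using this
  have h2 := (isUnitaryCorep_tensorMatrix (rep lam).isUnitaryCorep
    (rep μ).isUnitaryCorep).coeffSpan_le_iSup h1
  rw [← star_star (conjCoeff lam i j * conjCoeff μ k l)]
  have h3 : star (conjCoeff lam i j * conjCoeff μ k l) ∈
      ⨆ (ν : {ν : Irr A // SubTensor ν lam μ}), coeffs ν.1 := by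
    refine SetLike.le_def.1 (iSup₂_le fun x hx => ?_) h2
    rw [coeffSpan_eq_coeffs]
    obtain ⟨T, hT, hT'⟩ := hx
    exact le_iSup (fun ν : {ν : Irr A // SubTensor ν lam μ} => coeffs ν.1)
      ⟨x.cls, x, rep lam, rep μ, rfl, rep_cls _, rep_cls _, T, hT, hT'⟩
  generalize star (conjCoeff lam i j * conjCoeff μ k l) = c at h3
  induction h3 using Submodule.iSup_induction' with
  | mem ν x hx =>
    exact Submodule.mem_iSup_of_mem ν.1 (Submodule.mem_iSup_of_mem ν.2 (star_mem_starCoeffs.2 hx))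
  | zero => simp
  | add x y _ _ hx hy => rw [star_add]; exact add_mem hx hy

/-- An embedding has a linear left inverse, so the coefficients of `ν` are combinations of those of
the tensor product. -/
theorem starCoeffs_le_mul {lam μ ν : Irr A} (h : SubTensor ν lam μ) :
    starCoeffs ν ≤ starCoeffs lam * starCoeffs μ := by
  obtain ⟨x, u, v, rfl, rfl, rfl, T, hT, hT'⟩ := h
  intro a ha
  rw [mem_starCoeffs, ← coeffSpan_eq_coeffs] at ha
  have h1 := coeffSpan_le_of_injective hT' hT ha
  rw [← star_star a]
  generalize star a = c at h1
  induction h1 using Submodule.span_induction with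
  | mem y hy =>
    obtain ⟨p, rfl⟩ := hy
    simp only [tensorMatrix, Matrix.of_apply, star_mul]
    refine Submodule.mul_mem_mul ?_ ?_ <;> rw [star_mem_starCoeffs, ← coeffSpan_eq_coeffs]
    · exact mem_coeffSpan _ _ _
    · exact mem_coeffSpan _ _ _
  | zero => simp
  | add x y _ _ hx hy => rw [star_add]; exact add_mem hx hy
  | smul c x _ hx => rw [star_smul]; exact Submodule.smul_mem _ _ hx

/-- A fixed vector of `u ⊗ v` is the same as an intertwiner from the conjugate of `v` to `u`:
multiply by `v*` to move `v` to the other side, and by `v` to move it back. -/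
theorem tensorMatrix_fixed_iff {u : Matrix I I A} {v : Matrix J J A} (hv : IsUnitaryCorep v)
    (t : Matrix I J ℂ) :
    (∀ i j, ∑ q : I × J, t q.1 q.2 • tensorMatrix u v (i, j) q = t i j • (1 : A)) ↔
      scal A t * v.map star = u * scal A t := by
  have h0 : ∀ i j, ∑ q : I × J, t q.1 q.2 • tensorMatrix u v (i, j) q =
      ∑ l, v j l * (u * scal A t) i l := by
    intro i j
    rw [Fintype.sum_prod_type, Finset.sum_comm]
    simp [mul_scal_apply, tensorMatrix, Finset.mul_sum]
  have h1 : ∀ i j, ∑ k, star (v k i) * v k j = (1 : Matrix J J A) i j := fun i j => by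
    rw [← hv.star_mul_self, Matrix.mul_apply]; rfl
  have h2 : ∀ i j, ∑ k, v i k * star (v j k) = (1 : Matrix J J A) i j := fun i j => by
    rw [← hv.mul_star_self, Matrix.mul_apply]; rfl
  simp only [h0]
  constructor
  · intro h
    ext i n
    rw [scal_mul_apply]
    calc ∑ j, t i j • v.map star j n = ∑ j, star (v j n) * ∑ l, v j l * (u * scal A t) i l := by
          simp [h]
      _ = ∑ l, (∑ j, star (v j n) * v j l) * (u * scal A t) i l := by
          simp only [Finset.mul_sum, Finset.sum_mul, mul_assoc]
          exact Finset.sum_comm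
      _ = _ := by simp [h1, Matrix.one_apply]
  · intro h i j
    rw [← h]
    calc ∑ l, v j l * (scal A t * v.map star) i l = ∑ m, t i m • ∑ l, v j l * star (v m l) := by
          simp only [scal_mul_apply, Finset.mul_sum, Finset.smul_sum, mul_smul_comm]
          exact Finset.sum_comm
      _ = _ := by simp [h2, Matrix.one_apply]

theorem act_trivialRep (f : A →ₗ[ℂ] ℂ) (y : Fin (trivialRep A).dim → ℂ) :
    act (trivialRep A).coeff f y = f 1 • y := by
  ext i
  change ((1 : Matrix (Fin 1) (Fin 1) A).map f).mulVec y i = f 1 * y i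
  obtain rfl : i = (0 : Fin 1) := Subsingleton.elim (α := Fin 1) _ _
  simp [Matrix.mulVec, dotProduct]

/-- The copy of the trivial representation is a nonzero fixed vector, hence a nonzero intertwiner
from the conjugate of `μ'` to `μ`. Both are irreducible, so it is bijective and the coefficients
agree. -/
theorem isConj_coeffs {μ μ' : Irr A} (h : IsConj μ μ') : starCoeffs μ' = coeffs μ := by
  obtain ⟨x, u, v, hx, rfl, rfl, T, hT, hT'⟩ := h
  obtain ⟨S, hS⟩ := Quotient.exact hx.symm
  have hTS : Intertwines (trivialRep A).coeff (tensorMatrix u.coeff v.coeff) (T ∘ₗ S.toLinearMap) := by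
    intro f
    rw [LinearMap.comp_assoc, hS f, ← LinearMap.comp_assoc, hT' f, LinearMap.comp_assoc]
  let t0 : Fin u.dim × Fin v.dim → ℂ := (T ∘ₗ S.toLinearMap) (fun _ => 1)
  have ht0 : t0 ≠ 0 := by
    intro h0
    have := (hT.comp S.injective) (h0.trans (map_zero (T ∘ₗ S.toLinearMap)).symm)
    have h2 := congrFun this ⟨0, (trivialRep A).dim_pos⟩
    simp at h2
  let t : Matrix (Fin u.dim) (Fin v.dim) ℂ := Matrix.of fun i j => t0 (i, j)
  have hfix := (tensorMatrix_fixed_iff (u := u.coeff) v.isUnitaryCorep t).1 (by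
    intro i j
    rw [← sub_eq_zero, ← Module.forall_dual_apply_eq_zero_iff ℂ]
    intro f
    have h1 := congrFun (LinearMap.congr_fun (hTS f) (fun _ => 1)) (i, j)
    rw [LinearMap.comp_apply, act_trivialRep, map_smul] at h1
    rw [map_sub, sub_eq_zero, map_sum]
    have h3 : (act (tensorMatrix u.coeff v.coeff) f t0) (i, j) =
        ∑ q : Fin u.dim × Fin v.dim, f (tensorMatrix u.coeff v.coeff (i, j) q) * t0 q := rfl
    have h4 : f 1 * t0 (i, j) = (act (tensorMatrix u.coeff v.coeff) f t0) (i, j) := h1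
    rw [h3] at h4
    simp only [map_smul, smul_eq_mul]
    rw [mul_comm (t i j)]
    refine Eq.trans (Finset.sum_congr rfl fun q _ => ?_) h4.symm
    rw [mul_comm]
    rfl)
  have hint := (intertwines_toLin' _ _ _).2 hfix
  have hbij := v.isIrred.map_star.bijective u.isIrred hint (by
    intro h0
    apply ht0
    have h1 : t = 0 := by simpa using h0
    ext ⟨i, j⟩
    exact congrFun (congrFun h1 i) j)
  have h5 := coeffSpan_eq_of_bijective hint hbij
  rw [← coeffSpan_eq_coeffs, ← h5]
  ext a
  rw [mem_starCoeffs, mem_coeffSpan_map_star, coeffSpan_eq_coeffs]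

/-- The conjugate matrix is irreducible but perhaps not unitary; the averaging argument makes it
equivalent to a unitary `v`. The inverse of this equivalence, with conjugated entries, is the
required fixed vector of `u ⊗ v`. -/
theorem exists_isConj (μ : Irr A) : ∃ μ' : Irr A, IsConj μ μ' := by
  let u := rep μ
  let i : Fin u.dim := ⟨0, u.dim_pos⟩
  have hubar := isCorep_conjCoeff μ
  -- Otherwise the entry would be orthogonal to all of `A`, hence zero, although its counit is `1`.
  obtain ⟨v, k, p, hvk⟩ : ∃ (v : IrrRep A) (k p : Fin v.dim),
      haar (star (v.coeff k p) * conjCoeff μ i i) ≠ 0 := by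
    by_contra! h
    have h1 : ∀ a ∈ ⨆ x : IrrRep A, coeffSpan x.coeff, haar (star a * conjCoeff μ i i) = 0 := by
      intro a ha
      induction ha using Submodule.iSup_induction' with
      | mem x y hy =>
        induction hy using Submodule.span_induction with
        | mem y hy => obtain ⟨q, rfl⟩ := hy; exact h _ _ _
        | zero => simp
        | add x y _ _ hx hy => simp [add_mul, hx, hy]
        | smul c x _ hx => simp [hx]
      | zero => simp
      | add x y _ _ hx hy => simp [add_mul, hx, hy]
    rw [iSup_coeffSpan] at h1
    have h2 := haar_faithful _ (h1 _ (Submodule.mem_top (x := conjCoeff μ i i)))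
    have h3 := hubar.counit i i
    simp [h2] at h3
  have hE := (intertwines_toLin' _ _ _).2 (haar_intertwines hubar v.isUnitaryCorep k i)
  have hbij := u.isIrred.map_star.bijective v.isIrred hE (by
    intro h0
    have h1 : (Matrix.of fun p n => haar (star (v.coeff k p) * conjCoeff μ i n)) = 0 := by
      simpa using h0
    exact hvk (congrFun (congrFun h1 p) i))
  let Y := LinearEquiv.ofBijective _ hbij
  have hY : Intertwines (conjCoeff μ) v.coeff Y.toLinearMap := hE
  have hZ := (intertwines_iff _ _ _).1 hY.symm
  set Z : Matrix (Fin u.dim) (Fin v.dim) ℂ := LinearMap.toMatrix' Y.symm.toLinearMap with hZdef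
  have hfix : scal A (Z.map star) * v.coeff.map star = u.coeff * scal A (Z.map star) := by
    ext a b
    have h1 := congrArg star (congrFun (congrFun hZ a) b)
    rw [scal_mul_apply, mul_scal_apply] at h1 ⊢
    simpa [conjCoeff, u] using h1
  have hfix2 := (tensorMatrix_fixed_iff (u := u.coeff) v.isUnitaryCorep (Z.map star)).2 hfix
  refine ⟨v.cls, trivialRep A, u, v, rfl, rep_cls _, rfl, ?_⟩
  let t0 : Fin u.dim × Fin v.dim → ℂ := fun q => Z.map star q.1 q.2
  have ht0 : t0 ≠ 0 := by
    intro h0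
    have hZ0 : Z = 0 := by
      ext a b
      have := congrFun h0 (a, b)
      simpa [t0] using this
    have h1 : Y.symm.toLinearMap = 0 := by simpa [hZdef] using hZ0
    have h2 := LinearMap.congr_fun h1 (Y (fun _ => 1))
    have h3 := congrFun h2 i
    simp at h3
  obtain ⟨P, hP⟩ : ∃ P : (Fin (trivialRep A).dim → ℂ) →ₗ[ℂ] (Fin u.dim × Fin v.dim → ℂ),
      ∀ x, P x = x ⟨0, (trivialRep A).dim_pos⟩ • t0 :=
    ⟨LinearMap.toSpanSingleton ℂ _ t0 ∘ₗ
      LinearMap.proj (⟨0, (trivialRep A).dim_pos⟩ : Fin (trivialRep A).dim), fun _ => rfl⟩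
  refine ⟨P, ?_, ?_⟩
  · intro x y hxy
    rw [hP, hP] at hxy
    ext j
    obtain rfl : j = ⟨0, (trivialRep A).dim_pos⟩ := Subsingleton.elim (α := Fin 1) _ _
    exact smul_left_injective ℂ ht0 hxy
  · intro f
    refine LinearMap.ext fun x => funext fun q => ?_
    obtain ⟨a, b⟩ := q
    have h1 := congrArg f (hfix2 a b)
    simp only [map_sum, map_smul, smul_eq_mul] at h1
    have h3 : (act (tensorMatrix u.coeff v.coeff) f t0) (a, b) =
        ∑ q : Fin u.dim × Fin v.dim, f (tensorMatrix u.coeff v.coeff (a, b) q) * t0 q := rfl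
    have h4 : (act (tensorMatrix u.coeff v.coeff) f t0) (a, b) = f 1 * t0 (a, b) := by
      rw [h3, mul_comm (f 1)]
      refine Eq.trans (Finset.sum_congr rfl fun q _ => ?_) h1
      rw [mul_comm]
    rw [LinearMap.comp_apply, LinearMap.comp_apply, act_trivialRep, map_smul, hP, map_smul,
      Pi.smul_apply, Pi.smul_apply, Pi.smul_apply, h4]
    simp only [smul_eq_mul]
    ring

end CompactQuantumGroup

/-! ### A basis of `A` that diagonalises the modular operator -/

namespace CompactQuantumGroup

variable {A : Type*} [Ring A] [StarRing A] [HopfAlgebra ℂ A] [StarModule ℂ A]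
  [CompactQuantumGroup A]

/-- A block has a basis which diagonalises the forms `φ(a* b)` and `φ(b a*)` simultaneously. -/
theorem exists_block_basis (μ : Irr A) : ∃ (n : ℕ) (o : Fin n → A) (d : Fin n → ℝ),
    (∀ i, o i ∈ starCoeffs μ) ∧
    (∀ i j, haar (star (o i) * o j) = if i = j then (1 : ℂ) else 0) ∧
    (∀ i j, haar (o j * star (o i)) = if i = j then (d j : ℂ) else 0) ∧
    starCoeffs μ ≤ Submodule.span ℂ (Set.range o) := by
  let V : Submodule ℂ (PreL2 A) := (starCoeffs μ).map (toPre : A ≃ₗ[ℂ] PreL2 A).toLinearMap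
  have : Module.Finite ℂ V := inferInstance
  let b := stdOrthonormalBasis ℂ V
  let val : V →ₗ[ℂ] A := (toPre : A ≃ₗ[ℂ] PreL2 A).symm.toLinearMap ∘ₗ V.subtype
  have hin : ∀ v w : V, ⟪v, w⟫_ℂ = haar (star (val v) * val w) := fun v w => rfl
  -- The matrix entries are chosen so that `⟪v, D w⟫ = φ(w v*)`. This form is hermitian because `φ`
  -- is, and the eigenvectors of `D` are the required basis.
  let D : V →ₗ[ℂ] V :=
    ∑ i, (haar ∘ₗ LinearMap.mulRight ℂ (star (val (b i))) ∘ₗ val).smulRight (b i)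
  have hDapp : ∀ v, D v = ∑ i, haar (val v * star (val (b i))) • b i := fun v => by
    simp [D, LinearMap.sum_apply]
  have hD : ∀ v w : V, ⟪v, D w⟫_ℂ = haar (val w * star (val v)) := by
    intro v w
    conv_rhs => rw [← b.sum_repr v]
    rw [hin, hDapp]
    simp only [map_sum, map_smul, star_sum, star_smul, Finset.mul_sum, mul_smul_comm, smul_eq_mul,
      b.repr_apply_apply, hin]
    refine Finset.sum_congr rfl fun i _ => ?_
    rw [mul_comm, show (star (haar (star (val (b i)) * val v)) : ℂ) =
      (starRingEnd ℂ) (haar (star (val (b i)) * val v)) from rfl, ← haar_star]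
    simp
  have hsymm : D.IsSymmetric := by
    intro v w
    rw [← inner_conj_symm, hD, hD, ← haar_star]
    simp
  let e := hsymm.eigenvectorBasis rfl
  refine ⟨_, fun i => val (e i), fun i => hsymm.eigenvalues rfl i, ?_, ?_, ?_, ?_⟩
  · intro i
    obtain ⟨x, hx, hxe⟩ := (e i).2
    have : val (e i) = x := by
      change toPre.symm (e i : PreL2 A) = x
      rw [← hxe]
      exact LinearEquiv.symm_apply_apply _ _
    change val (e i) ∈ _
    rwa [this]
  · intro i j
    rw [← hin]
    exact orthonormal_iff_ite.1 e.orthonormal i j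
  · intro i j
    rw [← hD, hsymm.apply_eigenvectorBasis, inner_smul_right]
    have := orthonormal_iff_ite.1 e.orthonormal i j
    rw [show ⟪e i, (hsymm.eigenvectorBasis rfl) j⟫_ℂ = _ from this]
    split_ifs <;> simp
  · intro a ha
    have h := e.sum_repr ⟨toPre a, a, ha, rfl⟩
    have h2 := congrArg val h
    rw [map_sum] at h2
    have h3 : val ⟨toPre a, a, ha, rfl⟩ = a := rfl
    rw [← h3, ← h2]
    refine Submodule.sum_mem _ fun i _ => ?_
    rw [map_smul]
    exact Submodule.smul_mem _ _ (Submodule.subset_span ⟨i, rfl⟩)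

/-- The dimension of a block. -/
noncomputable def blockDim (μ : Irr A) : ℕ := (exists_block_basis μ).choose

/-- The vectors of the modular basis. -/
noncomputable def blockVec (μ : Irr A) : Fin (blockDim μ) → A :=
  (exists_block_basis μ).choose_spec.choose

variable (A) in
/-- The index set of the modular basis. -/
abbrev ModIndex := Σ μ : Irr A, Fin (blockDim μ)

/-- The eigenvalues of the modular operator. -/
noncomputable def modEig (k : ModIndex A) : ℝ :=
  (exists_block_basis k.1).choose_spec.choose_spec.choose k.2

theorem blockVec_spec (μ : Irr A) : (∀ i, blockVec μ i ∈ starCoeffs μ) ∧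
    (∀ i j, haar (star (blockVec μ i) * blockVec μ j) = if i = j then (1 : ℂ) else 0) ∧
    (∀ i j, haar (blockVec μ j * star (blockVec μ i)) =
      if i = j then (modEig ⟨μ, j⟩ : ℂ) else 0) ∧
    starCoeffs μ ≤ Submodule.span ℂ (Set.range (blockVec μ)) :=
  (exists_block_basis μ).choose_spec.choose_spec.choose_spec

theorem blockVec_mem {μ : Irr A} (i : Fin (blockDim μ)) : blockVec μ i ∈ starCoeffs μ :=
  (blockVec_spec μ).1 i

theorem haar_star_blockVec (k l : ModIndex A) [Decidable (k = l)] :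
    haar (star (blockVec k.1 k.2) * blockVec l.1 l.2) = if k = l then (1 : ℂ) else 0 := by
  by_cases h : k.1 = l.1
  · obtain ⟨μ, i⟩ := k
    obtain ⟨ν, j⟩ := l
    obtain rfl : μ = ν := h
    refine ((blockVec_spec μ).2.1 i j).trans ?_
    by_cases hij : i = j
    · simp [hij]
    · have : ¬ ((⟨μ, i⟩ : ModIndex A) = ⟨μ, j⟩) := by simpa using hij
      rw [if_neg hij, if_neg this]
  · rw [haar_star_mul_of_mem h (blockVec_mem _) (blockVec_mem _), if_neg]
    rintro rfl
    exact h rfl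

theorem haar_blockVec_star (k l : ModIndex A) [Decidable (k = l)] :
    haar (blockVec l.1 l.2 * star (blockVec k.1 k.2)) = if k = l then (modEig l : ℂ) else 0 := by
  by_cases h : k.1 = l.1
  · obtain ⟨μ, i⟩ := k
    obtain ⟨ν, j⟩ := l
    obtain rfl : μ = ν := h
    refine ((blockVec_spec μ).2.2.1 i j).trans ?_
    by_cases hij : i = j
    · simp [hij]
    · have : ¬ ((⟨μ, i⟩ : ModIndex A) = ⟨μ, j⟩) := by simpa using hij
      rw [if_neg hij, if_neg this]
  · rw [haar_mul_star_of_mem (Ne.symm h) (blockVec_mem _) (blockVec_mem _), if_neg]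
    rintro rfl
    exact h rfl

theorem starCoeffs_eq_span (μ : Irr A) :
    starCoeffs μ = Submodule.span ℂ (Set.range (blockVec μ)) :=
  le_antisymm (blockVec_spec μ).2.2.2
    (Submodule.span_le.2 (by rintro _ ⟨i, rfl⟩; exact blockVec_mem i))

theorem orthonormal_blockVec : Orthonormal ℂ fun k : ModIndex A => Lam (blockVec k.1 k.2) := by
  classical
  rw [orthonormal_iff_ite]
  intro k l
  rw [inner_Lam, haar_star_blockVec]

theorem Lam_injective : Function.Injective (Lam : A → L2 A) := by
  rw [injective_iff_map_eq_zero]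
  intro a ha
  apply haar_faithful
  rw [← inner_Lam, ha, inner_zero_left]

variable (A) in
/-- A basis of `A` which diagonalises the forms `φ(a* b)` and `φ(b a*)` simultaneously. -/
noncomputable def modBasis : Module.Basis (ModIndex A) ℂ A :=
  Module.Basis.mk (v := fun k : ModIndex A => blockVec k.1 k.2)
    (LinearIndependent.of_comp Lam orthonormal_blockVec.linearIndependent) (by
      rw [← iSup_starCoeffs]
      refine iSup_le fun μ => ?_
      rw [starCoeffs_eq_span, Submodule.span_le]
      rintro _ ⟨i, rfl⟩
      exact Submodule.subset_span ⟨⟨μ, i⟩, rfl⟩)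

theorem modBasis_apply (k : ModIndex A) : modBasis A k = blockVec k.1 k.2 :=
  Module.Basis.mk_apply _ _ _

theorem modBasis_mem (k : ModIndex A) : modBasis A k ∈ starCoeffs k.1 := by
  rw [modBasis_apply]
  exact blockVec_mem _

theorem haar_star_modBasis (k l : ModIndex A) [Decidable (k = l)] :
    haar (star (modBasis A k) * modBasis A l) = if k = l then (1 : ℂ) else 0 := by
  rw [modBasis_apply, modBasis_apply, haar_star_blockVec]

theorem haar_modBasis_star (k l : ModIndex A) [Decidable (k = l)] :
    haar (modBasis A l * star (modBasis A k)) = if k = l then (modEig l : ℂ) else 0 := by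
  rw [modBasis_apply, modBasis_apply, haar_blockVec_star]

/-- The eigenvalue is `φ(a a*)` for the basis vector `a`; positivity and faithfulness apply to `a*`.
Positive eigenvalues make all complex powers available. -/
theorem modEig_pos (k : ModIndex A) : 0 < modEig k := by
  classical
  have h := haar_modBasis_star k k
  rw [if_pos rfl] at h
  have h1 := haar_pos (star (modBasis A k))
  rw [star_star, h] at h1
  refine lt_of_le_of_ne (by simpa using h1.1) fun h0 => ?_
  have h2 : haar (star (star (modBasis A k)) * star (modBasis A k)) = 0 := by
    rw [star_star, h, ← h0]; simp
  have h3 := haar_faithful _ h2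
  exact (modBasis A).ne_zero k (by simpa using h3)

theorem orthonormal_modBasis : Orthonormal ℂ fun k : ModIndex A => Lam (modBasis A k) := by
  simpa only [modBasis_apply] using orthonormal_blockVec

theorem starCoeffs_eq_span_modBasis (μ : Irr A) :
    starCoeffs μ = Submodule.span ℂ (Set.range fun i => modBasis A ⟨μ, i⟩) := by
  simp only [modBasis_apply]
  exact starCoeffs_eq_span μ

theorem topologicalClosure_span_modBasis :
    ⊤ ≤ (Submodule.span ℂ (Set.range fun k : ModIndex A => Lam (modBasis A k))).topologicalClosure := by
  have h : Submodule.span ℂ (Set.range fun k : ModIndex A => Lam (modBasis A k)) =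
      LinearMap.range (Lam : A →ₗ[ℂ] L2 A) := by
    rw [show (Set.range fun k : ModIndex A => Lam (modBasis A k)) =
      Lam '' Set.range (modBasis A) from Set.range_comp _ _, ← Submodule.map_span,
      (modBasis A).span_eq, Submodule.map_top]
  rw [h]
  intro x _
  rw [← SetLike.mem_coe, Submodule.topologicalClosure_coe, LinearMap.coe_range]
  exact denseRange_Lam x

variable (A) in
/-- The Hilbert basis of `L²(K)` given by the modular basis. -/
noncomputable def modHilbert : HilbertBasis (ModIndex A) ℂ (L2 A) :=
  HilbertBasis.mk orthonormal_modBasis topologicalClosure_span_modBasis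

theorem modHilbert_apply (k : ModIndex A) : modHilbert A k = Lam (modBasis A k) := by
  rw [modHilbert, HilbertBasis.coe_mk]

/-! ### Extension of operators from `A` to `L²(K)` -/

theorem exists_extension {m : A →ₗ[ℂ] A} {C : ℝ} (hC : 0 ≤ C)
    (h : ∀ a, ‖Lam (m a)‖ ≤ C * ‖Lam a‖) :
    ∃ X : L2 A →L[ℂ] L2 A, (∀ a, X (Lam a) = Lam (m a)) ∧ ‖X‖ ≤ C :=
  ⟨(Lam ∘ₗ m).extendOfNorm Lam, LinearMap.extendOfNorm_eq denseRange_Lam ⟨C, h⟩,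
    LinearMap.opNorm_extendOfNorm_le (f := Lam ∘ₗ m) denseRange_Lam hC h⟩

theorem clm_ext {E : Type*} [NormedAddCommGroup E] [NormedSpace ℂ E] {X Y : L2 A →L[ℂ] E}
    (h : ∀ a, X (Lam a) = Y (Lam a)) : X = Y :=
  ContinuousLinearMap.coeFn_injective
    (denseRange_Lam.equalizer X.continuous Y.continuous (funext h))

/-- The linear map which is diagonal with respect to the modular basis. -/
noncomputable def diagMap (c : ModIndex A → ℂ) : A →ₗ[ℂ] A :=
  (modBasis A).constr ℂ fun k => c k • modBasis A k

theorem diagMap_modBasis (c : ModIndex A → ℂ) (k : ModIndex A) :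
    diagMap c (modBasis A k) = c k • modBasis A k := by
  rw [diagMap, Module.Basis.constr_basis]

theorem repr_diagMap (c : ModIndex A → ℂ) (a : A) (k : ModIndex A) :
    (modBasis A).repr (diagMap c a) k = c k * (modBasis A).repr a k := by
  classical
  have h : (modBasis A).coord k ∘ₗ diagMap c = c k • (modBasis A).coord k := by
    refine (modBasis A).ext fun l => ?_
    simp only [LinearMap.comp_apply, diagMap_modBasis, map_smul, LinearMap.smul_apply,
      Module.Basis.coord_apply, Module.Basis.repr_self, smul_eq_mul, Finsupp.single_apply]
    split_ifs with hkl
    · rw [hkl]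
    · simp
  exact LinearMap.congr_fun h a

theorem inner_Lam_eq_sum (a b : A) : ⟪Lam a, Lam b⟫_ℂ =
    ((modBasis A).repr a).sum fun k x => (starRingEnd ℂ) x * (modBasis A).repr b k := by
  have h := orthonormal_modBasis.inner_finsupp_eq_sum_left ((modBasis A).repr a)
    ((modBasis A).repr b)
  rw [← h]
  have e : ∀ a : A, Finsupp.linearCombination ℂ (fun k : ModIndex A => Lam (modBasis A k))
      ((modBasis A).repr a) = Lam a := by
    intro a
    conv_rhs => rw [← (modBasis A).linearCombination_repr a]
    rw [Finsupp.apply_linearCombination]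
    rfl
  rw [e, e]

theorem support_diagMap (c : ModIndex A → ℂ) (a : A) :
    ((modBasis A).repr (diagMap c a)).support ⊆ ((modBasis A).repr a).support := by
  intro k hk
  rw [Finsupp.mem_support_iff, repr_diagMap] at hk
  exact Finsupp.mem_support_iff.2 (right_ne_zero_of_mul hk)

theorem inner_diagMap (c : ModIndex A → ℂ) (a b : A) :
    ⟪Lam (diagMap c a), Lam b⟫_ℂ = ⟪Lam a, Lam (diagMap (fun k => (starRingEnd ℂ) (c k)) b)⟫_ℂ := by
  rw [inner_Lam_eq_sum, inner_Lam_eq_sum,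
    Finsupp.sum_of_support_subset _ (support_diagMap c a) _ (by simp), Finsupp.sum]
  refine Finset.sum_congr rfl fun k _ => ?_
  simp only [repr_diagMap, map_mul]
  ring

theorem norm_Lam_sq (a : A) :
    ‖Lam a‖ ^ 2 = ((modBasis A).repr a).sum fun _ x => ‖x‖ ^ 2 := by
  have h := inner_Lam_eq_sum a a
  rw [inner_self_eq_norm_sq_to_K] at h
  have h2 : ((‖Lam a‖ ^ 2 : ℝ) : ℂ) = (((modBasis A).repr a).sum fun _ x => ‖x‖ ^ 2 : ℝ) := by
    push_cast
    rw [← Complex.coe_algebraMap] at *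
    refine h.trans ?_
    rw [Finsupp.sum, Finsupp.sum]
    push_cast
    refine Finset.sum_congr rfl fun k _ => ?_
    rw [mul_comm, Complex.mul_conj, Complex.normSq_eq_norm_sq]
    push_cast
    rfl
  exact_mod_cast h2

theorem norm_diagMap_le {c : ModIndex A → ℂ} {C : ℝ} (hc : ∀ k, ‖c k‖ ≤ C) (hC : 0 ≤ C) (a : A) :
    ‖Lam (diagMap c a)‖ ≤ C * ‖Lam a‖ := by
  refine le_of_sq_le_sq ?_ (by positivity)
  rw [mul_pow, norm_Lam_sq, norm_Lam_sq,
    Finsupp.sum_of_support_subset _ (support_diagMap c a) _ (by simp), Finsupp.sum, Finset.mul_sum]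
  refine Finset.sum_le_sum fun k _ => ?_
  rw [repr_diagMap, norm_mul, mul_pow]
  have := hc k
  gcongr

end CompactQuantumGroup

namespace CompactQuantumGroup

variable {A : Type*} [Ring A] [StarRing A] [HopfAlgebra ℂ A] [StarModule ℂ A]
  [CompactQuantumGroup A]

/-! ### The blocks of `L²(K)` -/

theorem block_eq_map (μ : Irr A) : block μ = (starCoeffs μ).map (Lam : A →ₗ[ℂ] L2 A) := by
  have h : Submodule.span ℂ {ξ | ∃ u : IrrRep A, u.cls = μ ∧
      ∃ i j, ξ = Lam (star (u.coeff i j))} = (starCoeffs μ).map (Lam : A →ₗ[ℂ] L2 A) := by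
    apply le_antisymm
    · rw [Submodule.span_le]
      rintro _ ⟨u, rfl, i, j, rfl⟩
      refine ⟨_, star_mem_starCoeffs.2 ?_, rfl⟩
      rw [← coeffSpan_eq_coeffs]
      exact mem_coeffSpan _ _ _
    · rw [Submodule.map_le_iff_le_comap]
      intro a ha
      refine starCoeffs_induction (p := fun a => a ∈ Submodule.comap (Lam : A →ₗ[ℂ] L2 A) _)
        (fun i j => ?_) (zero_mem _) (fun a b ha hb => add_mem ha hb)
        (fun c a ha => Submodule.smul_mem _ _ ha) ha
      exact Submodule.subset_span ⟨rep μ, rep_cls μ, i, j, rfl⟩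
  rw [block, h]
  exact (Submodule.closed_of_finiteDimensional _).submodule_topologicalClosure_eq

theorem Lam_mem_block {μ : Irr A} {a : A} (ha : a ∈ starCoeffs μ) : Lam a ∈ block μ := by
  rw [block_eq_map]
  exact ⟨a, ha, rfl⟩

theorem exists_of_mem_block {μ : Irr A} {ξ : L2 A} (h : ξ ∈ block μ) :
    ∃ a ∈ starCoeffs μ, Lam a = ξ := by
  rwa [block_eq_map] at h

theorem blockProj_Lam_self {μ : Irr A} {a : A} (ha : a ∈ starCoeffs μ) :
    blockProj μ (Lam a) = Lam a :=
  Submodule.starProjection_eq_self_iff.2 (Lam_mem_block ha)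

theorem blockProj_Lam_of_ne {μ ν : Irr A} (h : μ ≠ ν) {a : A} (ha : a ∈ starCoeffs ν) :
    blockProj μ (Lam a) = 0 := by
  refine (Submodule.starProjection_apply_eq_zero_iff _).2 ?_
  rw [Submodule.mem_orthogonal]
  intro ξ hξ
  obtain ⟨b, hb, rfl⟩ := exists_of_mem_block hξ
  rw [inner_Lam, haar_star_mul_of_mem h hb ha]

theorem blockProj_mem_block (μ : Irr A) (ξ : L2 A) : blockProj μ ξ ∈ block μ :=
  Submodule.starProjection_apply_mem _ _

/-- To prove that two operators are equal, it suffices to consider vectors from the blocks. -/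
theorem clm_ext_block {E : Type*} [NormedAddCommGroup E] [NormedSpace ℂ E] {X Y : L2 A →L[ℂ] E}
    (h : ∀ μ, ∀ a ∈ starCoeffs μ, X (Lam a) = Y (Lam a)) : X = Y := by
  refine clm_ext fun a => ?_
  refine induction_conjCoeff (p := fun a => X (Lam a) = Y (Lam a))
    (fun μ i j => h μ _ (mem_coeffSpan _ _ _)) (by simp) (fun a b ha hb => by simp [ha, hb])
    (fun c a ha => by simp [ha]) a

theorem linearMap_ext_block {E : Type*} [AddCommGroup E] [Module ℂ E] {X Y : A →ₗ[ℂ] E}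
    (h : ∀ μ, ∀ a ∈ starCoeffs μ, X a = Y a) : X = Y := by
  refine LinearMap.ext fun a => ?_
  refine induction_conjCoeff (p := fun a => X a = Y a)
    (fun μ i j => h μ _ (mem_coeffSpan _ _ _)) (by simp) (fun a b ha hb => by simp [ha, hb])
    (fun c a ha => by simp [ha]) a

theorem blockProj_apply (μ : Irr A) (ξ : L2 A) : blockProj μ ξ =
    ∑ i, ⟪Lam (modBasis A ⟨μ, i⟩), ξ⟫_ℂ • Lam (modBasis A ⟨μ, i⟩) := by
  have h : blockProj μ = ∑ i, (innerSL ℂ (Lam (modBasis A ⟨μ, i⟩))).smulRight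
      (Lam (modBasis A ⟨μ, i⟩)) := by
    refine clm_ext fun a => ?_
    classical
    have h2 : (blockProj μ).toLinearMap ∘ₗ Lam = (∑ i, (innerSL ℂ (Lam (modBasis A ⟨μ, i⟩))).smulRight
      (Lam (modBasis A ⟨μ, i⟩))).toLinearMap ∘ₗ Lam := by
      refine (modBasis A).ext fun k => ?_
      simp only [LinearMap.comp_apply, ContinuousLinearMap.coe_coe, sum_apply,
        ContinuousLinearMap.smulRight_apply, innerSL_apply_apply, inner_Lam, haar_star_modBasis]
      by_cases hk : k.1 = μ
      · obtain ⟨ν, j⟩ := k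
        obtain rfl : ν = μ := hk
        rw [blockProj_Lam_self (modBasis_mem (⟨ν, j⟩ : ModIndex A))]
        simp [Sigma.mk.injEq]
      · rw [blockProj_Lam_of_ne (Ne.symm hk) (modBasis_mem _)]
        symm
        refine Finset.sum_eq_zero fun i _ => ?_
        rw [if_neg, zero_smul]
        rintro rfl
        exact hk rfl
    exact LinearMap.congr_fun h2 a
  rw [h]
  simp

theorem hasSum_blockProj (ξ : L2 A) : HasSum (fun μ : Irr A => blockProj μ ξ) ξ := by
  have h := (modHilbert A).hasSum_repr ξ
  refine h.sigma fun μ => ?_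
  rw [blockProj_apply]
  simp only [(modHilbert A).repr_apply_apply, modHilbert_apply]
  exact hasSum_fintype _

/-! ### Adjoints of convolution operators -/

/-- The functional `a ↦ conj f(S(a*))`. -/
noncomputable def adjFunctional (f : A →ₗ[ℂ] ℂ) : A →ₗ[ℂ] ℂ :=
  starFunctional (f ∘ₗ HopfAlgebra.antipode ℂ)

theorem adjFunctional_conjCoeff (f : A →ₗ[ℂ] ℂ) (μ : Irr A) (i j) :
    adjFunctional f (conjCoeff μ i j) = (starRingEnd ℂ) (f (conjCoeff μ j i)) := by
  have h := (rep μ).isUnitaryCorep.toIsCorep.star_eq_antipode (rep μ).isUnitaryCorep.star_mul_self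
  have h1 := congrFun (congrFun h i) j
  rw [Matrix.star_apply] at h1
  simp [adjFunctional, starFunctional_apply, conjCoeff, h1]

/-- Left invariance of the Haar state on `s* t`, followed by right multiplication with the
coefficients `u` of which `t` is the entrywise adjoint: unitarity removes `t` from one side and
leaves `u` on the other. Applying the functional gives the two inner products. -/
theorem inner_Lc (f : A →ₗ[ℂ] ℂ) (a b : A) :
    ⟪Lam (Lc f a), Lam b⟫_ℂ = ⟪Lam a, Lam (Lc (adjFunctional f) b)⟫_ℂ := by
  simp only [inner_Lam]
  refine induction_conjCoeff (p := fun a => haar (star (Lc f a) * b) =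
    haar (star a * Lc (adjFunctional f) b)) (fun ν p q => ?_) (by simp)
    (fun a b ha hb => by simp [add_mul, ha, hb]) (fun c a ha => by simp [ha]) a
  refine induction_conjCoeff (p := fun b => haar (star (Lc f (conjCoeff ν p q)) * b) =
    haar (star (conjCoeff ν p q) * Lc (adjFunctional f) b)) (fun μ l j => ?_) (by simp)
    (fun a b ha hb => by simp [mul_add, ha, hb]) (fun c a ha => by simp [ha]) b
  have hs := isCorep_conjCoeff ν
  have ht := isCorep_conjCoeff μ
  set s := conjCoeff ν
  set t := conjCoeff μ with htdef
  set u := (rep μ).coeff with hu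
  have h1 : ∀ i, ∑ k, ∑ m, haar (star (s m q) * t k j) • (star (s p m) * t i k) =
      haar (star (s p q) * t i j) • (1 : A) := by
    intro i
    have h := haar_left (star (s p q) * t i j)
    rw [Bialgebra.comul_mul, comul_star, hs.comul, ht.comul, star_sum, Finset.sum_mul] at h
    rw [Finset.sum_comm]
    simpa only [TensorProduct.star_tmul, Finset.mul_sum, Algebra.TensorProduct.tmul_mul_tmul,
      map_sum, LinearMap.lTensor_tmul, TensorProduct.rid_tmul] using h
  have h2 : ∀ k, ∑ i, t i k * u i l = (1 : Matrix _ _ A) k l := fun k => by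
    rw [← (rep μ).isUnitaryCorep.star_mul_self, Matrix.mul_apply]; rfl
  have h3 : ∑ m, haar (star (s m q) * t l j) • star (s p m) =
      ∑ i, haar (star (s p q) * t i j) • u i l := by
    calc ∑ m, haar (star (s m q) * t l j) • star (s p m)
        = ∑ k, (∑ m, haar (star (s m q) * t k j) • star (s p m)) * ∑ i, t i k * u i l := by
          simp only [h2]
          simp [Matrix.one_apply]
      _ = ∑ i, (∑ k, ∑ m, haar (star (s m q) * t k j) • (star (s p m) * t i k)) * u i l := by
          simp only [Finset.sum_mul, Finset.mul_sum, smul_mul_assoc, mul_assoc]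
          rw [Finset.sum_comm]
      _ = _ := by simp [h1]
  have h4 := congrArg (starFunctional f) h3
  simp only [map_sum, map_smul, starFunctional_apply, star_star, smul_eq_mul] at h4
  rw [hs.Lc, ht.Lc]
  simp only [star_sum, star_smul, Finset.sum_mul, Finset.mul_sum, smul_mul_assoc, mul_smul_comm,
    map_sum, map_smul, smul_eq_mul]
  rw [htdef]
  simp only [adjFunctional_conjCoeff]
  refine Eq.trans (Finset.sum_congr rfl fun m _ => ?_) (h4.trans (Finset.sum_congr rfl fun m _ => ?_))
  · rw [mul_comm]; rfl
  · rw [mul_comm]; rfl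

theorem Lc_congr {f g : A →ₗ[ℂ] ℂ} {μ : Irr A} (h : ∀ a ∈ starCoeffs μ, f a = g a) {a : A}
    (ha : a ∈ starCoeffs μ) : Lc f a = Lc g a := by
  refine starCoeffs_induction (p := fun a => Lc f a = Lc g a) (fun i j => ?_) (by simp)
    (fun a b ha hb => by simp [ha, hb]) (fun c a ha => by simp [ha]) ha
  rw [(isCorep_conjCoeff μ).Lc, (isCorep_conjCoeff μ).Lc]
  exact Finset.sum_congr rfl fun k _ => by rw [h _ (mem_coeffSpan _ _ _)]

/-- On a given block, every functional is represented by a vector. -/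
theorem exists_haarForm_eq (f : A →ₗ[ℂ] ℂ) (μ : Irr A) : ∃ c ∈ starCoeffs μ,
    ∀ a ∈ starCoeffs μ, haarForm c a = f a := by
  classical
  refine ⟨∑ i, (starRingEnd ℂ) (f (modBasis A ⟨μ, i⟩)) • modBasis A ⟨μ, i⟩,
    Submodule.sum_mem _ fun i _ => Submodule.smul_mem _ _ (modBasis_mem ⟨μ, i⟩), fun a ha => ?_⟩
  rw [starCoeffs_eq_span_modBasis] at ha
  induction ha using Submodule.span_induction with
  | mem x hx =>
    obtain ⟨j, rfl⟩ := hx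
    simp [haarForm_apply, Finset.sum_mul, haar_star_modBasis]
  | zero => simp
  | add x y _ _ hx hy => rw [map_add, map_add, hx, hy]
  | smul c x _ hx => rw [map_smul, map_smul, hx]

/-! ### Slices of the Kac-Takesaki operator -/

theorem LamLam_tmul (a b : A) : LamLam A (a ⊗ₜ b) = tens (Lam a) (Lam b) := rfl

theorem inner_tens (ξ η ξ' η' : L2 A) : ⟪tens ξ η, tens ξ' η'⟫_ℂ = ⟪ξ, ξ'⟫_ℂ * ⟪η, η'⟫_ℂ := by
  change ⟪((ξ ⊗ₜ[ℂ] η : L2 A ⊗[ℂ] L2 A) : L2L2 A), ((ξ' ⊗ₜ[ℂ] η' : L2 A ⊗[ℂ] L2 A) : L2L2 A)⟫_ℂ = _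
  rw [Completion.inner_coe, TensorProduct.inner_tmul]

theorem adjoint_tens (ξ ξ' η' : L2 A) :
    ContinuousLinearMap.adjoint (tens ξ) (tens ξ' η') = ⟪ξ, ξ'⟫_ℂ • η' := by
  refine ext_inner_left ℂ fun v => ?_
  rw [ContinuousLinearMap.adjoint_inner_right, inner_tens, inner_smul_right]

theorem adjoint_tens_LamLam (c : A) (z : A ⊗[ℂ] A) :
    ContinuousLinearMap.adjoint (tens (Lam c)) (LamLam A z) =
      Lam (TensorProduct.lid ℂ A ((haarForm c).rTensor A z)) := by
  induction z with
  | zero => simp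
  | add x y hx hy => simp only [map_add, hx, hy]
  | tmul x y =>
    rw [LamLam_tmul, adjoint_tens, inner_Lam]
    simp [haarForm_apply]

/-- The functional `b ↦ φ(c* b a)`. -/
noncomputable def sliceFunctional (c a : A) : A →ₗ[ℂ] ℂ := haarForm c ∘ₗ LinearMap.mulRight ℂ a

theorem sliceFunctional_apply (c a b : A) : sliceFunctional c a b = haar (star c * (b * a)) := rfl

/-- Slices of `W*` are left convolutions, so the generators of VN(K) are the adjoints of left
convolutions. -/
theorem leftSlice_Wstar_Lam (c a b : A) :
    leftSlice (Lam c) (Lam a) (Wstar A) (Lam b) = Lam (Lc (sliceFunctional c a) b) := by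
  change ContinuousLinearMap.adjoint (tens (Lam c)) (Wstar A (tens (Lam a) (Lam b))) = _
  rw [← LamLam_tmul, Wstar_LamLam, adjoint_tens_LamLam, Lc_apply]
  congr 1
  simp only [Wpre, TensorProduct.lift.tmul, LinearMap.mk₂_apply]
  induction Coalgebra.comul (R := ℂ) b with
  | zero => simp
  | add x y hx hy => simp only [map_add, add_mul, hx, hy]
  | tmul x y => simp [sliceFunctional_apply, haarForm_apply]

theorem adjoint_leftSlice (ξ η : L2 A) (X : L2L2 A →L[ℂ] L2L2 A) :
    ContinuousLinearMap.adjoint (leftSlice ξ η X) =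
      leftSlice η ξ (ContinuousLinearMap.adjoint X) := by
  simp [leftSlice, ContinuousLinearMap.adjoint_comp, ContinuousLinearMap.comp_assoc]

theorem continuous_tens : Continuous (tens : L2 A → L2 A →L[ℂ] L2L2 A) := by
  unfold tens
  fun_prop

theorem continuous_leftSlice (X : L2L2 A →L[ℂ] L2L2 A) :
    Continuous fun p : L2 A × L2 A => leftSlice p.1 p.2 X := by
  unfold leftSlice
  have h := continuous_tens (A := A)
  have h2 : Continuous fun p : L2 A × L2 A => ContinuousLinearMap.adjoint (tens p.1) :=
    ContinuousLinearMap.adjoint.continuous.comp (h.comp continuous_fst)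
  have h3 : Continuous fun p : L2 A × L2 A => X.comp (tens p.2) :=
    continuous_const.clm_comp (h.comp continuous_snd)
  exact h2.clm_comp h3

theorem norm_tens (ξ : L2 A) : ‖tens ξ‖ ≤ ‖ξ‖ := by
  refine ContinuousLinearMap.opNorm_le_bound _ (norm_nonneg _) fun η => ?_
  change ‖((ξ ⊗ₜ[ℂ] η : L2 A ⊗[ℂ] L2 A) : L2L2 A)‖ ≤ _
  rw [Completion.norm_coe, TensorProduct.norm_tmul]

/-- `Λ(A)` is dense and slices depend norm-continuously on both vectors. -/
theorem leftSlice_eq_of_Lam {P : (L2 A →L[ℂ] L2 A) → Prop} (hP : IsClosed {X | P X})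
    {X : L2L2 A →L[ℂ] L2L2 A} (h : ∀ c a, P (leftSlice (Lam c) (Lam a) X)) (ξ η : L2 A) :
    P (leftSlice ξ η X) := by
  have hd : DenseRange (Prod.map (Lam (A := A)) (Lam (A := A))) :=
    denseRange_Lam.prodMap denseRange_Lam
  refine hd.induction_on (p := fun p : L2 A × L2 A => P (leftSlice p.1 p.2 X)) (ξ, η) ?_
    fun p => h p.1 p.2
  exact hP.preimage (continuous_leftSlice X)

/-! ### The elements of `VN(K)` -/

theorem mem_generatedVN {H : Type*} [NormedAddCommGroup H] [InnerProductSpace ℂ H]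
    [CompleteSpace H] {S : Set (H →L[ℂ] H)} {x : H →L[ℂ] H} :
    x ∈ generatedVN S ↔ ∀ y ∈ StarSubalgebra.centralizer ℂ S, y * x = x * y := by
  have h : x ∈ generatedVN S ↔
      x ∈ StarSubalgebra.centralizer ℂ (StarSubalgebra.centralizer ℂ S : Set (H →L[ℂ] H)) := Iff.rfl
  rw [h, StarSubalgebra.mem_centralizer_iff]
  exact ⟨fun h y hy => (h y hy).1, fun h y hy => ⟨h y hy, h _ (star_mem hy)⟩⟩

theorem mem_centralizer_slices {y : L2 A →L[ℂ] L2 A} : y ∈ StarSubalgebra.centralizer ℂ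
    {T | ∃ ξ η : L2 A, T = leftSlice ξ η (W A)} ↔ ∀ ξ η : L2 A,
      leftSlice ξ η (W A) * y = y * leftSlice ξ η (W A) ∧
      leftSlice ξ η (Wstar A) * y = y * leftSlice ξ η (Wstar A) := by
  have hadj : ∀ ξ η, star (leftSlice ξ η (W A)) = leftSlice η ξ (Wstar A) := by
    intro ξ η
    rw [ContinuousLinearMap.star_eq_adjoint, adjoint_leftSlice, W,
      ContinuousLinearMap.adjoint_adjoint]
  rw [StarSubalgebra.mem_centralizer_iff]
  constructor
  · intro h ξ η
    refine ⟨(h _ ⟨ξ, η, rfl⟩).1, ?_⟩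
    have := (h _ ⟨η, ξ, rfl⟩).2
    rwa [hadj] at this
  · rintro h _ ⟨ξ, η, rfl⟩
    refine ⟨(h ξ η).1, ?_⟩
    rw [hadj]
    exact (h η ξ).2

theorem leftSlice_haarForm (c a : A) :
    leftSlice (Lam c) (Lam 1) (Wstar A) (Lam a) = Lam (Lc (haarForm c) a) := by
  have h : sliceFunctional c 1 = haarForm c := LinearMap.ext fun b => by
    rw [sliceFunctional_apply, haarForm_apply, mul_one]
  rw [leftSlice_Wstar_Lam, h]

theorem Lc_haarForm_of_ne {μ ν : Irr A} (h : μ ≠ ν) {c a : A} (hc : c ∈ starCoeffs μ)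
    (ha : a ∈ starCoeffs ν) : Lc (haarForm c) a = 0 := by
  rw [Lc_congr (g := 0) (fun b hb => haar_star_mul_of_mem h hc hb) ha, Lc_apply]
  simp

/-- On each single block `Lc f` agrees with a slice of `W*`. An operator in the commutant commutes
with the block projections, which are slices as well, so it preserves the blocks and the comparison
can be made block by block. -/
theorem mem_VN_of_Lc {x : L2 A →L[ℂ] L2 A} {f : A →ₗ[ℂ] ℂ} (hx : ∀ a, x (Lam a) = Lam (Lc f a)) :
    x ∈ VN A := by
  rw [VN, mem_generatedVN]
  intro y hy
  rw [mem_centralizer_slices] at hy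
  have hblock : ∀ μ, ∀ a ∈ starCoeffs μ, ∃ a' ∈ starCoeffs μ, y (Lam a) = Lam a' := by
    intro μ a ha
    -- With `c` representing the counit on the block, the slice is the identity there and zero on
    -- the other blocks.
    obtain ⟨c, hc, hc'⟩ := exists_haarForm_eq (Coalgebra.counit (R := ℂ)) μ
    have hp : leftSlice (Lam c) (Lam 1) (Wstar A) = blockProj μ := by
      refine clm_ext_block fun ν b hb => ?_
      rw [leftSlice_haarForm]
      by_cases h : μ = ν
      · subst h
        rw [blockProj_Lam_self hb, Lc_congr hc' hb, Lc_counit]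
      · rw [blockProj_Lam_of_ne h hb, Lc_haarForm_of_ne h hc hb, map_zero]
    have h1 := (hy (Lam c) (Lam 1)).2
    rw [hp] at h1
    have h2 := congrArg (fun T => T (Lam a)) h1
    simp only [mul_apply_eq_comp, blockProj_Lam_self ha] at h2
    obtain ⟨a', ha', h3⟩ := exists_of_mem_block (blockProj_mem_block μ (y (Lam a)))
    exact ⟨a', ha', by rw [h3, h2]⟩
  refine clm_ext_block fun μ a ha => ?_
  obtain ⟨a', ha', h'⟩ := hblock μ a ha
  obtain ⟨c, hc, hc'⟩ := exists_haarForm_eq f μ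
  have h2 := congrArg (fun T => T (Lam a)) (hy (Lam c) (Lam 1)).2
  simp only [mul_apply_eq_comp] at h2 ⊢
  rw [h', leftSlice_haarForm, leftSlice_haarForm, Lc_congr hc' ha, Lc_congr hc' ha'] at h2
  rw [h', hx, hx, h2]

/-- Right convolution, restricted to a block. -/
noncomputable def blockRc (μ : Irr A) (g : A →ₗ[ℂ] ℂ) : L2 A →L[ℂ] L2 A :=
  ∑ i, (innerSL ℂ (Lam (modBasis A ⟨μ, i⟩))).smulRight (Lam (Rc g (modBasis A ⟨μ, i⟩)))

theorem blockRc_self {μ : Irr A} (g : A →ₗ[ℂ] ℂ) {a : A} (ha : a ∈ starCoeffs μ) :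
    blockRc μ g (Lam a) = Lam (Rc g a) := by
  classical
  rw [starCoeffs_eq_span_modBasis] at ha
  induction ha using Submodule.span_induction with
  | mem x hx =>
    obtain ⟨j, rfl⟩ := hx
    simp [blockRc, sum_apply, inner_Lam, haar_star_modBasis]
  | zero => simp
  | add x y _ _ hx hy => simp only [map_add, hx, hy]
  | smul c x _ hx => simp only [map_smul, hx]

theorem blockRc_of_ne {μ ν : Irr A} (h : μ ≠ ν) (g : A →ₗ[ℂ] ℂ) {a : A} (ha : a ∈ starCoeffs ν) :
    blockRc μ g (Lam a) = 0 := by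
  simp only [blockRc, sum_apply, ContinuousLinearMap.smulRight_apply,
    innerSL_apply_apply, inner_Lam]
  exact Finset.sum_eq_zero fun i _ => by
    rw [haar_star_mul_of_mem h (modBasis_mem ⟨μ, i⟩) ha, zero_smul]

theorem blockRc_comm {x : L2 A →L[ℂ] L2 A} {f : A →ₗ[ℂ] ℂ} (hx : ∀ a, x (Lam a) = Lam (Lc f a))
    (μ : Irr A) (g : A →ₗ[ℂ] ℂ) : x * blockRc μ g = blockRc μ g * x := by
  refine clm_ext_block fun ν a ha => ?_
  simp only [mul_apply_eq_comp, hx]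
  by_cases h : μ = ν
  · subst h
    rw [blockRc_self g ha, blockRc_self g (Lc_mem_starCoeffs f ha), hx, Rc_Lc]
  · rw [blockRc_of_ne h g ha, blockRc_of_ne h g (Lc_mem_starCoeffs f ha), map_zero]

theorem adjoint_Lam {x : L2 A →L[ℂ] L2 A} {f : A →ₗ[ℂ] ℂ} (hx : ∀ a, x (Lam a) = Lam (Lc f a))
    (a : A) : ContinuousLinearMap.adjoint x (Lam a) = Lam (Lc (adjFunctional f) a) := by
  refine ext_inner_left ℂ fun v => ?_
  refine denseRange_Lam.induction_on
    (p := fun v => ⟪v, ContinuousLinearMap.adjoint x (Lam a)⟫_ℂ = ⟪v, Lam _⟫_ℂ) v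
    (isClosed_eq (by fun_prop) (by fun_prop)) fun b => ?_
  rw [ContinuousLinearMap.adjoint_inner_right, hx, inner_Lc]

/-- Left and right convolutions commute. Cutting a right convolution down to one block gives finite
rank, hence a bounded operator, without losing the commutation. -/
theorem blockRc_mem_centralizer (μ : Irr A) (g : A →ₗ[ℂ] ℂ) :
    blockRc μ g ∈ StarSubalgebra.centralizer ℂ {T | ∃ ξ η : L2 A, T = leftSlice ξ η (W A)} := by
  rw [mem_centralizer_slices]
  intro ξ η
  have hcl : IsClosed {X : L2 A →L[ℂ] L2 A | X * blockRc μ g = blockRc μ g * X} :=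
    isClosed_eq (by fun_prop) (by fun_prop)
  constructor
  · refine leftSlice_eq_of_Lam hcl (fun c a => ?_) ξ η
    have h : leftSlice (Lam c) (Lam a) (W A) =
        ContinuousLinearMap.adjoint (leftSlice (Lam a) (Lam c) (Wstar A)) := by
      rw [adjoint_leftSlice, W]
    rw [h]
    exact blockRc_comm (adjoint_Lam (leftSlice_Wstar_Lam a c)) μ g
  · exact leftSlice_eq_of_Lam hcl (fun c a => blockRc_comm (leftSlice_Wstar_Lam c a) μ g) ξ η

/-- An element of VN(K) commutes with the truncated right convolutions. Those of the counit are the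
block projections, so it restricts to a linear map of `A`; this map commutes with all right
convolutions and is therefore the left convolution with its composition with the counit. -/
theorem exists_Lc_of_mem_VN {x : L2 A →L[ℂ] L2 A} (hx : x ∈ VN A) :
    ∃ f : A →ₗ[ℂ] ℂ, ∀ a, x (Lam a) = Lam (Lc f a) := by
  rw [VN, mem_generatedVN] at hx
  have hcomm := fun μ g => hx _ (blockRc_mem_centralizer μ g)
  have hblock : ∀ μ, ∀ a ∈ starCoeffs μ, ∃ a' ∈ starCoeffs μ, x (Lam a) = Lam a' := by
    intro μ a ha
    have hp : blockRc μ (Coalgebra.counit (R := ℂ)) = blockProj μ := by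
      refine clm_ext_block fun ν b hb => ?_
      by_cases h : μ = ν
      · subst h
        rw [blockProj_Lam_self hb, blockRc_self _ hb, Rc_counit]
      · rw [blockProj_Lam_of_ne h hb, blockRc_of_ne h _ hb]
    have h1 := hcomm μ (Coalgebra.counit (R := ℂ))
    rw [hp] at h1
    have h2 := congrArg (fun T => T (Lam a)) h1
    simp only [mul_apply_eq_comp, blockProj_Lam_self ha] at h2
    obtain ⟨a', ha', h3⟩ := exists_of_mem_block (blockProj_mem_block μ (x (Lam a)))
    exact ⟨a', ha', by rw [h3, h2]⟩
  choose x1 hx1 hx1' using fun k : ModIndex A => hblock k.1 _ (modBasis_mem k)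
  let x0 : A →ₗ[ℂ] A := (modBasis A).constr ℂ x1
  have h0 : ∀ a, x (Lam a) = Lam (x0 a) := by
    intro a
    have : x.toLinearMap ∘ₗ Lam = Lam ∘ₗ x0 := by
      refine (modBasis A).ext fun k => ?_
      simp [x0, Module.Basis.constr_basis, hx1']
    exact LinearMap.congr_fun this a
  have h1 : ∀ μ, ∀ a ∈ starCoeffs μ, x0 a ∈ starCoeffs μ := by
    intro μ a ha
    obtain ⟨a', ha', h⟩ := hblock μ a ha
    rw [h0] at h
    rwa [Lam_injective h]
  have h2 : ∀ (g : A →ₗ[ℂ] ℂ) a, x0 (Rc g a) = Rc g (x0 a) := by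
    intro g a
    have : x0 ∘ₗ Rc g = Rc g ∘ₗ x0 := by
      refine linearMap_ext_block fun μ a ha => Lam_injective ?_
      have h3 := congrArg (fun T => T (Lam a)) (hcomm μ g)
      simp only [mul_apply_eq_comp] at h3
      rw [h0, blockRc_self g (h1 μ a ha), blockRc_self g ha, h0] at h3
      exact h3.symm
    exact LinearMap.congr_fun this a
  refine ⟨Coalgebra.counit ∘ₗ x0, fun a => ?_⟩
  rw [h0]
  congr 1
  rw [← sub_eq_zero, ← Module.forall_dual_apply_eq_zero_iff ℂ]
  intro k
  rw [map_sub, sub_eq_zero, apply_Lc, LinearMap.comp_apply, h2, ← apply_Lc, Lc_counit]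

end CompactQuantumGroup

namespace CompactQuantumGroup

variable {A : Type*} [Ring A] [StarRing A] [HopfAlgebra ℂ A] [StarModule ℂ A]
  [CompactQuantumGroup A]

/-! ### The operator `Ŵ` and the dual comultiplication -/

theorem flip_coe (t : L2 A ⊗[ℂ] L2 A) :
    flip A (t : L2L2 A) = ((TensorProduct.comm ℂ (L2 A) (L2 A) t : L2 A ⊗[ℂ] L2 A) : L2L2 A) := by
  rw [flip, ContinuousLinearMap.completion_apply_coe]
  rfl

theorem flip_LamLam (z : A ⊗[ℂ] A) :
    flip A (LamLam A z) = LamLam A (TensorProduct.comm ℂ A A z) := by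
  induction z with
  | zero => simp
  | add x y hx hy => simp only [map_add, hx, hy]
  | tmul x y => exact flip_coe _

theorem flip_flip (η : L2L2 A) : flip A (flip A η) = η := by
  refine Completion.induction_on η (isClosed_eq (by fun_prop) (by fun_prop)) fun t => ?_
  rw [flip_coe, flip_coe, TensorProduct.comm_comm]

theorem inner_flip (η ζ : L2L2 A) : ⟪flip A η, flip A ζ⟫_ℂ = ⟪η, ζ⟫_ℂ := by
  refine Completion.induction_on₂ η ζ (isClosed_eq (by fun_prop) (by fun_prop)) fun s t => ?_
  rw [flip_coe, flip_coe, Completion.inner_coe, Completion.inner_coe, TensorProduct.inner_comm_comm]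

theorem adjoint_flip : ContinuousLinearMap.adjoint (flip A) = flip A := by
  ext η
  refine ext_inner_left ℂ fun ζ => ?_
  rw [ContinuousLinearMap.adjoint_inner_right, ← inner_flip, flip_flip]

theorem LamLam_injective : Function.Injective (LamLam A) := by
  have h : Function.Injective (TensorProduct.map (Lam (A := A)) (Lam (A := A))) :=
    TensorProduct.map_injective_of_flat_flat _ _ Lam_injective Lam_injective
  exact (Completion.coe_injective _).comp h

variable (A) in
/-- The linear map `a ⊗ b ↦ a₍₂₎ ⊗ a₍₁₎ b`. -/
noncomputable def WhatAlg : A ⊗[ℂ] A →ₗ[ℂ] A ⊗[ℂ] A :=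
  (TensorProduct.comm ℂ A A).toLinearMap ∘ₗ Wpre A ∘ₗ (TensorProduct.comm ℂ A A).toLinearMap

theorem What_LamLam (z : A ⊗[ℂ] A) : What A (LamLam A z) = LamLam A (WhatAlg A z) := by
  simp only [What, mul_apply_eq_comp, flip_LamLam, Wstar_LamLam]
  rfl

theorem inner_What_LamLam (z z' : A ⊗[ℂ] A) :
    ⟪What A (LamLam A z), What A (LamLam A z')⟫_ℂ = ⟪LamLam A z, LamLam A z'⟫_ℂ := by
  simp only [What, mul_apply_eq_comp, inner_flip]
  rw [flip_LamLam, flip_LamLam, Wstar_LamLam, Wstar_LamLam, inner_Wpre, ← flip_LamLam,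
    ← flip_LamLam, inner_flip]

theorem inner_What (η ζ : L2L2 A) : ⟪What A η, What A ζ⟫_ℂ = ⟪η, ζ⟫_ℂ := by
  refine denseRange_LamLam.induction_on₂
    (p := fun η ζ : L2L2 A => ⟪What A η, What A ζ⟫_ℂ = ⟪η, ζ⟫_ℂ)
    (isClosed_eq (by fun_prop) (by fun_prop)) inner_What_LamLam η ζ

theorem norm_What (η : L2L2 A) : ‖What A η‖ = ‖η‖ := by
  have h := inner_What η η
  rw [inner_self_eq_norm_sq_to_K, inner_self_eq_norm_sq_to_K] at h
  have h' : ‖What A η‖ ^ 2 = ‖η‖ ^ 2 := by exact_mod_cast h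
  exact (sq_eq_sq₀ (norm_nonneg _) (norm_nonneg _)).1 h'

theorem adjoint_What_What (η : L2L2 A) : ContinuousLinearMap.adjoint (What A) (What A η) = η := by
  refine ext_inner_left ℂ fun ζ => ?_
  rw [ContinuousLinearMap.adjoint_inner_right, inner_What]

theorem WhatAlg_conjCoeff (μ ν : Irr A) (i j k l) :
    WhatAlg A (conjCoeff μ i j ⊗ₜ conjCoeff ν k l) =
      ∑ m, conjCoeff μ m j ⊗ₜ (conjCoeff μ i m * conjCoeff ν k l) := by
  simp [WhatAlg, Wpre, (isCorep_conjCoeff μ).comul, Finset.sum_mul]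

theorem opTensor_tens (x y : L2 A →L[ℂ] L2 A) (ξ η : L2 A) :
    opTensor x y (tens ξ η) = tens (x ξ) (y η) := by
  change (TensorProduct.mapL x y).completion ((ξ ⊗ₜ[ℂ] η : L2 A ⊗[ℂ] L2 A) : L2L2 A) = _
  rw [ContinuousLinearMap.completion_apply_coe]
  rfl

theorem opTensor_LamLam {x y : L2 A →L[ℂ] L2 A} {m n : A →ₗ[ℂ] A} (hx : ∀ a, x (Lam a) = Lam (m a))
    (hy : ∀ a, y (Lam a) = Lam (n a)) (z : A ⊗[ℂ] A) :
    opTensor x y (LamLam A z) = LamLam A (TensorProduct.map m n z) := by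
  induction z with
  | zero => simp
  | add x y hx hy => simp only [map_add, hx, hy]
  | tmul a b => rw [LamLam_tmul, opTensor_tens, hx, hy]; rfl

theorem norm_opTensor_one_le (y : L2 A →L[ℂ] L2 A) (η : L2L2 A) :
    ‖opTensor 1 y η‖ ≤ ‖y‖ * ‖η‖ := by
  refine Completion.induction_on η (isClosed_le (by fun_prop) (by fun_prop)) fun t => ?_
  rw [opTensor, ContinuousLinearMap.completion_apply_coe, Completion.norm_coe, Completion.norm_coe]
  refine ((TensorProduct.mapL 1 y).le_opNorm t).trans ?_
  gcongr
  refine (TensorProduct.norm_mapL_le _ _).trans ?_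
  exact mul_le_of_le_one_left (norm_nonneg _) ContinuousLinearMap.norm_id_le

/-- The linear map `a ⊗ b ↦ f(a₍₁₎ b₍₁₎) a₍₂₎ ⊗ b₍₂₎`. -/
noncomputable def conv₂ (f : A →ₗ[ℂ] ℂ) : A ⊗[ℂ] A →ₗ[ℂ] A ⊗[ℂ] A :=
  (TensorProduct.lid ℂ (A ⊗[ℂ] A)).toLinearMap ∘ₗ (f ∘ₗ LinearMap.mul' ℂ A).rTensor (A ⊗[ℂ] A) ∘ₗ
    (TensorProduct.tensorTensorTensorComm ℂ A A A A).toLinearMap ∘ₗ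
      TensorProduct.map Coalgebra.comul Coalgebra.comul

theorem conv₂_conjCoeff (f : A →ₗ[ℂ] ℂ) (μ ν : Irr A) (i j k l) :
    conv₂ f (conjCoeff μ i j ⊗ₜ conjCoeff ν k l) =
      ∑ m, ∑ n, f (conjCoeff μ i m * conjCoeff ν k n) • (conjCoeff μ m j ⊗ₜ conjCoeff ν n l) := by
  simp only [conv₂, LinearMap.comp_apply, TensorProduct.map_tmul, (isCorep_conjCoeff _).comul,
    TensorProduct.sum_tmul, TensorProduct.tmul_sum, map_sum, LinearEquiv.coe_coe,
    TensorProduct.tensorTensorTensorComm_tmul, LinearMap.rTensor_tmul, TensorProduct.lid_tmul,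
    LinearMap.mul'_apply]
  exact Finset.sum_comm

theorem induction_tensor {p : A ⊗[ℂ] A → Prop}
    (h : ∀ μ ν i j k l, p (conjCoeff μ i j ⊗ₜ conjCoeff ν k l))
    (h0 : p 0) (hadd : ∀ a b, p a → p b → p (a + b)) (hsmul : ∀ (c : ℂ) a, p a → p (c • a))
    (z : A ⊗[ℂ] A) : p z := by
  induction z with
  | zero => exact h0
  | add x y hx hy => exact hadd _ _ hx hy
  | tmul a b =>
    refine induction_conjCoeff (p := fun a => p (a ⊗ₜ b)) (fun μ i j => ?_) (by simpa using h0)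
      (fun a a' h h' => by rw [TensorProduct.add_tmul]; exact hadd _ _ h h')
      (fun c a h => by rw [← TensorProduct.smul_tmul']; exact hsmul _ _ h) a
    exact induction_conjCoeff (p := fun b => p (conjCoeff μ i j ⊗ₜ b)) (fun ν k l => h _ _ _ _ _ _)
      (by simpa using h0) (fun a a' h h' => by rw [TensorProduct.tmul_add]; exact hadd _ _ h h')
      (fun c a h => by rw [TensorProduct.tmul_smul]; exact hsmul _ _ h) b

/-- The algebraic form of `Ŵ Δ̂(x) = (1 ⊗ x) Ŵ`; it rests on multiplicativity of `Δ`, applied to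
`a₍₁₎ b`. -/
theorem WhatAlg_conv₂ (f : A →ₗ[ℂ] ℂ) (z : A ⊗[ℂ] A) :
    WhatAlg A (conv₂ f z) = (Lc f).lTensor A (WhatAlg A z) := by
  refine induction_tensor (p := fun z => WhatAlg A (conv₂ f z) = (Lc f).lTensor A (WhatAlg A z))
    (fun μ ν i j k l => ?_) (by simp) (fun a b ha hb => by simp only [map_add, ha, hb])
    (fun c a ha => by simp only [map_smul, ha]) z
  have hL : ∀ m, Lc f (conjCoeff μ i m * conjCoeff ν k l) = ∑ p, ∑ n,
      f (conjCoeff μ i p * conjCoeff ν k n) • (conjCoeff μ p m * conjCoeff ν n l) := by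
    intro m
    rw [Lc_apply, Bialgebra.comul_mul, (isCorep_conjCoeff μ).comul, (isCorep_conjCoeff ν).comul,
      Finset.sum_mul_sum]
    simp
  rw [conv₂_conjCoeff, WhatAlg_conjCoeff]
  simp only [map_sum, map_smul, WhatAlg_conjCoeff, LinearMap.lTensor_tmul, hL,
    TensorProduct.tmul_sum, TensorProduct.tmul_smul, Finset.smul_sum]
  conv_rhs => rw [Finset.sum_comm]
  exact Finset.sum_congr rfl fun _ _ => Finset.sum_comm

/-- Only `Ŵ* Ŵ = 1` is used, not surjectivity of `Ŵ`. -/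
theorem dualComul_LamLam {x : L2 A →L[ℂ] L2 A} {f : A →ₗ[ℂ] ℂ}
    (hx : ∀ a, x (Lam a) = Lam (Lc f a)) (z : A ⊗[ℂ] A) :
    dualComul x (LamLam A z) = LamLam A (conv₂ f z) := by
  have h : opTensor 1 x (LamLam A (WhatAlg A z)) = LamLam A (WhatAlg A (conv₂ f z)) := by
    rw [WhatAlg_conv₂]
    exact opTensor_LamLam (m := LinearMap.id) (fun a => rfl) hx _
  simp only [dualComul, mul_apply_eq_comp, What_LamLam]
  rw [h, ← What_LamLam, adjoint_What_What]

/-- The slice `ε ⊗ id` of `a₍₂₎ ⊗ a₍₁₎ b` is the product `a b`. -/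
theorem counit_WhatAlg (z : A ⊗[ℂ] A) :
    TensorProduct.lid ℂ A ((Coalgebra.counit (R := ℂ)).rTensor A (WhatAlg A z)) =
      LinearMap.mul' ℂ A z := by
  refine induction_tensor (p := fun z => TensorProduct.lid ℂ A ((Coalgebra.counit (R := ℂ)).rTensor A
    (WhatAlg A z)) = LinearMap.mul' ℂ A z) (fun μ ν i j k l => ?_) (by simp)
    (fun a b ha hb => by simp only [map_add, ha, hb]) (fun c a ha => by simp only [map_smul, ha]) z
  rw [WhatAlg_conjCoeff]
  simp [(isCorep_conjCoeff μ).counit, Matrix.one_apply]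

/-! ### Orthogonal decomposition of `L²(K) ⊗ L²(K)` into tensor blocks -/

/-- The tensor product of two subspaces of `A`. -/
def tensorBlock (V W : Submodule ℂ A) : Submodule ℂ (A ⊗[ℂ] A) :=
  Submodule.map₂ (TensorProduct.mk ℂ A A) V W

theorem tensorBlock_induction {V W : Submodule ℂ A} {p : A ⊗[ℂ] A → Prop}
    (h : ∀ a ∈ V, ∀ b ∈ W, p (a ⊗ₜ b)) (h0 : p 0) (hadd : ∀ a b, p a → p b → p (a + b))
    {z : A ⊗[ℂ] A} (hz : z ∈ tensorBlock V W) : p z := by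
  rw [tensorBlock, Submodule.map₂_eq_span_image2] at hz
  -- Closure under scalars is not assumed: proving the claim for all multiples at once lets the
  -- first tensor factor absorb the scalar.
  refine Submodule.span_induction (p := fun z _ => ∀ c : ℂ, p (c • z)) ?_ (by simpa using h0) ?_ ?_
    hz (1 : ℂ) |> fun h => by simpa using h
  · rintro _ ⟨a, ha, b, hb, rfl⟩ c
    have := h _ (V.smul_mem c ha) _ hb
    rwa [← TensorProduct.smul_tmul'] at this
  · intro x y _ _ hx hy c
    rw [smul_add]
    exact hadd _ _ (hx c) (hy c)
  · intro d x _ hx c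
    rw [smul_smul]
    exact hx _

theorem tmul_mem_tensorBlock {V W : Submodule ℂ A} {a b : A} (ha : a ∈ V) (hb : b ∈ W) :
    a ⊗ₜ[ℂ] b ∈ tensorBlock V W :=
  Submodule.apply_mem_map₂ _ ha hb

theorem tensorBlock_conjCoeff_induction {lam μ : Irr A} {p : A ⊗[ℂ] A → Prop}
    (h : ∀ i j k l, p (conjCoeff lam i j ⊗ₜ conjCoeff μ k l)) (h0 : p 0)
    (hadd : ∀ a b, p a → p b → p (a + b)) (hsmul : ∀ (c : ℂ) a, p a → p (c • a))
    {z : A ⊗[ℂ] A} (hz : z ∈ tensorBlock (starCoeffs lam) (starCoeffs μ)) : p z := by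
  refine tensorBlock_induction (fun a ha b hb => ?_) h0 hadd hz
  refine starCoeffs_induction (p := fun a => p (a ⊗ₜ b)) (fun i j => ?_) (by simpa using h0)
    (fun a a' h h' => by rw [TensorProduct.add_tmul]; exact hadd _ _ h h')
    (fun c a h => by rw [← TensorProduct.smul_tmul']; exact hsmul _ _ h) ha
  exact starCoeffs_induction (p := fun b => p (conjCoeff lam i j ⊗ₜ b)) (fun k l => h _ _ _ _)
    (by simpa using h0) (fun a a' h h' => by rw [TensorProduct.tmul_add]; exact hadd _ _ h h')
    (fun c a h => by rw [TensorProduct.tmul_smul]; exact hsmul _ _ h) hb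

theorem conv₂_mem (f : A →ₗ[ℂ] ℂ) {lam μ : Irr A} {z : A ⊗[ℂ] A}
    (hz : z ∈ tensorBlock (starCoeffs lam) (starCoeffs μ)) :
    conv₂ f z ∈ tensorBlock (starCoeffs lam) (starCoeffs μ) := by
  refine tensorBlock_conjCoeff_induction
    (p := fun z => conv₂ f z ∈ tensorBlock (starCoeffs lam) (starCoeffs μ))
    (fun i j k l => ?_) (by simp) (fun a b ha hb => by rw [map_add]; exact add_mem ha hb)
    (fun c a ha => by rw [map_smul]; exact Submodule.smul_mem _ _ ha) hz
  rw [conv₂_conjCoeff]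
  exact Submodule.sum_mem _ fun m _ => Submodule.sum_mem _ fun n _ => Submodule.smul_mem _ _
    (tmul_mem_tensorBlock (mem_coeffSpan _ _ _) (mem_coeffSpan _ _ _))

/-- The second leg of `a₍₂₎ ⊗ a₍₁₎ b` is a product of elements of the two blocks, so only the `ν`
contained in `lam ⊗ μ` occur in it. -/
theorem WhatAlg_mem {lam μ : Irr A} {z : A ⊗[ℂ] A}
    (hz : z ∈ tensorBlock (starCoeffs lam) (starCoeffs μ)) :
    WhatAlg A z ∈ ⨆ ν : {ν : Irr A // SubTensor ν lam μ}, tensorBlock ⊤ (starCoeffs ν.1) := by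
  refine tensorBlock_conjCoeff_induction (p := fun z => WhatAlg A z ∈ _)
    (fun i j k l => ?_) (by simp) (fun a b ha hb => by rw [map_add]; exact add_mem ha hb)
    (fun c a ha => by rw [map_smul]; exact Submodule.smul_mem _ _ ha) hz
  rw [WhatAlg_conjCoeff]
  refine Submodule.sum_mem _ fun m _ => ?_
  have h := starCoeffs_mul_le lam μ (Submodule.mul_mem_mul (mem_coeffSpan (conjCoeff lam) i m)
    (mem_coeffSpan (conjCoeff μ) k l))
  rw [iSup_subtype'] at h
  generalize conjCoeff lam i m * conjCoeff μ k l = b at h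
  induction h using Submodule.iSup_induction' with
  | mem ν x hx => exact Submodule.mem_iSup_of_mem ν (tmul_mem_tensorBlock trivial hx)
  | zero => simp
  | add x y _ _ hx hy => rw [TensorProduct.tmul_add]; exact add_mem hx hy

theorem inner_LamLam_tmul (a b c d : A) : ⟪LamLam A (a ⊗ₜ b), LamLam A (c ⊗ₜ d)⟫_ℂ =
    haar (star a * c) * haar (star b * d) := by
  rw [LamLam_tmul, LamLam_tmul, inner_tens, inner_Lam, inner_Lam]

theorem inner_LamLam_eq_zero {V W V' W' : Submodule ℂ A}
    (h : (∀ a ∈ V, ∀ c ∈ V', haar (star a * c) = 0) ∨ ∀ b ∈ W, ∀ d ∈ W', haar (star b * d) = 0)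
    {z z' : A ⊗[ℂ] A} (hz : z ∈ tensorBlock V W) (hz' : z' ∈ tensorBlock V' W') :
    ⟪LamLam A z, LamLam A z'⟫_ℂ = 0 := by
  refine tensorBlock_induction (p := fun z => ⟪LamLam A z, LamLam A z'⟫_ℂ = 0)
    (fun a ha b hb => ?_) (by simp) (fun x y hx hy => by rw [map_add, inner_add_left, hx, hy, add_zero]) hz
  refine tensorBlock_induction (p := fun z' => ⟪LamLam A (a ⊗ₜ b), LamLam A z'⟫_ℂ = 0)
    (fun c hc d hd => ?_) (by simp) (fun x y hx hy => by rw [map_add, inner_add_right, hx, hy, add_zero]) hz'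
  rw [inner_LamLam_tmul]
  rcases h with h | h
  · rw [h a ha c hc, zero_mul]
  · rw [h b hb d hd, mul_zero]

theorem iSup_tensorBlock :
    ⨆ p : Irr A × Irr A, tensorBlock (starCoeffs p.1) (starCoeffs p.2) = ⊤ := by
  rw [eq_top_iff]
  intro z _
  refine induction_tensor (p := fun z => z ∈ _) (fun μ ν i j k l => ?_) (zero_mem _)
    (fun a b ha hb => add_mem ha hb) (fun c a ha => Submodule.smul_mem _ _ ha) z
  exact Submodule.mem_iSup_of_mem (μ, ν) (tmul_mem_tensorBlock (mem_coeffSpan _ _ _)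
    (mem_coeffSpan _ _ _))

/-- A form which is positive on orthogonal subspaces is positive on their sum. -/
theorem inner_nonneg_of_iSup {ι : Type*} {V : ι → Submodule ℂ (A ⊗[ℂ] A)}
    (T : L2L2 A →L[ℂ] L2L2 A)
    (hdiag : ∀ i, ∀ z ∈ V i, 0 ≤ (⟪T (LamLam A z), LamLam A z⟫_ℂ).re ∧
      (⟪T (LamLam A z), LamLam A z⟫_ℂ).im = 0)
    (hoff : ∀ i j, i ≠ j → ∀ z ∈ V i, ∀ z' ∈ V j, ⟪T (LamLam A z), LamLam A z'⟫_ℂ = 0)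
    {z : A ⊗[ℂ] A} (hz : z ∈ ⨆ i, V i) : 0 ≤ (⟪T (LamLam A z), LamLam A z⟫_ℂ).re ∧
      (⟪T (LamLam A z), LamLam A z⟫_ℂ).im = 0 := by
  classical
  obtain ⟨f, hf, rfl⟩ := (Submodule.mem_iSup_iff_exists_finsupp _ _).1 hz
  have h : ⟪T (LamLam A (f.sum fun _ x => x)), LamLam A (f.sum fun _ x => x)⟫_ℂ =
      ∑ i ∈ f.support, ⟪T (LamLam A (f i)), LamLam A (f i)⟫_ℂ := by
    rw [Finsupp.sum, map_sum, map_sum, sum_inner]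
    refine Finset.sum_congr rfl fun i hi => ?_
    rw [inner_sum, Finset.sum_eq_single i]
    · intro j _ hij
      exact hoff i j (Ne.symm hij) _ (hf i) _ (hf j)
    · intro h
      exact absurd hi h
  rw [h, Complex.re_sum, Complex.im_sum]
  exact ⟨Finset.sum_nonneg fun i _ => (hdiag i _ (hf i)).1,
    Finset.sum_eq_zero fun i _ => (hdiag i _ (hf i)).2⟩

end CompactQuantumGroup

namespace CompactQuantumGroup

variable {A : Type*} [Ring A] [StarRing A] [HopfAlgebra ℂ A] [StarModule ℂ A]
  [CompactQuantumGroup A]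

/-! ### Operators which are scalar on the blocks -/

/-- The functional for which `Lc` acts as the scalar `c μ` on the block of `μ`. -/
noncomputable def diagFun (c : Irr A → ℂ) : A →ₗ[ℂ] ℂ :=
  Coalgebra.counit ∘ₗ diagMap fun k => c k.1

theorem diagMap_of_mem (c : Irr A → ℂ) {μ : Irr A} {a : A} (ha : a ∈ starCoeffs μ) :
    diagMap (fun k => c k.1) a = c μ • a := by
  rw [starCoeffs_eq_span_modBasis] at ha
  induction ha using Submodule.span_induction with
  | mem x hx =>
    obtain ⟨j, rfl⟩ := hx
    rw [diagMap_modBasis]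
  | zero => simp
  | add x y _ _ hx hy => rw [map_add, hx, hy, smul_add]
  | smul d x _ hx => rw [map_smul, hx, smul_comm]

theorem Lc_diagFun (c : Irr A → ℂ) {μ : Irr A} {a : A} (ha : a ∈ starCoeffs μ) :
    Lc (diagFun c) a = c μ • a := by
  rw [Lc_congr (g := c μ • Coalgebra.counit) (fun b hb => ?_) ha]
  · conv_rhs => rw [← Lc_counit a]
    rw [Lc_apply, Lc_apply, LinearMap.rTensor_smul, LinearMap.smul_apply, map_smul]
  · simp [diagFun, diagMap_of_mem c hb]

/-- The bounded operator `x` acts as the scalar `c μ` on the block of `μ`. -/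
def IsBlockScalar (c : Irr A → ℝ) (x : L2 A →L[ℂ] L2 A) : Prop :=
  ∀ μ, ∀ a ∈ starCoeffs μ, x (Lam a) = (c μ : ℂ) • Lam a

theorem exists_isBlockScalar {c : Irr A → ℝ} {C : ℝ} (hc : ∀ μ, |c μ| ≤ C) (hC : 0 ≤ C) :
    ∃ x, IsBlockScalar c x ∧ ‖x‖ ≤ C := by
  obtain ⟨x, hx, hn⟩ := exists_extension hC
    (norm_diagMap_le (c := fun k : ModIndex A => (c k.1 : ℂ)) (fun k => by simpa using hc k.1) hC)
  refine ⟨x, fun μ a ha => ?_, hn⟩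
  rw [hx, diagMap_of_mem (fun μ => (c μ : ℂ)) ha, map_smul]

namespace IsBlockScalar

variable {c d : Irr A → ℝ} {x y : L2 A →L[ℂ] L2 A}

theorem ext (hx : IsBlockScalar c x) (hy : IsBlockScalar c y) : x = y :=
  clm_ext_block fun μ a ha => by rw [hx μ a ha, hy μ a ha]

theorem mul (hx : IsBlockScalar c x) (hy : IsBlockScalar d y) :
    IsBlockScalar (fun μ => c μ * d μ) (x * y) := fun μ a ha => by
  rw [mul_apply_eq_comp, hy μ a ha, map_smul, hx μ a ha, smul_smul]
  push_cast
  rw [mul_comm]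

theorem sq (hx : IsBlockScalar c x) : IsBlockScalar (fun μ => c μ ^ 2) (x ^ 2) := by
  simpa only [pow_two] using hx.mul hx

theorem apply_Lam (hx : IsBlockScalar c x) (a : A) :
    x (Lam a) = Lam (Lc (diagFun fun μ => (c μ : ℂ)) a) := by
  have h : x.toLinearMap ∘ₗ Lam = Lam ∘ₗ Lc (diagFun fun μ => (c μ : ℂ)) := by
    refine linearMap_ext_block fun μ a ha => ?_
    simp only [LinearMap.comp_apply, ContinuousLinearMap.coe_coe]
    rw [hx μ a ha, Lc_diagFun _ ha, map_smul]
  exact LinearMap.congr_fun h a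

theorem mem_VN (hx : IsBlockScalar c x) : x ∈ VN A := mem_VN_of_Lc hx.apply_Lam

theorem comm (hx : IsBlockScalar c x) (hy : y ∈ VN A) : x * y = y * x := by
  obtain ⟨f, hf⟩ := exists_Lc_of_mem_VN hy
  refine clm_ext_block fun μ a ha => ?_
  rw [mul_apply_eq_comp, mul_apply_eq_comp, hf, hx μ a ha, hx μ _ (Lc_mem_starCoeffs f ha), map_smul,
    hf]

theorem blockProj_comm (hx : IsBlockScalar c x) (μ : Irr A) (ξ : L2 A) :
    x (blockProj μ ξ) = (c μ : ℂ) • blockProj μ ξ := by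
  obtain ⟨a, ha, h⟩ := exists_of_mem_block (blockProj_mem_block μ ξ)
  rw [← h, hx μ a ha]

theorem blockProj_apply (hx : IsBlockScalar c x) (μ : Irr A) (ξ : L2 A) :
    blockProj μ (x ξ) = (c μ : ℂ) • blockProj μ ξ := by
  rw [← hx.blockProj_comm]
  have h : blockProj μ * x = x * blockProj μ := by
    refine clm_ext_block fun ν a ha => ?_
    rw [mul_apply_eq_comp, mul_apply_eq_comp, hx ν a ha, map_smul]
    by_cases h : μ = ν
    · subst h
      rw [blockProj_Lam_self ha, hx μ a ha]
    · rw [blockProj_Lam_of_ne h ha, smul_zero, map_zero]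
  exact congrArg (fun T => T ξ) h

theorem inner_apply (hx : IsBlockScalar c x) (ξ η : L2 A) : ⟪x ξ, η⟫_ℂ = ⟪ξ, x η⟫_ℂ := by
  have h : ContinuousLinearMap.adjoint x = x := by
    refine clm_ext fun a => ext_inner_left ℂ fun v => ?_
    refine denseRange_Lam.induction_on
      (p := fun v => ⟪v, ContinuousLinearMap.adjoint x (Lam a)⟫_ℂ = ⟪v, x (Lam a)⟫_ℂ) v
      (isClosed_eq (by fun_prop) (by fun_prop)) fun b => ?_
    rw [ContinuousLinearMap.adjoint_inner_right]
    have h2 : ∀ a : A, x (Lam a) = Lam (diagMap (fun k => (c k.1 : ℂ)) a) := by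
      have : x.toLinearMap ∘ₗ Lam = Lam ∘ₗ diagMap (fun k => (c k.1 : ℂ)) := by
        refine linearMap_ext_block fun μ a ha => ?_
        simp only [LinearMap.comp_apply, ContinuousLinearMap.coe_coe]
        rw [hx μ a ha, diagMap_of_mem (fun μ => (c μ : ℂ)) ha, map_smul]
      exact LinearMap.congr_fun this
    rw [h2, h2, inner_diagMap]
    simp
  rw [← ContinuousLinearMap.adjoint_inner_right, h]

theorem norm_le (hx : IsBlockScalar c x) {C : ℝ} (hc : ∀ μ, |c μ| ≤ C) (hC : 0 ≤ C) : ‖x‖ ≤ C := by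
  obtain ⟨y, hy, hn⟩ := exists_isBlockScalar hc hC
  rwa [hx.ext hy]

theorem opTensor_LamLam (hx : IsBlockScalar c x) {lam μ : Irr A} {z : A ⊗[ℂ] A}
    (hz : z ∈ tensorBlock (starCoeffs lam) (starCoeffs μ)) :
    opTensor x x (LamLam A z) = ((c lam * c μ : ℝ) : ℂ) • LamLam A z := by
  refine tensorBlock_induction (p := fun z => opTensor x x (LamLam A z) = _ • LamLam A z)
    (fun a ha b hb => ?_) (by simp) (fun a b ha hb => by simp only [map_add, ha, hb, smul_add]) hz
  rw [LamLam_tmul, opTensor_tens, hx lam a ha, hx μ b hb, map_smul, Complex.ofReal_mul, mul_comm,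
    mul_smul]
  congr 1
  rw [← Lam.map_smul, ← LamLam_tmul, ← LamLam_tmul, ← TensorProduct.smul_tmul', map_smul]

theorem opTensor_one_LamLam (hx : IsBlockScalar c x) {ν : Irr A} {z : A ⊗[ℂ] A}
    (hz : z ∈ tensorBlock ⊤ (starCoeffs ν)) :
    opTensor 1 x (LamLam A z) = (c ν : ℂ) • LamLam A z := by
  refine tensorBlock_induction (p := fun z => opTensor 1 x (LamLam A z) = _ • LamLam A z)
    (fun a _ b hb => ?_) (by simp) (fun a b ha hb => by simp only [map_add, ha, hb, smul_add]) hz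
  rw [LamLam_tmul, opTensor_tens, hx ν b hb, map_smul]
  rfl

end IsBlockScalar

/-! ### The unbounded operator `diagOp w` and its bounded inverse -/

theorem diagOp_Lam (w : Irr A → ℝ) {μ : Irr A} {a : A} (ha : a ∈ starCoeffs μ) :
    ∃ h : Lam a ∈ (diagOp w).domain, diagOp w ⟨Lam a, h⟩ = (w μ : ℂ) • Lam a := by
  have h : HasSum (fun ν : Irr A => (w ν : ℂ) • blockProj ν (Lam a)) ((w μ : ℂ) • Lam a) := by
    have h1 := hasSum_single (f := fun ν : Irr A => (w ν : ℂ) • blockProj ν (Lam a)) μ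
      fun ν hν => by rw [blockProj_Lam_of_ne hν ha, smul_zero]
    rwa [blockProj_Lam_self ha] at h1
  exact ⟨h.summable, h.tsum_eq⟩

theorem IsBoundedInverse.isBlockScalar {w : Irr A → ℝ} (hw : ∀ μ, 0 < w μ) {x : L2 A →L[ℂ] L2 A}
    (hx : IsBoundedInverse (diagOp w) x) : IsBlockScalar (fun μ => (w μ)⁻¹) x := by
  intro μ a ha
  obtain ⟨h, h'⟩ := diagOp_Lam w ha
  have h1 := hx.1 ⟨Lam a, h⟩
  rw [h', map_smul] at h1
  have h2 : (w μ : ℂ) ≠ 0 := by exact_mod_cast (hw μ).ne'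
  rw [Complex.ofReal_inv, eq_inv_smul_iff₀ h2, h1]

/-- Both directions compare the series defining the operator, termwise, with the expansion `ξ = ∑
p_μ ξ`. -/
theorem IsBlockScalar.isBoundedInverse {w : Irr A → ℝ} (hw : ∀ μ, 0 < w μ) {x : L2 A →L[ℂ] L2 A}
    (hx : IsBlockScalar (fun μ => (w μ)⁻¹) x) : IsBoundedInverse (diagOp w) x := by
  have h2 : ∀ μ, (w μ : ℂ) ≠ 0 := fun μ => by exact_mod_cast (hw μ).ne'
  constructor
  · intro ξ
    have h : HasSum (fun μ : Irr A => (w μ : ℂ) • blockProj μ (ξ : L2 A)) (diagOp w ξ) :=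
      Summable.hasSum ξ.2
    have h1 := x.hasSum h
    simp only [map_smul, hx.blockProj_comm, smul_smul, Complex.ofReal_inv,
      mul_inv_cancel₀ (h2 _), one_smul] at h1
    exact h1.unique (hasSum_blockProj _)
  · intro ξ
    have h : HasSum (fun μ : Irr A => (w μ : ℂ) • blockProj μ (x ξ)) ξ := by
      simp only [hx.blockProj_apply, smul_smul, Complex.ofReal_inv, mul_inv_cancel₀ (h2 _), one_smul]
      exact hasSum_blockProj ξ
    exact ⟨h.summable, h.tsum_eq⟩

theorem Lam_mem_domain (w : Irr A → ℝ) (a : A) : Lam a ∈ (diagOp w).domain := by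
  refine induction_conjCoeff (p := fun a => Lam a ∈ (diagOp w).domain)
    (fun μ i j => (diagOp_Lam w (mem_coeffSpan _ _ _)).1) (by simp) (fun a b ha hb => ?_)
    (fun c a ha => ?_) a
  · rw [map_add]; exact add_mem ha hb
  · rw [map_smul]; exact Submodule.smul_mem _ _ ha

theorem dense_domain_diagOp (w : Irr A → ℝ) : Dense ((diagOp w).domain : Set (L2 A)) :=
  denseRange_Lam.mono (Set.range_subset_iff.2 (Lam_mem_domain w))

/-- A symmetric operator with an everywhere defined bounded symmetric inverse is self-adjoint: `x w*
η = η` puts the domain of the adjoint into the range of `x`, which lies in the domain of `w`. -/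
theorem isSelfAdjoint_diagOp {w : Irr A → ℝ} {x : L2 A →L[ℂ] L2 A}
    (hsa : ∀ ξ η, ⟪x ξ, η⟫_ℂ = ⟪ξ, x η⟫_ℂ) (hx : IsBoundedInverse (diagOp w) x) :
    IsSelfAdjoint (diagOp w) := by
  have hd := dense_domain_diagOp w
  rw [LinearPMap.isSelfAdjoint_def]
  refine le_antisymm ?_ (LinearPMap.IsFormalAdjoint.le_adjoint hd fun ξ η => ?_)
  · have h : ∀ η : ((diagOp w).adjoint).domain, x ((diagOp w).adjoint η) = η := by
      intro η
      refine ext_inner_right ℂ fun θ => ?_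
      obtain ⟨h1, h2⟩ := hx.2 θ
      have h3 := LinearPMap.adjoint_isFormalAdjoint hd η ⟨x θ, h1⟩
      rw [h2] at h3
      rw [hsa]
      exact h3
    refine LinearPMap.le_of_eqLocus_ge fun η hη => ?_
    obtain ⟨h1, h2⟩ := hx.2 ((diagOp w).adjoint ⟨η, hη⟩)
    have h3 := h ⟨η, hη⟩
    simp only [h3] at h1 h2
    exact ⟨hη, h1, h2.symm⟩
  · conv_rhs => rw [← hx.1 ξ]
    conv_lhs => rw [← hx.1 η]
    rw [hsa]

theorem strictly_pos_diagOp {w : Irr A → ℝ} (hw : ∀ μ, 1 ≤ w μ) (ξ : (diagOp w).domain)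
    (hξ : ξ ≠ 0) : 0 < (⟪(ξ : L2 A), diagOp w ξ⟫_ℂ).re := by
  have hw0 : ∀ μ, 0 < w μ := fun μ => one_pos.trans_le (hw μ)
  -- `y` is `w^{-1/2}`, bounded because `w ≥ 1`; then `⟪ξ, w ξ⟫ = ‖y w ξ‖²`.
  obtain ⟨y, hy, -⟩ := exists_isBlockScalar (c := fun μ => √(w μ)⁻¹) (C := 1)
    (fun μ => by
      rw [abs_of_nonneg (Real.sqrt_nonneg _), Real.sqrt_le_one]
      exact inv_le_one_of_one_le₀ (hw μ)) zero_le_one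
  have hx : IsBlockScalar (fun μ => (w μ)⁻¹) (y ^ 2) := by
    have h := hy.sq
    simpa only [Real.sq_sqrt (inv_nonneg.2 (hw0 _).le)] using h
  have h1 := (hx.isBoundedInverse hw0).1 ξ
  have h2 : ⟪(ξ : L2 A), diagOp w ξ⟫_ℂ = ⟪y (diagOp w ξ), y (diagOp w ξ)⟫_ℂ := by
    conv_lhs => rw [← h1]
    rw [pow_two, mul_apply_eq_comp, hy.inner_apply]
  rw [h2]
  have h3 : y (diagOp w ξ) ≠ 0 := by
    intro h
    rw [pow_two, mul_apply_eq_comp, h, map_zero] at h1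
    exact hξ (Subtype.ext h1.symm)
  rw [inner_self_eq_norm_sq_to_K]
  have h4 : 0 < ‖y (diagOp w ξ)‖ ^ 2 := pow_pos (norm_pos_iff.2 h3) 2
  exact_mod_cast h4

/-! ### The weight inequality -/

theorem inner_dualComul (x : L2 A →L[ℂ] L2 A) (η ζ : L2L2 A) :
    ⟪dualComul x η, ζ⟫_ℂ = ⟪opTensor 1 x (What A η), What A ζ⟫_ℂ := by
  simp only [dualComul, mul_apply_eq_comp, ContinuousLinearMap.adjoint_inner_left]

theorem WhatAlg_injective : Function.Injective (WhatAlg A) := by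
  rw [← LinearMap.ker_eq_bot, LinearMap.ker_eq_bot']
  intro z hz
  have h := What_LamLam z
  rw [hz, map_zero, ← norm_eq_zero, norm_What, norm_eq_zero] at h
  exact LamLam_injective (h.trans (map_zero _).symm)

theorem exists_mul_eq {V W : Submodule ℂ A} {a : A} (ha : a ∈ V * W) :
    ∃ z ∈ tensorBlock V W, LinearMap.mul' ℂ A z = a := by
  induction ha using Submodule.mul_induction_on' with
  | mem_mul_mem a ha b hb => exact ⟨_, tmul_mem_tensorBlock ha hb, by simp⟩
  | add x _ y _ hx hy =>
    obtain ⟨z, hz, rfl⟩ := hx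
    obtain ⟨z', hz', rfl⟩ := hy
    exact ⟨z + z', add_mem hz hz', map_add _ _ _⟩

/-- If `ν ⊆ lam ⊗ μ`, then `Δ̂(p_ν)` does not vanish on the block of `(lam, μ)`. -/
theorem exists_conv₂_eq_smul {lam μ ν : Irr A} (h : SubTensor ν lam μ) :
    ∃ z ∈ tensorBlock (starCoeffs lam) (starCoeffs μ), z ≠ 0 ∧
      ∀ c : Irr A → ℂ, conv₂ (diagFun c) z = c ν • z := by
  classical
  obtain ⟨a, ha, ha0⟩ := Submodule.exists_mem_ne_zero_of_ne_bot (starCoeffs_ne_bot ν)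
  -- The witness is `Δ̂(p_ν) z`, where multiplication sends `z` to a nonzero `a` in `starCoeffs ν`.
  -- Its image under multiplication is `p_ν a = a`, so it is not zero.
  obtain ⟨z, hz, hza⟩ := exists_mul_eq (starCoeffs_le_mul h ha)
  have hL : ∀ c : Irr A → ℂ, Lc (diagFun c) ∘ₗ Lc (diagFun (Pi.single ν 1)) =
      c ν • Lc (diagFun (Pi.single ν (1 : ℂ))) := by
    intro c
    refine linearMap_ext_block fun κ b hb => ?_
    simp only [LinearMap.comp_apply, LinearMap.smul_apply, Lc_diagFun _ hb, map_smul]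
    by_cases hκ : κ = ν
    · subst hκ
      rw [smul_comm]
    · simp [Pi.single_eq_of_ne hκ]
  refine ⟨conv₂ (diagFun (Pi.single ν 1)) z, conv₂_mem _ hz, fun h0 => ha0 ?_, fun c => ?_⟩
  · have h1 := counit_WhatAlg (conv₂ (diagFun (Pi.single ν 1)) z)
    have h2 : ∀ (f : A →ₗ[ℂ] ℂ) (t : A ⊗[ℂ] A), TensorProduct.lid ℂ A
        ((Coalgebra.counit (R := ℂ)).rTensor A ((Lc f).lTensor A t)) =
        Lc f (TensorProduct.lid ℂ A ((Coalgebra.counit (R := ℂ)).rTensor A t)) := by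
      intro f t
      induction t with
      | zero => simp
      | add x y hx hy => simp only [map_add, hx, hy]
      | tmul x y => simp
    rw [WhatAlg_conv₂, h2, counit_WhatAlg, hza, Lc_diagFun _ ha, h0] at h1
    simpa using h1
  · apply WhatAlg_injective
    rw [WhatAlg_conv₂, WhatAlg_conv₂, map_smul, WhatAlg_conv₂, ← LinearMap.comp_apply,
      ← LinearMap.lTensor_comp, hL, LinearMap.lTensor_smul, LinearMap.smul_apply]

theorem inner_ofReal_smul_self {E : Type*} [NormedAddCommGroup E] [InnerProductSpace ℂ E] (r : ℝ)
    (η : E) : ⟪(r : ℂ) • η, η⟫_ℂ = ((r * ‖η‖ ^ 2 : ℝ) : ℂ) := by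
  rw [inner_smul_left, inner_self_eq_norm_sq_to_K, Complex.conj_ofReal]
  push_cast
  rfl

theorem one_le_and_submultiplicative {w : Irr A → ℝ} (hw : ∀ μ, 0 < w μ) {x : L2 A →L[ℂ] L2 A}
    (hx : IsBlockScalar (fun μ => (w μ)⁻¹) x)
    (hle : opTensor (x ^ 2) (x ^ 2) ≤ dualComul (x ^ 2)) :
    (∀ μ, 1 ≤ w μ) ∧ ∀ lam μ ν : Irr A, SubTensor ν lam μ → w ν ≤ w lam * w μ := by
  have hx2 := hx.sq
  set y := x ^ 2
  have hineq : ∀ η, (⟪opTensor y y η, η⟫_ℂ).re ≤ (⟪dualComul y η, η⟫_ℂ).re := by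
    intro η
    have h := (ContinuousLinearMap.le_def _ _).1 hle
    have h2 := (ContinuousLinearMap.isPositive_iff_complex _).1 h η
    have h3 := h2.2
    rw [sub_apply, inner_sub_left] at h3
    simpa using h3
  have hpos : ∀ z : A ⊗[ℂ] A, z ≠ 0 → 0 < ‖LamLam A z‖ ^ 2 := fun z hz =>
    pow_pos (norm_pos_iff.2 fun h => hz (LamLam_injective (h.trans (map_zero _).symm))) 2
  have hself : ∀ (r : ℝ) (η : L2L2 A), (⟪(r : ℂ) • η, η⟫_ℂ).re = r * ‖η‖ ^ 2 := by
    intro r η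
    rw [inner_ofReal_smul_self, Complex.ofReal_re]
  constructor
  -- Testing `y ⊗ y ≤ Δ̂(y)` on a vector of the block of `(μ, μ)`: the left side is `w(μ)⁻⁴`, the
  -- right side at most `‖y‖`.
  · have h1 : ∀ μ, ((w μ)⁻¹ ^ 2) ^ 2 ≤ ‖y‖ := by
      intro μ
      obtain ⟨a, ha, ha0⟩ := Submodule.exists_mem_ne_zero_of_ne_bot (starCoeffs_ne_bot μ)
      have hz := tmul_mem_tensorBlock ha ha
      have hz0 : a ⊗ₜ[ℂ] a ≠ 0 := by
        intro h0
        have h := inner_LamLam_tmul a a a a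
        rw [h0, map_zero, inner_zero_left, eq_comm, mul_self_eq_zero] at h
        exact ha0 (haar_faithful a h)
      have h := hineq (LamLam A (a ⊗ₜ a))
      rw [hx2.opTensor_LamLam hz, hself, inner_dualComul] at h
      have h2 : (⟪opTensor 1 y (What A (LamLam A (a ⊗ₜ a))), What A (LamLam A (a ⊗ₜ a))⟫_ℂ).re ≤
          ‖y‖ * ‖LamLam A (a ⊗ₜ[ℂ] a)‖ ^ 2 := by
        refine (Complex.re_le_norm _).trans ((norm_inner_le_norm _ _).trans ?_)
        have h3 := norm_opTensor_one_le y (What A (LamLam A (a ⊗ₜ a)))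
        rw [norm_What] at h3 ⊢
        nlinarith [norm_nonneg (LamLam A (a ⊗ₜ[ℂ] a))]
      have h4 := le_of_mul_le_mul_right (h.trans h2) (hpos _ hz0)
      rwa [← pow_two] at h4
    -- The eigenvalues `w(μ)⁻²` of `y` are at most `√‖y‖`, and so is their supremum `‖y‖`; this
    -- forces `‖y‖ ≤ 1`.
    have h2 : ‖y‖ ≤ √‖y‖ := hx2.norm_le (fun μ => by
      rw [abs_of_nonneg (by positivity)]
      exact Real.le_sqrt_of_sq_le (h1 μ)) (Real.sqrt_nonneg _)
    have h3 : ‖y‖ ≤ 1 := by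
      by_contra! h
      have h4 := Real.sqrt_lt' (x := ‖y‖) (y := ‖y‖) (by linarith)
      have h5 := h4.2 (by nlinarith)
      linarith
    intro μ
    have h4 : ((w μ)⁻¹ ^ 2) ^ 2 ≤ 1 := (h1 μ).trans h3
    rw [← pow_mul] at h4
    have h5 : (w μ)⁻¹ ≤ 1 := (pow_le_one_iff_of_nonneg (inv_nonneg.2 (hw μ).le) (by norm_num)).1 h4
    exact (inv_le_one₀ (hw μ)).1 h5
  · intro lam μ ν hν
    -- A common eigenvector: `y ⊗ y` has eigenvalue `(w(lam) w(μ))⁻²` on it, and `Δ̂(y)` has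
    -- `w(ν)⁻²`.
    obtain ⟨z, hz, hz0, hc⟩ := exists_conv₂_eq_smul hν
    have h := hineq (LamLam A z)
    rw [hx2.opTensor_LamLam hz, dualComul_LamLam hx2.apply_Lam, hc, map_smul, hself, hself] at h
    have h1 := le_of_mul_le_mul_right h (hpos z hz0)
    rw [← mul_pow, ← mul_inv] at h1
    have h2 := (pow_le_pow_iff_left₀ (inv_nonneg.2 (mul_pos (hw lam) (hw μ)).le)
      (inv_nonneg.2 (hw ν).le) two_ne_zero).1 h1
    exact (inv_le_inv₀ (mul_pos (hw lam) (hw μ)) (hw ν)).1 h2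

/-- Both operators preserve the mutually orthogonal tensor blocks. On the block of `(lam, μ)` the
difference is carried by `Ŵ` to `1 ⊗ x - c(lam) c(μ)`, which acts on the image as the nonnegative
scalars `c(ν) - c(lam) c(μ)` on orthogonal pieces. Positivity then passes from the dense subspace to
the whole space. -/
theorem opTensor_le_dualComul {c : Irr A → ℝ} {x : L2 A →L[ℂ] L2 A} (hx : IsBlockScalar c x)
    (hc : ∀ lam μ ν : Irr A, SubTensor ν lam μ → c lam * c μ ≤ c ν) :
    opTensor x x ≤ dualComul x := by
  have horth : ∀ p q : Irr A × Irr A, p ≠ q →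
      ∀ z ∈ tensorBlock (starCoeffs p.1) (starCoeffs p.2),
      ∀ z' ∈ tensorBlock (starCoeffs q.1) (starCoeffs q.2), ⟪LamLam A z, LamLam A z'⟫_ℂ = 0 := by
    intro p q hpq z hz z' hz'
    refine inner_LamLam_eq_zero ?_ hz hz'
    by_cases h : p.1 = q.1
    · exact Or.inr fun b hb d hd => haar_star_mul_of_mem (fun h' => hpq (Prod.ext h h')) hb hd
    · exact Or.inl fun b hb d hd => haar_star_mul_of_mem h hb hd
  have hdense : ∀ z : A ⊗[ℂ] A,
      0 ≤ (⟪(dualComul x - opTensor x x) (LamLam A z), LamLam A z⟫_ℂ).re ∧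
      (⟪(dualComul x - opTensor x x) (LamLam A z), LamLam A z⟫_ℂ).im = 0 := by
    intro z
    refine inner_nonneg_of_iSup (V := fun p : Irr A × Irr A =>
      tensorBlock (starCoeffs p.1) (starCoeffs p.2)) _ ?_ ?_
      (iSup_tensorBlock (A := A) ▸ Submodule.mem_top)
    · rintro ⟨lam, μ⟩ z hz
      have h1 : ⟪(dualComul x - opTensor x x) (LamLam A z), LamLam A z⟫_ℂ =
          ⟪(opTensor 1 x - ((c lam * c μ : ℝ) : ℂ) • 1) (LamLam A (WhatAlg A z)),
            LamLam A (WhatAlg A z)⟫_ℂ := by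
        rw [sub_apply, sub_apply, inner_sub_left, inner_sub_left, inner_dualComul,
          hx.opTensor_LamLam hz, smul_apply, one_apply_eq_self,
          inner_smul_left, inner_smul_left, ← What_LamLam, inner_What]
      rw [h1]
      have hT : ∀ ν : {ν : Irr A // SubTensor ν lam μ}, ∀ z ∈ tensorBlock ⊤ (starCoeffs ν.1),
          (opTensor 1 x - ((c lam * c μ : ℝ) : ℂ) • 1) (LamLam A z) =
            ((c ν.1 - c lam * c μ : ℝ) : ℂ) • LamLam A z := by
        intro ν z hz
        rw [sub_apply, hx.opTensor_one_LamLam hz, smul_apply,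
          one_apply_eq_self, ← sub_smul, Complex.ofReal_sub]
      refine inner_nonneg_of_iSup _ (fun ν z hz => ?_) (fun ν ν' h z hz z' hz' => ?_)
        (WhatAlg_mem hz)
      · rw [hT ν z hz, inner_ofReal_smul_self, Complex.ofReal_re, Complex.ofReal_im]
        exact ⟨mul_nonneg (sub_nonneg.2 (hc lam μ ν ν.2)) (by positivity), rfl⟩
      · rw [hT ν z hz, inner_smul_left, inner_LamLam_eq_zero (Or.inr fun b hb d hd =>
          haar_star_mul_of_mem (fun h' => h (Subtype.ext h')) hb hd) hz hz', mul_zero]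
    · intro p q hpq z hz z' hz'
      rw [sub_apply, dualComul_LamLam hx.apply_Lam, hx.opTensor_LamLam hz, inner_sub_left,
        inner_smul_left, horth p q hpq z hz z' hz', horth p q hpq _ (conv₂_mem _ hz) z' hz']
      simp
  rw [ContinuousLinearMap.le_def, ContinuousLinearMap.isPositive_iff_complex]
  intro η
  have h : 0 ≤ (⟪(dualComul x - opTensor x x) η, η⟫_ℂ).re ∧
      (⟪(dualComul x - opTensor x x) η, η⟫_ℂ).im = 0 := by
    refine denseRange_LamLam.induction_on (p := fun η : L2L2 A =>
      0 ≤ (⟪(dualComul x - opTensor x x) η, η⟫_ℂ).re ∧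
      (⟪(dualComul x - opTensor x x) η, η⟫_ℂ).im = 0) η ?_ hdense
    rw [Set.ofPred_and]
    refine IsClosed.inter (isClosed_le continuous_const ?_) (isClosed_eq ?_ continuous_const)
    · exact Complex.continuous_re.comp (by fun_prop)
    · exact Complex.continuous_im.comp (by fun_prop)
  exact ⟨Complex.ext rfl h.2.symm, h.1⟩

theorem isCentralWeight_diagOp_iff {w : Irr A → ℝ} (hw : ∀ μ, 0 < w μ) :
    IsCentralWeight (diagOp w) ↔
      (∀ μ, 1 ≤ w μ) ∧ ∀ lam μ ν : Irr A, SubTensor ν lam μ → w ν ≤ w lam * w μ := by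
  constructor
  · rintro ⟨h, -⟩
    obtain ⟨x, -, hx, hle⟩ := h.inverse
    exact one_le_and_submultiplicative hw (hx.isBlockScalar hw) hle
  · rintro ⟨h1, h2⟩
    obtain ⟨x, hx, -⟩ := exists_isBlockScalar (c := fun μ => (w μ)⁻¹) (C := 1)
      (fun μ => by
        rw [abs_of_pos (inv_pos.2 (hw μ))]
        exact inv_le_one_of_one_le₀ (h1 μ)) zero_le_one
    have hinv := hx.isBoundedInverse hw
    refine ⟨⟨dense_domain_diagOp w, isSelfAdjoint_diagOp hx.inner_apply hinv,
      strictly_pos_diagOp h1, x, hx.mem_VN, hinv, opTensor_le_dualComul hx.sq fun lam μ ν hν => ?_⟩,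
      x, hx.mem_VN, hinv, fun y hy => hx.comm hy⟩
    rw [← mul_pow, ← mul_inv]
    exact pow_le_pow_left₀ (inv_nonneg.2 (mul_pos (hw _) (hw _)).le)
      ((inv_le_inv₀ (mul_pos (hw _) (hw _)) (hw _)).2 (h2 _ _ _ hν)) 2

end CompactQuantumGroup

namespace CompactQuantumGroup

variable {A : Type*} [Ring A] [StarRing A] [HopfAlgebra ℂ A] [StarModule ℂ A]
  [CompactQuantumGroup A]

/-! ### Bounded functions on a strip -/

/-- The closed strip `-1/2 ≤ Im z ≤ 0`. -/
def strip : Set ℂ := {z : ℂ | -(1 / 2) ≤ z.im ∧ z.im ≤ 0}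

theorem ofReal_mem_strip (t : ℝ) : (t : ℂ) ∈ strip := by
  simp [strip]

theorem neg_I_div_two_mem_strip : -(Complex.I / 2) ∈ strip := by
  simp [strip]

theorem norm_le_of_strip {f : ℂ → ℂ} {C a b : ℝ} (hC : ∀ z ∈ strip, ‖f z‖ ≤ C)
    (hc : ContinuousOn f strip)
    (hd : DifferentiableOn ℂ f {z : ℂ | -(1 / 2) < z.im ∧ z.im < 0})
    (ha : ∀ z : ℂ, z.im = 0 → ‖f z‖ ≤ a) (hb : ∀ z : ℂ, z.im = -(1 / 2) → ‖f z‖ ≤ b)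
    {z : ℂ} (hz : z ∈ strip) : ‖f z‖ ≤ a ^ (1 + 2 * z.im) * b ^ (-2 * z.im) := by
  -- The map `r` rotates and rescales the vertical strip `0 ≤ Re s ≤ 1`, for which the three lines
  -- theorem is stated, onto `strip`; its inverse is `z ↦ 2 i z`.
  let r : ℂ → ℂ := fun s => -(Complex.I / 2) * s
  have hr : ∀ s : ℂ, (r s).im = -(s.re / 2) := fun s => by
    simp [r, Complex.mul_im, div_eq_mul_inv, mul_comm]
  have hrd : Differentiable ℂ r := by fun_prop
  have hmaps : Set.MapsTo r (Complex.HadamardThreeLines.verticalClosedStrip 0 1) strip := by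
    rintro s ⟨h1, h2⟩
    constructor <;> rw [hr] <;> linarith
  have hmaps' : Set.MapsTo r (Complex.HadamardThreeLines.verticalStrip 0 1)
      {z : ℂ | -(1 / 2) < z.im ∧ z.im < 0} := by
    rintro s ⟨h1, h2⟩
    constructor <;> rw [hr] <;> linarith
  have hsub : closure (Complex.HadamardThreeLines.verticalStrip 0 1) ⊆
      Complex.HadamardThreeLines.verticalClosedStrip 0 1 :=
    closure_minimal (Set.preimage_mono Set.Ioo_subset_Icc_self)
      (isClosed_Icc.preimage Complex.continuous_re)
  have hs : r (2 * Complex.I * z) = z := by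
    simp only [r]
    linear_combination -z * Complex.I_mul_I
  have hre : (2 * Complex.I * z).re = -2 * z.im := by
    simp [mul_assoc]
  have h := Complex.HadamardThreeLines.norm_le_interp_of_mem_verticalClosedStrip₀₁' (f ∘ r)
    (z := 2 * Complex.I * z) (a := a) (b := b) ?_ ?_ ?_ ?_ ?_
  · rw [Function.comp_apply, hs, hre] at h
    convert h using 3
    ring
  · constructor <;> rw [hre] <;> linarith [hz.1, hz.2]
  · exact ⟨hd.comp hrd.differentiableOn hmaps', hc.comp hrd.continuous.continuousOn fun s hs =>
      hmaps (hsub hs)⟩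
  · refine ⟨C, ?_⟩
    rintro _ ⟨s, hs, rfl⟩
    exact hC _ (hmaps hs)
  · intro s hs
    refine ha _ ?_
    rw [hr, show s.re = 0 from hs]
    simp
  · intro s hs
    refine hb _ ?_
    rw [hr, show s.re = 1 from hs]

theorem eq_zero_of_strip {f : ℂ → ℂ} {C : ℝ} (hC : ∀ z ∈ strip, ‖f z‖ ≤ C)
    (hc : ContinuousOn f strip)
    (hd : DifferentiableOn ℂ f {z : ℂ | -(1 / 2) < z.im ∧ z.im < 0})
    (h0 : ∀ z : ℂ, z.im = 0 → f z = 0) : f (-(Complex.I / 2)) = 0 := by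
  have h1 : ∀ z ∈ {z : ℂ | -(1 / 2) < z.im ∧ z.im < 0}, f z = 0 := by
    intro z hz
    have h := norm_le_of_strip hC hc hd (a := 0) (b := C) (fun z hz => by simp [h0 z hz])
      (fun z hz => hC z ⟨hz.ge, by rw [hz]; norm_num⟩) ⟨hz.1.le, hz.2.le⟩
    rw [Real.zero_rpow (by linarith [hz.1]), zero_mul] at h
    simpa using h
  -- At the lower edge the exponent of the zero bound is `0` and the estimate says nothing; the
  -- value there is obtained by continuity from the interior.
  have hmem : -(Complex.I / 2) ∈ closure {z : ℂ | -(1 / 2) < z.im ∧ z.im < 0} := by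
    have h2 : Filter.Tendsto (fun t : ℝ => -((t : ℂ) * Complex.I)) (nhdsWithin (1 / 2) (Set.Iio (1 / 2)))
        (nhds (-(Complex.I / 2))) := by
      have h3 : Continuous fun t : ℝ => -((t : ℂ) * Complex.I) := by fun_prop
      have h4 := (h3.tendsto (1 / 2)).mono_left (nhdsWithin_le_nhds (s := Set.Iio (1 / 2)))
      convert h4 using 2
      push_cast
      ring
    refine mem_closure_of_tendsto h2 ?_
    filter_upwards [Ioo_mem_nhdsLT (show (0 : ℝ) < 1 / 2 by norm_num)] with t ht
    simpa using ht.symm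
  have h2 := (hc _ neg_I_div_two_mem_strip).mono (fun z hz => ⟨hz.1.le, hz.2.le⟩ :
    {z : ℂ | -(1 / 2) < z.im ∧ z.im < 0} ⊆ strip)
  have h3 := h2.mem_closure hmem (t := {0}) fun z hz => h1 z hz
  simpa using h3

/-! ### Symmetric weights are invariant under conjugation -/

/-- The flips in the definitions cancel. Hence the antipode of the dual sends `(ω ⊗ id)(W*)` to `(ω
⊗ id)(W)`. -/
theorem rightSlice_What (ξ η : L2 A) : rightSlice ξ η (What A) = leftSlice ξ η (Wstar A) := by
  rw [rightSlice]
  congr 1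
  ext ζ
  simp [What, mul_apply_eq_comp, flip_flip]

theorem rightSlice_adjoint_What (ξ η : L2 A) :
    rightSlice ξ η (ContinuousLinearMap.adjoint (What A)) = leftSlice ξ η (W A) := by
  rw [rightSlice]
  congr 1
  have h : ContinuousLinearMap.adjoint (What A) = flip A * W A * flip A := by
    rw [What, ← ContinuousLinearMap.star_eq_adjoint, star_mul, star_mul]
    simp only [ContinuousLinearMap.star_eq_adjoint, adjoint_flip]
    rw [mul_assoc]
    rfl
  rw [h]
  ext ζ
  simp [mul_apply_eq_comp, flip_flip]

theorem leftSlice_W (ξ η : L2 A) :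
    leftSlice ξ η (W A) = ContinuousLinearMap.adjoint (leftSlice η ξ (Wstar A)) := by
  rw [adjoint_leftSlice, W]

/-- Let `F` continue the orbit of the slice. As the scaling group fixes `x`, the identity `x F(t) =
c F(t)` holds on the real line, hence at `-i/2`. The antimultiplicative unitary antipode fixes `x`
too and moves it to the right of the slice of `W`. -/
theorem IsAntipodeDecomposition.map_smul_eq {R : VNElem A →ₗ[ℂ] VNElem A}
    {τ : ℝ → (VNElem A ≃⋆ₐ[ℂ] VNElem A)} (h : IsAntipodeDecomposition R τ) {x : VNElem A}
    (hτ : ∀ t, τ t x = x) (hR : R x = x) {c : ℂ} {ξ η : L2 A}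
    (hx : (x : L2 A →L[ℂ] L2 A) * leftSlice ξ η (Wstar A) = c • leftSlice ξ η (Wstar A)) :
    leftSlice ξ η (W A) * (x : L2 A →L[ℂ] L2 A) = c • leftSlice ξ η (W A) := by
  obtain ⟨F, ⟨C, hC⟩, hcont, hdiff, hFt, hF0, hFR⟩ := h.antipode_eq ξ η
  rw [rightSlice_What] at hF0
  rw [rightSlice_adjoint_What] at hFR
  have hx0 : x * F 0 = c • F 0 := Subtype.ext (by
    rw [MulMemClass.coe_mul, hF0, hx, SetLike.val_smul, hF0])
  have hxt : ∀ t : ℝ, x * F t = c • F t := by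
    intro t
    have h1 := congrArg (τ t) hx0
    rwa [_root_.map_mul, hτ, map_smul, ← hFt] at h1
  have hxi : x * F (-(Complex.I / 2)) = c • F (-(Complex.I / 2)) := by
    refine Subtype.ext (ContinuousLinearMap.ext fun β => ext_inner_left ℂ fun α => ?_)
    have e : ∀ z, ⟪α, ((x * F z : VNElem A) : L2 A →L[ℂ] L2 A) β⟫_ℂ -
        ⟪α, ((c • F z : VNElem A) : L2 A →L[ℂ] L2 A) β⟫_ℂ =
        ⟪ContinuousLinearMap.adjoint (x : L2 A →L[ℂ] L2 A) α, (F z : L2 A →L[ℂ] L2 A) β⟫_ℂ -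
        c * ⟪α, (F z : L2 A →L[ℂ] L2 A) β⟫_ℂ := by
      intro z
      rw [MulMemClass.coe_mul, mul_apply_eq_comp, SetLike.val_smul, smul_apply, inner_smul_right,
        ContinuousLinearMap.adjoint_inner_left]
    have hb : ∀ α z, z ∈ strip → ‖⟪α, (F z : L2 A →L[ℂ] L2 A) β⟫_ℂ‖ ≤ ‖α‖ * (C * ‖β‖) := by
      intro α z hz
      refine (norm_inner_le_norm _ _).trans ?_
      gcongr
      exact (F z : L2 A →L[ℂ] L2 A).le_of_opNorm_le (hC z hz.1 hz.2) β
    rw [← sub_eq_zero]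
    refine eq_zero_of_strip (f := fun z => ⟪α, ((x * F z : VNElem A) : L2 A →L[ℂ] L2 A) β⟫_ℂ -
        ⟪α, ((c • F z : VNElem A) : L2 A →L[ℂ] L2 A) β⟫_ℂ)
      (C := ‖ContinuousLinearMap.adjoint (x : L2 A →L[ℂ] L2 A) α‖ * (C * ‖β‖) +
        ‖c‖ * (‖α‖ * (C * ‖β‖))) ?_ ?_ ?_ ?_
    · intro z hz
      rw [e]
      refine (norm_sub_le _ _).trans (add_le_add (hb _ z hz) ?_)
      rw [norm_mul]
      exact mul_le_mul_of_nonneg_left (hb _ z hz) (norm_nonneg _)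
    · simp only [e]
      exact (hcont _ β).sub (continuousOn_const.mul (hcont α β))
    · simp only [e]
      exact (hdiff _ β).sub ((differentiableOn_const c).mul (hdiff α β))
    · intro z hz
      have hz' : (z.re : ℂ) = z := Complex.ext (by simp) (by simp [hz])
      have h1 := hxt z.re
      rw [hz'] at h1
      rw [h1, sub_self]
  have h2 := congrArg (fun y => (R y : L2 A →L[ℂ] L2 A)) hxi
  simp only [h.map_mul, hR, map_smul] at h2
  rwa [MulMemClass.coe_mul, SetLike.val_smul, hFR] at h2

/-- The slice for `(c, 1)`, with `c` representing the counit on the block of `μ`, is the projection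
onto that block, so `x` multiplies it by `w(μ)⁻¹`. The preceding lemma and an adjoint yield the same
scalar for the slice for `(1, c)`, which does not vanish on `c*`, a vector of the block of `μ'`. -/
theorem IsSymmetricWeight.eq_of_isConj {w : Irr A → ℝ} (hw : ∀ μ, 0 < w μ)
    (h : IsSymmetricWeight (diagOp w)) {μ μ' : Irr A} (hμ : IsConj μ μ') : w μ = w μ' := by
  obtain ⟨-, x, hx, R, τ, hRτ, hτ, hR⟩ := h
  have hx' := hx.isBlockScalar hw
  obtain ⟨c, hc, hc'⟩ := exists_haarForm_eq (Coalgebra.counit (R := ℂ)) μ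
  have hc0 : c ≠ 0 := by
    rintro rfl
    have h1 := hc' _ (mem_coeffSpan (conjCoeff μ) ⟨0, (rep μ).dim_pos⟩ ⟨0, (rep μ).dim_pos⟩)
    rw [(isCorep_conjCoeff μ).counit] at h1
    simp [haarForm_apply] at h1
  have h1 : (x : L2 A →L[ℂ] L2 A) * leftSlice (Lam c) (Lam 1) (Wstar A) =
      (((w μ)⁻¹ : ℝ) : ℂ) • leftSlice (Lam c) (Lam 1) (Wstar A) := by
    refine clm_ext_block fun ν a ha => ?_
    rw [mul_apply_eq_comp, smul_apply, leftSlice_haarForm]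
    by_cases hν : μ = ν
    · subst hν
      exact hx' μ _ (Lc_mem_starCoeffs _ ha)
    · rw [Lc_haarForm_of_ne hν hc ha]
      simp
  have h2 := hRτ.map_smul_eq hτ hR h1
  have h3 := congrArg star h2
  rw [leftSlice_W, star_mul, star_smul] at h3
  simp only [ContinuousLinearMap.star_eq_adjoint, ContinuousLinearMap.adjoint_adjoint] at h3
  have h4 : star c ∈ starCoeffs μ' := by
    rw [isConj_coeffs hμ]
    exact mem_starCoeffs.1 hc
  have h5 := congrArg (fun T => ⟪Lam (Lc (sliceFunctional 1 c) (star c)), T (Lam (star c))⟫_ℂ) h3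
  have hadj : ContinuousLinearMap.adjoint (x : L2 A →L[ℂ] L2 A) = x := by
    ext ξ
    refine ext_inner_left ℂ fun η => ?_
    rw [ContinuousLinearMap.adjoint_inner_right, hx'.inner_apply]
  simp only [hadj, mul_apply_eq_comp, smul_apply, leftSlice_Wstar_Lam,
    hx' μ' _ (Lc_mem_starCoeffs _ h4), inner_smul_right] at h5
  -- The counit of this convolution is `φ(c* c)`, which is nonzero by faithfulness.
  have h6 : ⟪Lam (Lc (sliceFunctional 1 c) (star c)), Lam (Lc (sliceFunctional 1 c) (star c))⟫_ℂ
      ≠ 0 := by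
    rw [inner_self_ne_zero]
    intro h
    have h7 := counit_Lc (sliceFunctional 1 c) (star c)
    rw [Lam_injective (h.trans (map_zero _).symm), map_zero, sliceFunctional_apply, star_one,
      one_mul] at h7
    exact hc0 (haar_faithful c h7.symm)
  have h7 := mul_right_cancel₀ h6 h5
  simp only [RCLike.star_def, Complex.conj_ofReal, Complex.ofReal_inj, inv_inj] at h7
  exact h7.symm

end CompactQuantumGroup

namespace CompactQuantumGroup

variable {A : Type*} [Ring A] [StarRing A] [HopfAlgebra ℂ A] [StarModule ℂ A]
  [CompactQuantumGroup A]

/-! ### Exponential sums -/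

/-- The linear combinations of the functions `z ↦ ρ ^ z` for `ρ > 0`. -/
def expSpan : Submodule ℂ (ℂ → ℂ) :=
  Submodule.span ℂ {h | ∃ ρ : ℝ, 0 < ρ ∧ h = fun z => (ρ : ℂ) ^ z}

theorem expSpan_induction {p : (ℂ → ℂ) → Prop} (h : ∀ ρ : ℝ, 0 < ρ → p fun z => (ρ : ℂ) ^ z)
    (h0 : p 0) (hadd : ∀ f g, p f → p g → p (f + g)) (hsmul : ∀ (c : ℂ) f, p f → p (c • f))
    {f : ℂ → ℂ} (hf : f ∈ expSpan) : p f := by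
  refine Submodule.span_induction (p := fun f _ => p f) ?_ h0 (fun f g _ _ => hadd f g)
    (fun c f _ => hsmul c f) hf
  rintro _ ⟨ρ, hρ, rfl⟩
  exact h ρ hρ

theorem cpow_mem_expSpan {ρ : ℝ} (hρ : 0 < ρ) : (fun z : ℂ => (ρ : ℂ) ^ z) ∈ expSpan :=
  Submodule.subset_span ⟨ρ, hρ, rfl⟩

theorem differentiable_of_mem_expSpan {f : ℂ → ℂ} (hf : f ∈ expSpan) : Differentiable ℂ f := by
  refine expSpan_induction (p := fun f => Differentiable ℂ f) (fun ρ hρ => ?_)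
    (differentiable_const 0) (fun f g hf hg => hf.add hg) (fun c f hf => hf.const_smul c) hf
  exact fun z => differentiableAt_id.const_cpow (Or.inl (by exact_mod_cast hρ.ne'))

theorem exists_bound_of_mem_expSpan {f : ℂ → ℂ} (hf : f ∈ expSpan) :
    ∃ C, ∀ z ∈ strip, ‖f (Complex.I * z)‖ ≤ C := by
  refine expSpan_induction (p := fun f => ∃ C, ∀ z ∈ strip, ‖f (Complex.I * z)‖ ≤ C)
    (fun ρ hρ => ⟨1 + ρ, fun z hz => ?_⟩) ⟨0, fun z _ => by simp⟩ ?_ ?_ hf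
  · rw [Complex.norm_cpow_eq_rpow_re_of_pos hρ, Complex.I_mul_re]
    calc ρ ^ (-z.im) ≤ (1 + ρ) ^ (-z.im) :=
          Real.rpow_le_rpow hρ.le (by linarith) (by linarith [hz.2])
      _ ≤ (1 + ρ) ^ (1 : ℝ) :=
          Real.rpow_le_rpow_of_exponent_le (by linarith) (by linarith [hz.1])
      _ = 1 + ρ := Real.rpow_one _
  · rintro f g ⟨C, hC⟩ ⟨D, hD⟩
    exact ⟨C + D, fun z hz => (norm_add_le _ _).trans (add_le_add (hC z hz) (hD z hz))⟩
  · rintro c f ⟨C, hC⟩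
    refine ⟨‖c‖ * C, fun z hz => ?_⟩
    rw [Pi.smul_apply, norm_smul]
    exact mul_le_mul_of_nonneg_left (hC z hz) (norm_nonneg c)

/-- An exponential sum which vanishes on the natural numbers vanishes identically. -/
theorem eq_zero_of_mem_expSpan {f : ℂ → ℂ} (hf : f ∈ expSpan) (h : ∀ n : ℕ, f n = 0) (z : ℂ) :
    f z = 0 := by
  classical
  obtain ⟨c, hc⟩ : ∃ c : ℝ →₀ ℂ, (∀ ρ ∈ c.support, 0 < ρ) ∧
      f = fun z => c.sum fun ρ x => x * (ρ : ℂ) ^ z := by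
    refine expSpan_induction (p := fun f => ∃ c : ℝ →₀ ℂ, (∀ ρ ∈ c.support, 0 < ρ) ∧
      f = fun z => c.sum fun ρ x => x * (ρ : ℂ) ^ z) (fun ρ hρ => ?_) ⟨0, by simp, by ext; simp⟩
      ?_ ?_ hf
    · refine ⟨Finsupp.single ρ 1, fun σ hσ => ?_, by ext; simp⟩
      have := Finsupp.support_single_subset hσ
      rwa [Finset.mem_singleton.1 this]
    · rintro _ _ ⟨c, hc, rfl⟩ ⟨d, hd, rfl⟩
      refine ⟨c + d, fun ρ hρ => ?_, ?_⟩
      · rcases Finset.mem_union.1 (Finsupp.support_add hρ) with h | h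
        exacts [hc _ h, hd _ h]
      · ext z
        rw [Finsupp.sum_add_index' (by simp) (by simp [add_mul])]
        rfl
    · rintro a _ ⟨c, hc, rfl⟩
      refine ⟨a • c, fun ρ hρ => hc _ (Finsupp.support_smul hρ), ?_⟩
      ext z
      rw [Finsupp.sum_smul_index (by simp)]
      simp [Finsupp.sum, Finset.mul_sum, mul_assoc]
  obtain ⟨hpos, rfl⟩ := hc
  -- The values at natural numbers are the power sums of the nodes, so the weighted sum vanishes for
  -- every polynomial, in particular for the one interpolating `ρ ↦ ρ ^ z` on the finite support.
  have hpoly : ∀ p : Polynomial ℂ, ∑ ρ ∈ c.support, c ρ * p.eval (ρ : ℂ) = 0 := by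
    intro p
    simp only [Polynomial.eval_eq_sum, Polynomial.sum, Finset.mul_sum]
    rw [Finset.sum_comm]
    refine Finset.sum_eq_zero fun n _ => ?_
    have h1 := h n
    simp only [Finsupp.sum, Complex.cpow_natCast] at h1
    calc _ = p.coeff n * ∑ ρ ∈ c.support, c ρ * (ρ : ℂ) ^ n := by
          rw [Finset.mul_sum]
          exact Finset.sum_congr rfl fun ρ _ => by ring
      _ = 0 := by rw [h1, mul_zero]
  have h2 := hpoly (Lagrange.interpolate c.support (fun ρ : ℝ => (ρ : ℂ)) fun ρ => (ρ : ℂ) ^ z)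
  rw [← h2]
  refine Finset.sum_congr rfl fun ρ hρ => ?_
  rw [Lagrange.eval_interpolate_at_node _ Complex.ofReal_injective.injOn hρ]

/-! ### Powers of the modular operator -/

/-- The powers of the operator `D` such that `⟪a, D b⟫ = φ(b a*)`. -/
noncomputable def modPow (z : ℂ) : A →ₗ[ℂ] A := diagMap fun k => (modEig k : ℂ) ^ z

theorem modEig_ne_zero (k : ModIndex A) : (modEig k : ℂ) ≠ 0 := by
  exact_mod_cast (modEig_pos k).ne'

theorem modPow_modBasis (z : ℂ) (k : ModIndex A) :
    modPow z (modBasis A k) = (modEig k : ℂ) ^ z • modBasis A k :=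
  diagMap_modBasis _ k

theorem modPow_add (y z : ℂ) (a : A) : modPow (y + z) a = modPow y (modPow z a) := by
  have h : modPow (y + z) = modPow y ∘ₗ modPow (A := A) z := (modBasis A).ext fun k => by
    rw [LinearMap.comp_apply, modPow_modBasis, modPow_modBasis, map_smul, modPow_modBasis,
      smul_smul, Complex.cpow_add _ _ (modEig_ne_zero k), mul_comm]
  exact LinearMap.congr_fun h a

theorem modPow_zero (a : A) : modPow 0 a = a := by
  have h : modPow 0 = (LinearMap.id : A →ₗ[ℂ] A) := (modBasis A).ext fun k => by
    rw [modPow_modBasis, Complex.cpow_zero, one_smul, LinearMap.id_apply]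
  exact LinearMap.congr_fun h a

theorem modPow_self_neg (z : ℂ) (a : A) : modPow z (modPow (-z) a) = a := by
  rw [← modPow_add, add_neg_cancel, modPow_zero]

theorem modPow_mem_starCoeffs (z : ℂ) {μ : Irr A} {a : A} (ha : a ∈ starCoeffs μ) :
    modPow z a ∈ starCoeffs μ := by
  have h : starCoeffs μ ≤ (starCoeffs μ).comap (modPow z) := by
    conv_lhs => rw [starCoeffs_eq_span_modBasis]
    rw [Submodule.span_le]
    rintro _ ⟨i, rfl⟩
    change modPow z (modBasis A ⟨μ, i⟩) ∈ starCoeffs μ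
    rw [modPow_modBasis]
    exact Submodule.smul_mem _ _ (modBasis_mem ⟨μ, i⟩)
  exact h ha

theorem modPow_of_eigenvector {a : A} {r : ℝ} (h : modPow 1 a = (r : ℂ) • a) (z : ℂ) :
    modPow z a = (r : ℂ) ^ z • a := by
  refine (modBasis A).ext_elem fun k => ?_
  have h1 := congrArg (fun b => (modBasis A).repr b k) h
  simp only [modPow, repr_diagMap, Complex.cpow_one, map_smul, Finsupp.smul_apply,
    smul_eq_mul] at h1 ⊢
  by_cases h0 : (modBasis A).repr a k = 0
  · simp [h0]
  · rw [mul_right_cancel₀ h0 h1]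

theorem modBasis_induction {p : A → Prop} (h : ∀ k, p (modBasis A k)) (h0 : p 0)
    (hadd : ∀ a b, p a → p b → p (a + b)) (hsmul : ∀ (c : ℂ) a, p a → p (c • a)) (a : A) : p a := by
  have ha : a ∈ Submodule.span ℂ (Set.range (modBasis A)) := by
    rw [(modBasis A).span_eq]; trivial
  refine Submodule.span_induction (p := fun a _ => p a) ?_ h0 (fun a b _ _ => hadd a b)
    (fun c a _ => hsmul c a) ha
  rintro _ ⟨k, rfl⟩
  exact h k

theorem inner_modPow_one (a b : A) : ⟪Lam a, Lam (modPow 1 b)⟫_ℂ = haar (b * star a) := by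
  classical
  rw [inner_Lam]
  refine modBasis_induction (p := fun a => haar (star a * modPow 1 b) = haar (b * star a))
    (fun k => ?_) (by simp) (fun a b ha hb => by simp [add_mul, mul_add, ha, hb])
    (fun c a ha => by simp [ha]) a
  refine modBasis_induction (p := fun b => haar (star (modBasis A k) * modPow 1 b) =
    haar (b * star (modBasis A k))) (fun l => ?_) (by simp)
    (fun a b ha hb => by simp [add_mul, mul_add, ha, hb]) (fun c a ha => by simp [ha]) b
  rw [modPow_modBasis, mul_smul_comm, map_smul, haar_star_modBasis, haar_modBasis_star,
    Complex.cpow_one]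
  simp

theorem Lam_ext_inner {a b : A} (h : ∀ c : A, ⟪Lam c, Lam a⟫_ℂ = ⟪Lam c, Lam b⟫_ℂ) : a = b := by
  have h1 : ∀ c : A, ⟪Lam c, Lam (a - b)⟫_ℂ = 0 := fun c => by
    rw [map_sub, inner_sub_right, h, sub_self]
  have h2 := h1 (a - b)
  rw [inner_self_eq_zero] at h2
  exact sub_eq_zero.1 (Lam_injective (h2.trans (map_zero _).symm))

/-- This says `D = S* S` for the Tomita operator `S : Λ(a) ↦ Λ(a*)`. -/
theorem inner_star_star (a b : A) : ⟪Lam (star a), Lam (star b)⟫_ℂ = ⟪Lam b, Lam (modPow 1 a)⟫_ℂ := by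
  rw [inner_modPow_one, inner_Lam, star_star]

/-- The involution turns `D` into `D⁻¹`. Applying `⟪a, D b⟫ = φ(b a*)` twice reduces both sides to
`φ(c* a*)`. -/
theorem modPow_star_modPow (a : A) : modPow 1 (star (modPow 1 a)) = star a := by
  refine Lam_ext_inner fun c => ?_
  rw [inner_modPow_one, ← inner_Lam, ← inner_conj_symm, inner_modPow_one, ← haar_star, star_mul,
    star_star, inner_Lam]

theorem star_modPow (z : ℂ) (a : A) :
    star (modPow z a) = modPow (-(starRingEnd ℂ) z) (star a) := by
  refine modBasis_induction (p := fun a => star (modPow z a) = modPow (-(starRingEnd ℂ) z) (star a))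
    (fun k => ?_) (by simp) (fun a b ha hb => by simp [ha, hb]) (fun c a ha => by simp [ha]) a
  have h := modPow_star_modPow (modBasis A k)
  rw [modPow_modBasis, Complex.cpow_one, star_smul, map_smul, RCLike.star_def,
    Complex.conj_ofReal] at h
  have h1 : modPow 1 (star (modBasis A k)) = (((modEig k)⁻¹ : ℝ) : ℂ) • star (modBasis A k) := by
    rw [Complex.ofReal_inv, eq_inv_smul_iff₀ (modEig_ne_zero k), h]
  rw [modPow_of_eigenvector h1, modPow_modBasis, star_smul]
  have harg : Complex.arg (modEig k : ℂ) ≠ Real.pi := by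
    rw [Complex.arg_ofReal_of_nonneg (modEig_pos k).le]
    exact Real.pi_pos.ne
  rw [Complex.ofReal_inv, Complex.inv_cpow _ _ harg, Complex.cpow_neg, inv_inv, Complex.cpow_conj _ _
    harg, Complex.conj_ofReal, RCLike.star_def]

/-! ### Modular conjugation of convolution operators -/

/-- The functional is `ε ∘ m`; commutation with right convolutions recovers `m` from it. -/
theorem exists_eq_Lc {m : A →ₗ[ℂ] A} (h : ∀ (g : A →ₗ[ℂ] ℂ) a, m (Rc g a) = Rc g (m a)) :
    ∃ f : A →ₗ[ℂ] ℂ, m = Lc f := by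
  refine ⟨Coalgebra.counit ∘ₗ m, LinearMap.ext fun a => ?_⟩
  rw [← sub_eq_zero, ← Module.forall_dual_apply_eq_zero_iff ℂ]
  intro k
  rw [map_sub, sub_eq_zero, apply_Lc, LinearMap.comp_apply, h, ← apply_Lc, Lc_counit]

theorem starFunctional_starFunctional (f : A →ₗ[ℂ] ℂ) : starFunctional (starFunctional f) = f :=
  LinearMap.ext fun a => by simp [starFunctional_apply]

theorem star_Lc_star (f : A →ₗ[ℂ] ℂ) (a : A) : star (Lc f a) = Lc (starFunctional f) (star a) := by
  rw [Lc_starFunctional, star_star]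

/-- Since `D = S* S`, it suffices that the involution and the passage to adjoints both carry left
convolutions to left convolutions. Two of each give the functional. -/
theorem exists_modPow_one_Lc (f : A →ₗ[ℂ] ℂ) :
    ∃ g : A →ₗ[ℂ] ℂ, ∀ a, modPow 1 (Lc f a) = Lc g (modPow 1 a) := by
  refine ⟨adjFunctional (starFunctional (adjFunctional (starFunctional f))), fun b => ?_⟩
  refine Lam_ext_inner fun a => ?_
  rw [← inner_Lc, ← inner_star_star, ← inner_star_star, star_Lc_star, star_Lc_star, inner_Lc,
    starFunctional_starFunctional]

theorem exists_modPow_nat_Lc (f : A →ₗ[ℂ] ℂ) (n : ℕ) :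
    ∃ g : A →ₗ[ℂ] ℂ, ∀ a, modPow n (Lc f a) = Lc g (modPow n a) := by
  induction n with
  | zero => exact ⟨f, fun a => by simp [modPow_zero]⟩
  | succ n ih =>
    obtain ⟨g, hg⟩ := ih
    obtain ⟨g', hg'⟩ := exists_modPow_one_Lc g
    refine ⟨g', fun a => ?_⟩
    rw [Nat.cast_succ, add_comm, modPow_add, hg, hg', modPow_add]

/-- In the eigenbasis the matrix entries of `D^z m D^{-z}` are multiples of `(d_k / d_l)^z`, and
only finitely many enter. -/
theorem modPow_conj_mem_expSpan (m : A →ₗ[ℂ] A) (φ : A →ₗ[ℂ] ℂ) (a : A) :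
    (fun z => φ (modPow z (m (modPow (-z) a)))) ∈ expSpan := by
  have h1 : ∀ (l : ModIndex A) (c : A),
      (fun z => (modEig l : ℂ) ^ (-z) * φ (modPow z c)) ∈ expSpan := by
    intro l c
    refine modBasis_induction (p := fun c => (fun z => (modEig l : ℂ) ^ (-z) * φ (modPow z c)) ∈
      expSpan) (fun k => ?_) ?_ (fun a b ha hb => ?_) (fun d a ha => ?_) c
    · have h := Submodule.smul_mem _ (φ (modBasis A k))
        (cpow_mem_expSpan (div_pos (modEig_pos k) (modEig_pos l)))
      convert h using 1
      ext z
      rw [modPow_modBasis, Pi.smul_apply, map_smul, smul_eq_mul, smul_eq_mul, Complex.ofReal_div,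
        div_eq_mul_inv, ← Complex.ofReal_inv, Complex.mul_cpow_ofReal_nonneg (modEig_pos k).le
        (inv_nonneg.2 (modEig_pos l).le), Complex.ofReal_inv, Complex.cpow_neg, Complex.inv_cpow]
      · ring
      · rw [Complex.arg_ofReal_of_nonneg (modEig_pos l).le]
        exact Real.pi_pos.ne
    · convert zero_mem expSpan using 1
      ext z
      simp
    · convert add_mem ha hb using 1
      ext z
      simp [mul_add]
    · convert Submodule.smul_mem _ d ha using 1
      ext z
      simp [mul_left_comm]
  refine modBasis_induction (p := fun a => (fun z => φ (modPow z (m (modPow (-z) a)))) ∈ expSpan)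
    (fun l => ?_) ?_ (fun a b ha hb => ?_) (fun d a ha => ?_) a
  · convert h1 l (m (modBasis A l)) using 1
    ext z
    rw [modPow_modBasis, map_smul, map_smul, map_smul, smul_eq_mul]
  · convert zero_mem expSpan using 1
    ext z
    simp
  · convert add_mem ha hb using 1
    ext z
    simp
  · convert Submodule.smul_mem _ d ha using 1
    ext z
    simp

/-- Conjugation by powers of the modular operator preserves the convolution operators. -/
theorem exists_modPow_conj_Lc (f : A →ₗ[ℂ] ℂ) (z : ℂ) :
    ∃ g : A →ₗ[ℂ] ℂ, ∀ a, modPow z (Lc f (modPow (-z) a)) = Lc g a := by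
  obtain ⟨g, hg⟩ := exists_eq_Lc (m := modPow z ∘ₗ Lc f ∘ₗ modPow (-z)) fun g a => by
    rw [← sub_eq_zero, ← Module.forall_dual_apply_eq_zero_iff ℂ]
    intro φ
    simp only [map_sub, LinearMap.comp_apply]
    -- The failure to commute with a right convolution is an exponential sum in `z` which vanishes
    -- for `z = n`, where the conjugate is already known to be a left convolution.
    refine eq_zero_of_mem_expSpan (sub_mem (modPow_conj_mem_expSpan (Lc f) φ (Rc g a))
      (modPow_conj_mem_expSpan (Lc f) (φ ∘ₗ Rc g) a)) (fun n => ?_) z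
    obtain ⟨k, hk⟩ := exists_modPow_nat_Lc f n
    simp only [Pi.sub_apply, hk, modPow_self_neg, LinearMap.comp_apply, Rc_Lc, sub_self]
  exact ⟨g, fun a => LinearMap.congr_fun hg a⟩

end CompactQuantumGroup

namespace CompactQuantumGroup

variable {A : Type*} [Ring A] [StarRing A] [HopfAlgebra ℂ A] [StarModule ℂ A]
  [CompactQuantumGroup A]

/-! ### The modular unitaries and the modular conjugation -/

theorem inner_modPow (z : ℂ) (a b : A) :
    ⟪Lam (modPow z a), Lam b⟫_ℂ = ⟪Lam a, Lam (modPow ((starRingEnd ℂ) z) b)⟫_ℂ := by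
  rw [modPow, inner_diagMap, modPow]
  congr 4
  ext k
  have harg : Complex.arg (modEig k : ℂ) ≠ Real.pi := by
    rw [Complex.arg_ofReal_of_nonneg (modEig_pos k).le]
    exact Real.pi_pos.ne
  rw [Complex.cpow_conj _ _ harg, Complex.conj_ofReal]

theorem exists_modU (t : ℝ) : ∃ X : L2 A →L[ℂ] L2 A,
    (∀ a, X (Lam a) = Lam (modPow (Complex.I * t) a)) ∧ ‖X‖ ≤ 1 :=
  exists_extension zero_le_one (norm_diagMap_le (fun k => by
    rw [Complex.norm_cpow_eq_rpow_re_of_pos (modEig_pos k)]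
    simp) zero_le_one)

/-- The unitary operators `D ^ (i t)`. -/
noncomputable def modU (t : ℝ) : L2 A →L[ℂ] L2 A := (exists_modU t).choose

theorem modU_Lam (t : ℝ) (a : A) : modU t (Lam a) = Lam (modPow (Complex.I * t) a) :=
  (exists_modU t).choose_spec.1 a

theorem norm_modU_le (t : ℝ) : ‖(modU t : L2 A →L[ℂ] L2 A)‖ ≤ 1 :=
  (exists_modU t).choose_spec.2

theorem modU_zero : (modU 0 : L2 A →L[ℂ] L2 A) = 1 :=
  clm_ext fun a => by simp [modU_Lam, modPow_zero]

theorem modU_add (s t : ℝ) : (modU (s + t) : L2 A →L[ℂ] L2 A) = modU s * modU t :=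
  clm_ext fun a => by
    rw [mul_apply_eq_comp, modU_Lam, modU_Lam, modU_Lam, ← modPow_add]
    congr 3
    push_cast
    ring

theorem modU_neg_mul (t : ℝ) : (modU (-t) : L2 A →L[ℂ] L2 A) * modU t = 1 := by
  rw [← modU_add, neg_add_cancel, modU_zero]

theorem modU_mul_neg (t : ℝ) : (modU t : L2 A →L[ℂ] L2 A) * modU (-t) = 1 := by
  rw [← modU_add, add_neg_cancel, modU_zero]

theorem star_modU (t : ℝ) : star (modU t : L2 A →L[ℂ] L2 A) = modU (-t) := by
  refine clm_ext fun a => ext_inner_left ℂ fun v => ?_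
  refine denseRange_Lam.induction_on
    (p := fun v => ⟪v, star (modU t) (Lam a)⟫_ℂ = ⟪v, modU (-t) (Lam a)⟫_ℂ) v
    (isClosed_eq (by fun_prop) (by fun_prop)) fun b => ?_
  rw [ContinuousLinearMap.star_eq_adjoint, ContinuousLinearMap.adjoint_inner_right, modU_Lam,
    modU_Lam, inner_modPow]
  simp

/-- The antilinear map `a ↦ (D ^ (-1/2) a)*`. -/
noncomputable def conjAlg : A →ₗ⋆[ℂ] A where
  toFun a := star (modPow (-(1 / 2)) a)
  map_add' a b := by simp
  map_smul' c a := by simp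

theorem conjAlg_apply (a : A) : conjAlg a = star (modPow (-(1 / 2)) a) := rfl

theorem conjAlg_eq (a : A) : conjAlg a = modPow (1 / 2) (star a) := by
  rw [conjAlg_apply, star_modPow]
  simp [Complex.conj_ofNat]

theorem conjAlg_conjAlg (a : A) : conjAlg (conjAlg a) = a := by
  rw [conjAlg_eq, conjAlg_apply, star_star, modPow_self_neg]

/-- The factor `D` from the involution cancels the two factors `D^{-1/2}`. -/
theorem inner_conjAlg (a b : A) : ⟪Lam (conjAlg a), Lam (conjAlg b)⟫_ℂ = ⟪Lam b, Lam a⟫_ℂ := by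
  rw [conjAlg_apply, conjAlg_apply, inner_star_star, inner_modPow, ← modPow_add, ← modPow_add]
  have h : (starRingEnd ℂ) (-(1 / 2)) + (1 + -(1 / 2)) = (0 : ℂ) := by
    simp only [map_neg, map_div₀, map_one, Complex.conj_ofNat]
    norm_num
  rw [← add_assoc] at h
  rw [add_assoc, ← add_assoc, h, modPow_zero]

theorem norm_Lam_conjAlg (a : A) : ‖Lam (conjAlg a)‖ = ‖Lam a‖ := by
  have h := inner_conjAlg a a
  rw [inner_self_eq_norm_sq_to_K, inner_self_eq_norm_sq_to_K] at h
  have h' : ‖Lam (conjAlg a)‖ ^ 2 = ‖Lam a‖ ^ 2 := by exact_mod_cast h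
  exact (sq_eq_sq₀ (norm_nonneg _) (norm_nonneg _)).1 h'

variable (A) in
/-- The modular conjugation, an antiunitary involution of `L²(K)`. -/
noncomputable def modJ : L2 A →L⋆[ℂ] L2 A :=
  (Lam.comp conjAlg : A →ₗ⋆[ℂ] L2 A).extendOfNorm Lam

theorem modJ_Lam (a : A) : modJ A (Lam a) = Lam (conjAlg a) :=
  LinearMap.extendOfNorm_eq (f := (Lam.comp conjAlg : A →ₗ⋆[ℂ] L2 A)) denseRange_Lam
    ⟨1, fun a => by rw [one_mul]; exact (norm_Lam_conjAlg a).le⟩ a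

theorem modJ_modJ (ξ : L2 A) : modJ A (modJ A ξ) = ξ := by
  refine denseRange_Lam.induction_on (p := fun ξ => modJ A (modJ A ξ) = ξ) ξ
    (isClosed_eq (by fun_prop) (by fun_prop)) fun a => ?_
  rw [modJ_Lam, modJ_Lam, conjAlg_conjAlg]

theorem inner_modJ (ξ η : L2 A) : ⟪modJ A ξ, η⟫_ℂ = ⟪modJ A η, ξ⟫_ℂ := by
  refine denseRange_Lam.induction_on₂ (p := fun ξ η => ⟪modJ A ξ, η⟫_ℂ = ⟪modJ A η, ξ⟫_ℂ)
    (isClosed_eq (by fun_prop) (by fun_prop)) (fun a b => ?_) ξ η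
  rw [modJ_Lam, modJ_Lam, ← inner_conjAlg, conjAlg_conjAlg]

theorem norm_modJ (ξ : L2 A) : ‖modJ A ξ‖ = ‖ξ‖ := by
  have h := inner_modJ ξ (modJ A ξ)
  rw [modJ_modJ, inner_self_eq_norm_sq_to_K, inner_self_eq_norm_sq_to_K] at h
  have h' : ‖modJ A ξ‖ ^ 2 = ‖ξ‖ ^ 2 := by exact_mod_cast h
  exact (sq_eq_sq₀ (norm_nonneg _) (norm_nonneg _)).1 h'

/-- The operator `J x J`. -/
noncomputable def conjOp (x : L2 A →L[ℂ] L2 A) : L2 A →L[ℂ] L2 A :=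
  (modJ A).comp (x.comp (modJ A))

theorem conjOp_apply (x : L2 A →L[ℂ] L2 A) (ξ : L2 A) : conjOp x ξ = modJ A (x (modJ A ξ)) := rfl

theorem conjOp_conjOp (x : L2 A →L[ℂ] L2 A) : conjOp (conjOp x) = x := by
  ext ξ
  simp only [conjOp_apply, modJ_modJ]

theorem conjOp_mul (x y : L2 A →L[ℂ] L2 A) : conjOp (x * y) = conjOp x * conjOp y := by
  ext ξ
  simp only [conjOp_apply, mul_apply_eq_comp, modJ_modJ]

theorem star_conjOp (x : L2 A →L[ℂ] L2 A) : star (conjOp x) = conjOp (star x) := by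
  ext ξ
  refine ext_inner_left ℂ fun η => ?_
  rw [ContinuousLinearMap.star_eq_adjoint, ContinuousLinearMap.adjoint_inner_right, conjOp_apply,
    conjOp_apply, inner_modJ, ← ContinuousLinearMap.adjoint_inner_left, ← inner_conj_symm η, inner_modJ,
    inner_conj_symm, ContinuousLinearMap.star_eq_adjoint]

theorem norm_conjOp_le (x : L2 A →L[ℂ] L2 A) : ‖conjOp x‖ ≤ ‖x‖ := by
  refine ContinuousLinearMap.opNorm_le_bound _ (norm_nonneg _) fun ξ => ?_
  rw [conjOp_apply, norm_modJ, ← norm_modJ ξ]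
  exact x.le_opNorm _

theorem continuous_conjOp : Continuous (conjOp : (L2 A →L[ℂ] L2 A) → L2 A →L[ℂ] L2 A) := by
  have h : LipschitzWith 1 (conjOp : (L2 A →L[ℂ] L2 A) → L2 A →L[ℂ] L2 A) := by
    refine LipschitzWith.of_dist_le_mul fun x y => ?_
    have h1 : conjOp x - conjOp y = conjOp (x - y) := by
      ext ξ
      simp [conjOp_apply]
    rw [dist_eq_norm, dist_eq_norm, h1, NNReal.coe_one, one_mul]
    exact norm_conjOp_le _
  exact h.continuous

/-- Write `J` as `* D^{-1/2}` on the left and as `D^{1/2} *` on the right. Conjugation by powers of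
`D` and by the involution both preserve left convolutions. -/
theorem conjOp_mem {x : L2 A →L[ℂ] L2 A} (hx : x ∈ VN A) : conjOp x ∈ VN A := by
  obtain ⟨f, hf⟩ := exists_Lc_of_mem_VN hx
  obtain ⟨g, hg⟩ := exists_modPow_conj_Lc f (-(1 / 2))
  refine mem_VN_of_Lc (f := starFunctional g) fun a => ?_
  have h : star (Lc g (star a)) = Lc (starFunctional g) a := by rw [star_Lc_star, star_star]
  rw [conjOp_apply, modJ_Lam, hf, modJ_Lam, conjAlg_apply, conjAlg_eq, ← h, ← hg, neg_neg]

/-! ### The scaling group and the unitary antipode -/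

theorem modU_conj_mem {x : L2 A →L[ℂ] L2 A} (hx : x ∈ VN A) (t : ℝ) :
    modU t * x * modU (-t) ∈ VN A := by
  obtain ⟨f, hf⟩ := exists_Lc_of_mem_VN hx
  obtain ⟨g, hg⟩ := exists_modPow_conj_Lc f (Complex.I * t)
  refine mem_VN_of_Lc (f := g) fun a => ?_
  rw [mul_apply_eq_comp, mul_apply_eq_comp, modU_Lam, hf, modU_Lam, ← hg]
  simp

/-- The scaling group `x ↦ D ^ (i t) x D ^ (-i t)`. -/
noncomputable def scaling (t : ℝ) : VNElem A ≃⋆ₐ[ℂ] VNElem A where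
  toFun x := ⟨modU t * (x : L2 A →L[ℂ] L2 A) * modU (-t), modU_conj_mem x.2 t⟩
  invFun x := ⟨modU (-t) * (x : L2 A →L[ℂ] L2 A) * modU t, by
    have h := modU_conj_mem x.2 (-t)
    rwa [neg_neg] at h⟩
  left_inv x := Subtype.ext (by
    change modU (-t) * (modU t * (x : L2 A →L[ℂ] L2 A) * modU (-t)) * modU t = _
    simp only [mul_assoc, modU_neg_mul, mul_one]
    rw [← mul_assoc, modU_neg_mul, one_mul])
  right_inv x := Subtype.ext (by
    change modU t * (modU (-t) * (x : L2 A →L[ℂ] L2 A) * modU t) * modU (-t) = _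
    simp only [mul_assoc, modU_mul_neg, mul_one]
    rw [← mul_assoc, modU_mul_neg, one_mul])
  map_mul' x y := Subtype.ext (by
    change modU t * ((x : L2 A →L[ℂ] L2 A) * (y : L2 A →L[ℂ] L2 A)) * modU (-t) =
      modU t * (x : L2 A →L[ℂ] L2 A) * modU (-t) * (modU t * (y : L2 A →L[ℂ] L2 A) * modU (-t))
    simp only [mul_assoc]
    rw [← mul_assoc (modU (-t)) (modU t), modU_neg_mul, one_mul])
  map_add' x y := Subtype.ext (by
    change modU t * ((x : L2 A →L[ℂ] L2 A) + (y : L2 A →L[ℂ] L2 A)) * modU (-t) =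
      modU t * (x : L2 A →L[ℂ] L2 A) * modU (-t) + modU t * (y : L2 A →L[ℂ] L2 A) * modU (-t)
    rw [mul_add, add_mul])
  map_star' x := Subtype.ext (by
    change modU t * star (x : L2 A →L[ℂ] L2 A) * modU (-t) =
      star (modU t * (x : L2 A →L[ℂ] L2 A) * modU (-t))
    rw [star_mul, star_mul, star_modU, star_modU, neg_neg, mul_assoc])
  map_smul' c x := Subtype.ext (by
    change modU t * (c • (x : L2 A →L[ℂ] L2 A)) * modU (-t) =
      c • (modU t * (x : L2 A →L[ℂ] L2 A) * modU (-t))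
    rw [mul_smul_comm, smul_mul_assoc])

theorem coe_scaling (t : ℝ) (x : VNElem A) :
    (scaling t x : L2 A →L[ℂ] L2 A) = modU t * (x : L2 A →L[ℂ] L2 A) * modU (-t) := rfl

variable (A) in
/-- The unitary antipode `x ↦ J x* J`. -/
noncomputable def unitaryAntipode : VNElem A →ₗ[ℂ] VNElem A where
  toFun x := ⟨conjOp (star (x : L2 A →L[ℂ] L2 A)), conjOp_mem (star_mem x.2)⟩
  map_add' x y := Subtype.ext (by
    ext ξ
    simp [conjOp_apply])
  map_smul' c x := Subtype.ext (by
    ext ξ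
    simp [conjOp_apply])

theorem coe_unitaryAntipode (x : VNElem A) : (unitaryAntipode A x : L2 A →L[ℂ] L2 A) =
    conjOp (star (x : L2 A →L[ℂ] L2 A)) := rfl

end CompactQuantumGroup

namespace CompactQuantumGroup

variable {A : Type*} [Ring A] [StarRing A] [HopfAlgebra ℂ A] [StarModule ℂ A]
  [CompactQuantumGroup A]

open Filter Topology

/-! ### Uniform limits -/

/-- Functions which are continuous on the closed strip and holomorphic in the open strip. -/
def IsStripHolo (f : ℂ → ℂ) : Prop :=
  ContinuousOn f strip ∧ DifferentiableOn ℂ f {z : ℂ | -(1 / 2) < z.im ∧ z.im < 0}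

theorem isStripHolo_of_tendstoUniformlyOn {f : ℕ → ℂ → ℂ} {g : ℂ → ℂ}
    (h : TendstoUniformlyOn f g atTop strip) (hf : ∀ n, IsStripHolo (f n)) : IsStripHolo g := by
  refine ⟨h.continuousOn (Eventually.of_forall fun n => (hf n).1).frequently, ?_⟩
  refine TendstoLocallyUniformlyOn.differentiableOn (F := f) (φ := atTop)
    (h.mono fun z hz => ⟨hz.1.le, hz.2.le⟩).tendstoLocallyUniformlyOn
    (Eventually.of_forall fun n => (hf n).2) ?_
  exact (isOpen_lt continuous_const Complex.continuous_im).inter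
    (isOpen_lt Complex.continuous_im continuous_const)

theorem exists_seq_tendsto_Lam (ξ : L2 A) : ∃ a : ℕ → A, Tendsto (fun n => Lam (a n)) atTop (𝓝 ξ) := by
  obtain ⟨x, hx, h⟩ := mem_closure_iff_seq_limit.1 (denseRange_Lam ξ)
  choose a ha using hx
  exact ⟨a, by simpa only [ha] using h⟩

/-- A uniform norm bound makes the approximation of `α` and `β` by vectors of `Λ(A)` uniform in the
parameter, so continuity and holomorphy need only be checked on `Λ(A)`. -/
theorem exists_seq_tendstoUniformlyOn {X : Type*} {s : Set X} {F : X → L2 A →L[ℂ] L2 A} {C : ℝ}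
    (hC : ∀ z ∈ s, ‖F z‖ ≤ C) (α β : L2 A) : ∃ a b : ℕ → A,
      TendstoUniformlyOn (fun n z => ⟪Lam (a n), F z (Lam (b n))⟫_ℂ) (fun z => ⟪α, F z β⟫_ℂ)
        atTop s := by
  obtain ⟨a, ha⟩ := exists_seq_tendsto_Lam α
  obtain ⟨b, hb⟩ := exists_seq_tendsto_Lam β
  refine ⟨a, b, ?_⟩
  rw [Metric.tendstoUniformlyOn_iff]
  intro ε hε
  have h : Tendsto (fun n => ‖α - Lam (a n)‖ * (C * ‖β‖) + ‖Lam (a n)‖ * (C * ‖β - Lam (b n)‖))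
      atTop (𝓝 (‖α - α‖ * (C * ‖β‖) + ‖α‖ * (C * ‖β - β‖))) :=
    ((tendsto_const_nhds.sub ha).norm.mul_const _).add
      (ha.norm.mul ((tendsto_const_nhds.sub hb).norm.const_mul C))
  simp only [sub_self, norm_zero, zero_mul, mul_zero, add_zero] at h
  filter_upwards [h.eventually_lt_const hε] with n hn z hz
  refine lt_of_le_of_lt ?_ hn
  have e : ⟪α, F z β⟫_ℂ - ⟪Lam (a n), F z (Lam (b n))⟫_ℂ =
      ⟪α - Lam (a n), F z β⟫_ℂ + ⟪Lam (a n), F z (β - Lam (b n))⟫_ℂ := by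
    rw [inner_sub_left, map_sub, inner_sub_right]
    ring
  rw [dist_eq_norm, e]
  refine (norm_add_le _ _).trans (add_le_add ?_ ?_)
  · refine (norm_inner_le_norm _ _).trans ?_
    gcongr
    exact (F z).le_of_opNorm_le (hC z hz) _
  · refine (norm_inner_le_norm _ _).trans ?_
    gcongr
    exact (F z).le_of_opNorm_le (hC z hz) _

/-! ### The analytic continuation of the scaling group -/

/-- The map `D ^ (i z) L D ^ (-i z)`, where `L` is the slice of `W*` defined by `c` and `a`. -/
noncomputable def pathAlg (c a : A) (z : ℂ) : A →ₗ[ℂ] A :=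
  modPow (Complex.I * z) ∘ₗ Lc (sliceFunctional c a) ∘ₗ modPow (-(Complex.I * z))

theorem sliceFunctional_sub_left (c c' a : A) :
    sliceFunctional (c - c') a = sliceFunctional c a - sliceFunctional c' a := by
  ext b
  simp [sliceFunctional_apply, sub_mul]

theorem sliceFunctional_sub_right (c a a' : A) :
    sliceFunctional c (a - a') = sliceFunctional c a - sliceFunctional c a' := by
  ext b
  simp [sliceFunctional_apply, mul_sub]

theorem Lc_sub (f g : A →ₗ[ℂ] ℂ) : Lc (f - g) = Lc f - Lc g := by
  ext a
  simp [Lc_apply, LinearMap.rTensor_sub]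

theorem pathAlg_sub (c c' a a' : A) (z : ℂ) (b : A) :
    pathAlg c a z b - pathAlg c' a' z b = pathAlg (c - c') a z b + pathAlg c' (a - a') z b := by
  simp only [pathAlg, LinearMap.comp_apply, sliceFunctional_sub_left, sliceFunctional_sub_right,
    Lc_sub, LinearMap.sub_apply, map_sub]
  abel

theorem inner_pathAlg (b b' c a : A) : ∃ h ∈ expSpan, ∀ z,
    ⟪Lam b', Lam (pathAlg c a z b)⟫_ℂ = h (Complex.I * z) :=
  ⟨_, modPow_conj_mem_expSpan (Lc (sliceFunctional c a)) (haarForm b') b, fun z => by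
    rw [inner_Lam, haarForm_apply]; rfl⟩

theorem isStripHolo_of_mem_expSpan {h : ℂ → ℂ} (hh : h ∈ expSpan) :
    IsStripHolo fun z => h (Complex.I * z) := by
  have h1 : Differentiable ℂ fun z => h (Complex.I * z) :=
    (differentiable_of_mem_expSpan hh).comp (differentiable_id.const_mul Complex.I)
  exact ⟨h1.continuous.continuousOn, h1.differentiableOn⟩

theorem norm_Wstar_le : ‖Wstar A‖ ≤ 1 := by
  refine ContinuousLinearMap.opNorm_le_bound _ zero_le_one fun η => ?_
  rw [one_mul]
  refine denseRange_LamLam.induction_on (p := fun η => ‖Wstar A η‖ ≤ ‖η‖) η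
    (isClosed_le (by fun_prop) (by fun_prop)) fun z => ?_
  rw [Wstar_LamLam, norm_Wpre]

theorem norm_leftSlice_Wstar_le (ξ η : L2 A) : ‖leftSlice ξ η (Wstar A)‖ ≤ ‖ξ‖ * ‖η‖ := by
  refine (ContinuousLinearMap.opNorm_comp_le _ _).trans ?_
  refine mul_le_mul ?_ ((ContinuousLinearMap.opNorm_comp_le _ _).trans ?_) (norm_nonneg _)
    (norm_nonneg _)
  · rw [LinearIsometryEquiv.norm_map]
    exact norm_tens ξ
  · exact (mul_le_of_le_one_left (norm_nonneg _) norm_Wstar_le).trans (norm_tens η)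

theorem pathAlg_ofReal (c a : A) (t : ℝ) (b : A) : Lam (pathAlg c a t b) =
    (modU t * leftSlice (Lam c) (Lam a) (Wstar A) * modU (-t) : L2 A →L[ℂ] L2 A) (Lam b) := by
  rw [mul_apply_eq_comp, mul_apply_eq_comp, modU_Lam, leftSlice_Wstar_Lam, modU_Lam, pathAlg]
  simp

theorem starFunctional_sliceFunctional (c a : A) :
    starFunctional (sliceFunctional c a) = sliceFunctional a c := by
  ext b
  rw [starFunctional_apply, sliceFunctional_apply, sliceFunctional_apply, ← haar_star]
  simp [mul_assoc]

/-- Although `D^{±1/2}` may be unbounded, this conjugate is bounded: the involution exchanges `c`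
and `a` in the functional, so it equals `J L J` for a slice `L`. -/
theorem conjOp_leftSlice_Lam (c a b : A) : conjOp (leftSlice (Lam a) (Lam c) (Wstar A)) (Lam b) =
    Lam (modPow (1 / 2) (Lc (sliceFunctional c a) (modPow (-(1 / 2)) b))) := by
  rw [conjOp_apply, modJ_Lam, leftSlice_Wstar_Lam, modJ_Lam, conjAlg_eq, conjAlg_apply, star_Lc_star,
    star_star, starFunctional_sliceFunctional]

theorem pathAlg_sub_I_div_two (c a : A) (t : ℝ) (b : A) : Lam (pathAlg c a (t - Complex.I / 2) b) =
    (modU t * conjOp (leftSlice (Lam a) (Lam c) (Wstar A)) * modU (-t) : L2 A →L[ℂ] L2 A)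
      (Lam b) := by
  have h1 : Complex.I * (t - Complex.I / 2) = Complex.I * t + 1 / 2 := by
    linear_combination -(1 / 2) * Complex.I_mul_I
  have h2 : -(Complex.I * (t - Complex.I / 2)) = -(1 / 2) + Complex.I * (-t : ℝ) := by
    rw [h1]; push_cast; ring
  rw [mul_apply_eq_comp, mul_apply_eq_comp, modU_Lam, conjOp_leftSlice_Lam, modU_Lam, pathAlg,
    LinearMap.comp_apply, LinearMap.comp_apply, h2, h1, modPow_add, modPow_add]

theorem norm_modU_conj_le (t : ℝ) (x : L2 A →L[ℂ] L2 A) : ‖modU t * x * modU (-t)‖ ≤ ‖x‖ := by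
  refine (norm_mul_le _ _).trans ((mul_le_of_le_one_right (norm_nonneg _) (norm_modU_le _)).trans ?_)
  exact (norm_mul_le _ _).trans (mul_le_of_le_one_left (norm_nonneg _) (norm_modU_le _))

theorem norm_le_of_strip_boundary {f : ℂ → ℂ} {C M : ℝ} (hC : ∀ z ∈ strip, ‖f z‖ ≤ C)
    (hf : IsStripHolo f) (ha : ∀ z : ℂ, z.im = 0 → ‖f z‖ ≤ M)
    (hb : ∀ z : ℂ, z.im = -(1 / 2) → ‖f z‖ ≤ M) {z : ℂ} (hz : z ∈ strip) : ‖f z‖ ≤ M := by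
  have h := norm_le_of_strip hC hf.1 hf.2 ha hb hz
  have hM : 0 ≤ M := (norm_nonneg _).trans (ha 0 rfl)
  -- The exponents add up to `1` only by a law that needs `M > 0`. For `M = 0` at least one of them
  -- is nonzero, which makes the product vanish.
  rcases hM.eq_or_lt with h0 | h0
  · rw [← h0] at h ⊢
    refine h.trans ?_
    rcases eq_or_ne (1 + 2 * z.im) 0 with h4 | h4
    · rw [Real.zero_rpow (x := -2 * z.im) (by linarith), mul_zero]
    · rw [Real.zero_rpow h4, zero_mul]
  · rwa [← Real.rpow_add h0, show 1 + 2 * z.im + -2 * z.im = 1 by ring, Real.rpow_one] at h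

theorem norm_inner_apply_le {x : L2 A →L[ℂ] L2 A} {M : ℝ} (hx : ‖x‖ ≤ M) (ξ η : L2 A) :
    ‖⟪ξ, x η⟫_ℂ‖ ≤ ‖ξ‖ * (M * ‖η‖) :=
  (norm_inner_le_norm _ _).trans
    (mul_le_mul_of_nonneg_left (x.le_of_opNorm_le hx η) (norm_nonneg ξ))

/-- Three lines theorem: on both edges the operator is a unitary conjugate of a slice, or of `J L J`
for a slice `L`, with the same norm bound. -/
theorem norm_inner_pathAlg_le (c a : A) {z : ℂ} (hz : z ∈ strip) (b b' : A) :
    ‖⟪Lam b', Lam (pathAlg c a z b)⟫_ℂ‖ ≤ ‖Lam b'‖ * (‖Lam c‖ * ‖Lam a‖ * ‖Lam b‖) := by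
  obtain ⟨h, hh, hp⟩ := inner_pathAlg b b' c a
  obtain ⟨C, hC⟩ := exists_bound_of_mem_expSpan hh
  rw [hp]
  refine norm_le_of_strip_boundary (f := fun z => h (Complex.I * z)) hC
    (isStripHolo_of_mem_expSpan hh) (fun z hz => ?_) (fun z hz => ?_) hz
  · have hz' : z = (z.re : ℂ) := Complex.ext (by simp) (by simp [hz])
    rw [← hp, hz', pathAlg_ofReal]
    exact norm_inner_apply_le ((norm_modU_conj_le _ _).trans (norm_leftSlice_Wstar_le _ _)) _ _
  · have hz' : z = (z.re : ℂ) - Complex.I / 2 := Complex.ext (by simp) (by simp [hz])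
    rw [← hp, hz', pathAlg_sub_I_div_two, mul_comm ‖Lam c‖]
    exact norm_inner_apply_le ((norm_modU_conj_le _ _).trans ((norm_conjOp_le _).trans
      (norm_leftSlice_Wstar_le _ _))) _ _

theorem norm_pathAlg_le (c a : A) {z : ℂ} (hz : z ∈ strip) (b : A) :
    ‖Lam (pathAlg c a z b)‖ ≤ ‖Lam c‖ * ‖Lam a‖ * ‖Lam b‖ := by
  -- Pairing the vector with itself and dividing by its norm turns the bound for matrix coefficients
  -- into a bound for the vector.
  have h := norm_inner_pathAlg_le c a hz b (pathAlg c a z b)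
  rw [inner_self_eq_norm_sq_to_K, norm_pow, RCLike.norm_ofReal, abs_norm, pow_two] at h
  rcases eq_or_lt_of_le (norm_nonneg (Lam (pathAlg c a z b))) with h0 | h0
  · rw [← h0]; positivity
  · exact le_of_mul_le_mul_left h h0

/-- Outside the strip no bound is available; the operator `0` is a placeholder there. -/
theorem exists_path (c a : A) (z : ℂ) : ∃ X : L2 A →L[ℂ] L2 A, z ∈ strip →
    (∀ b, X (Lam b) = Lam (pathAlg c a z b)) ∧ ‖X‖ ≤ ‖Lam c‖ * ‖Lam a‖ := by
  by_cases hz : z ∈ strip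
  · obtain ⟨X, hX⟩ := exists_extension (by positivity) (norm_pathAlg_le c a hz)
    exact ⟨X, fun _ => hX⟩
  · exact ⟨0, fun h => absurd h hz⟩

/-- The extension of `pathAlg c a z` to a bounded operator, for `z` in the strip. -/
noncomputable def path (c a : A) (z : ℂ) : L2 A →L[ℂ] L2 A := (exists_path c a z).choose

theorem path_Lam (c a : A) {z : ℂ} (hz : z ∈ strip) (b : A) :
    path c a z (Lam b) = Lam (pathAlg c a z b) :=
  ((exists_path c a z).choose_spec hz).1 b

theorem norm_path_le (c a : A) {z : ℂ} (hz : z ∈ strip) : ‖path c a z‖ ≤ ‖Lam c‖ * ‖Lam a‖ :=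
  ((exists_path c a z).choose_spec hz).2

theorem norm_path_sub_le (c c' a a' : A) {z : ℂ} (hz : z ∈ strip) :
    ‖path c a z - path c' a' z‖ ≤ ‖Lam c - Lam c'‖ * ‖Lam a‖ + ‖Lam c'‖ * ‖Lam a - Lam a'‖ := by
  have h : path c a z - path c' a' z = path (c - c') a z + path c' (a - a') z := clm_ext fun b => by
    rw [sub_apply, add_apply, path_Lam _ _ hz, path_Lam _ _ hz, path_Lam _ _ hz, path_Lam _ _ hz,
      ← map_sub, ← map_add, pathAlg_sub]
  rw [h, ← map_sub, ← map_sub]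
  exact (norm_add_le _ _).trans (add_le_add (norm_path_le _ _ hz) (norm_path_le _ _ hz))

theorem path_mem (c a : A) {z : ℂ} (hz : z ∈ strip) : path c a z ∈ VN A := by
  obtain ⟨g, hg⟩ := exists_modPow_conj_Lc (sliceFunctional c a) (Complex.I * z)
  exact mem_VN_of_Lc (f := g) fun b => by rw [path_Lam _ _ hz, ← hg]; rfl

theorem path_ofReal (c a : A) (t : ℝ) :
    path c a t = modU t * leftSlice (Lam c) (Lam a) (Wstar A) * modU (-t) :=
  clm_ext fun b => by rw [path_Lam _ _ (ofReal_mem_strip t), pathAlg_ofReal]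

theorem path_neg_I_div_two (c a : A) :
    path c a (-(Complex.I / 2)) = conjOp (leftSlice (Lam a) (Lam c) (Wstar A)) :=
  clm_ext fun b => by
    have h := pathAlg_sub_I_div_two c a 0 b
    simp only [Complex.ofReal_zero, zero_sub, neg_zero, modU_zero, one_mul, mul_one] at h
    rw [path_Lam _ _ neg_I_div_two_mem_strip, h]

theorem isClosed_VN : IsClosed {x : L2 A →L[ℂ] L2 A | x ∈ VN A} := by
  have h : {x : L2 A →L[ℂ] L2 A | x ∈ VN A} = ⋂ y ∈ StarSubalgebra.centralizer ℂ
      {T | ∃ ξ η : L2 A, T = leftSlice ξ η (W A)}, {x | y * x = x * y} := by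
    ext x
    simp only [Set.mem_iInter]
    exact mem_generatedVN
  rw [h]
  exact isClosed_biInter fun y _ => isClosed_eq (by fun_prop) (by fun_prop)

/-- The bound on differences makes the paths of approximating vectors uniformly Cauchy on the strip,
and VN(K) is norm closed. This extends the continuation from vectors in `Λ(A)` to arbitrary ones. -/
theorem exists_tendstoUniformlyOn_path (ξ η : L2 A) : ∃ (F : ℂ → VNElem A) (c a : ℕ → A),
    Tendsto (fun n => Lam (c n)) atTop (𝓝 ξ) ∧ Tendsto (fun n => Lam (a n)) atTop (𝓝 η) ∧
    TendstoUniformlyOn (fun n z => path (c n) (a n) z) (fun z => (F z : L2 A →L[ℂ] L2 A)) atTop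
      strip := by
  obtain ⟨c, hc⟩ := exists_seq_tendsto_Lam ξ
  obtain ⟨a, ha⟩ := exists_seq_tendsto_Lam η
  have hcauchy : UniformCauchySeqOn (fun n z => path (c n) (a n) z) atTop strip := by
    intro u hu
    obtain ⟨ε, hε, hu⟩ := Metric.mem_uniformity_dist.1 hu
    have hfst : Tendsto (fun p : ℕ × ℕ => p.1) (atTop ×ˢ atTop) atTop := tendsto_fst
    have hsnd : Tendsto (fun p : ℕ × ℕ => p.2) (atTop ×ˢ atTop) atTop := tendsto_snd
    have h := (((hc.comp hfst).sub (hc.comp hsnd)).norm.mul (ha.comp hfst).norm).add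
      ((hc.comp hsnd).norm.mul ((ha.comp hfst).sub (ha.comp hsnd)).norm)
    simp only [sub_self, norm_zero, zero_mul, mul_zero, add_zero] at h
    filter_upwards [h.eventually_lt_const hε] with p hp z hz
    refine hu ?_
    rw [dist_eq_norm]
    exact (norm_path_sub_le _ _ _ _ hz).trans_lt hp
  have hlim : ∀ z, ∃ X : VNElem A, z ∈ strip →
      Tendsto (fun n => path (c n) (a n) z) atTop (𝓝 (X : L2 A →L[ℂ] L2 A)) := by
    intro z
    by_cases hz : z ∈ strip
    · obtain ⟨X, hX⟩ := cauchySeq_tendsto_of_complete (hcauchy.cauchySeq hz)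
      exact ⟨⟨X, isClosed_VN.mem_of_tendsto hX (Eventually.of_forall fun n => path_mem _ _ hz)⟩,
        fun _ => hX⟩
    · exact ⟨0, fun h => absurd h hz⟩
  choose F hF using hlim
  exact ⟨F, c, a, hc, ha, hcauchy.tendstoUniformlyOn_of_tendsto fun z hz => hF z hz⟩

theorem isStripHolo_of_tendstoUniformlyOn_path {F : ℂ → L2 A →L[ℂ] L2 A} {c a : ℕ → A} {C : ℝ}
    (hF : TendstoUniformlyOn (fun n z => path (c n) (a n) z) F atTop strip)
    (hC : ∀ z ∈ strip, ‖F z‖ ≤ C) (α β : L2 A) : IsStripHolo fun z => ⟪α, F z β⟫_ℂ := by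
  obtain ⟨u, v, h⟩ := exists_seq_tendstoUniformlyOn hC α β
  refine isStripHolo_of_tendstoUniformlyOn h fun k => ?_
  have h1 : UniformContinuous fun T : L2 A →L[ℂ] L2 A => ⟪Lam (u k), T (Lam (v k))⟫_ℂ :=
    ((innerSL ℂ (Lam (u k))).comp
      (ContinuousLinearMap.apply ℂ (L2 A) (Lam (v k)))).uniformContinuous
  refine isStripHolo_of_tendstoUniformlyOn (h1.comp_tendstoUniformlyOn hF) fun n => ?_
  obtain ⟨p, hp, hp'⟩ := inner_pathAlg (v k) (u k) (c n) (a n)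
  obtain ⟨h2, h3⟩ := isStripHolo_of_mem_expSpan hp
  refine ⟨h2.congr fun z hz => ?_, h3.congr fun z hz => ?_⟩
  · simp only [Function.comp_apply, path_Lam _ _ hz, hp']
  · simp only [Function.comp_apply, path_Lam (z := z) _ _ ⟨hz.1.le, hz.2.le⟩, hp']

theorem tendsto_apply₂ {X Y Z ι : Type*} [TopologicalSpace X] [TopologicalSpace Y]
    [TopologicalSpace Z] {f : X → Y → Z} (hf : Continuous fun p : X × Y => f p.1 p.2) {l : Filter ι}
    {u : ι → X} {v : ι → Y} {x : X} {y : Y} (hu : Tendsto u l (𝓝 x)) (hv : Tendsto v l (𝓝 y)) :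
    Tendsto (fun i => f (u i) (v i)) l (𝓝 (f x y)) :=
  (hf.tendsto (x, y)).comp (hu.prodMk_nhds hv)

theorem tendsto_leftSlice {ξ η : L2 A} {c a : ℕ → A}
    (hc : Tendsto (fun n => Lam (c n)) atTop (𝓝 ξ)) (ha : Tendsto (fun n => Lam (a n)) atTop (𝓝 η)) :
    Tendsto (fun n => leftSlice (Lam (c n)) (Lam (a n)) (Wstar A)) atTop
      (𝓝 (leftSlice ξ η (Wstar A))) :=
  tendsto_apply₂ (f := fun ξ η => leftSlice ξ η (Wstar A)) (continuous_leftSlice (Wstar A)) hc ha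

theorem continuous_modU_conj (t : ℝ) :
    Continuous fun x : L2 A →L[ℂ] L2 A => modU t * x * modU (-t) :=
  (continuous_const.mul continuous_id).mul continuous_const

/-- The analytic continuation of `t ↦ τ̂_t((ω ⊗ id)(W*))` to the strip. -/
theorem exists_strip_continuation (ξ η : L2 A) : ∃ F : ℂ → VNElem A,
    (∀ z ∈ strip, ‖(F z : L2 A →L[ℂ] L2 A)‖ ≤ ‖ξ‖ * ‖η‖) ∧
    (∀ α β : L2 A, IsStripHolo fun z => ⟪α, (F z : L2 A →L[ℂ] L2 A) β⟫_ℂ) ∧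
    (∀ t : ℝ, (F t : L2 A →L[ℂ] L2 A) = modU t * leftSlice ξ η (Wstar A) * modU (-t)) ∧
    (F (-(Complex.I / 2)) : L2 A →L[ℂ] L2 A) = conjOp (leftSlice η ξ (Wstar A)) := by
  obtain ⟨F, c, a, hc, ha, hF⟩ := exists_tendstoUniformlyOn_path ξ η
  have hbd : ∀ z ∈ strip, ‖(F z : L2 A →L[ℂ] L2 A)‖ ≤ ‖ξ‖ * ‖η‖ := fun z hz =>
    le_of_tendsto_of_tendsto' (hF.tendsto_at hz).norm (hc.norm.mul ha.norm)
      fun n => norm_path_le _ _ hz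
  refine ⟨F, hbd, isStripHolo_of_tendstoUniformlyOn_path hF hbd, fun t => ?_, ?_⟩
  · have h := hF.tendsto_at (ofReal_mem_strip t)
    simp only [path_ofReal] at h
    exact tendsto_nhds_unique h (((continuous_modU_conj t).tendsto _).comp (tendsto_leftSlice hc ha))
  · have h := hF.tendsto_at neg_I_div_two_mem_strip
    simp only [path_neg_I_div_two] at h
    exact tendsto_nhds_unique h ((continuous_conjOp.tendsto _).comp (tendsto_leftSlice ha hc))

/-- Symmetry of a weight requires some pair of unitary antipode and scaling group; this provides the
modular one. -/
theorem isAntipodeDecomposition : IsAntipodeDecomposition (unitaryAntipode A) scaling where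
  map_mul x y := Subtype.ext (by
    rw [MulMemClass.coe_mul, coe_unitaryAntipode, coe_unitaryAntipode, coe_unitaryAntipode,
      MulMemClass.coe_mul, star_mul, conjOp_mul])
  map_star x := Subtype.ext (by
    rw [coe_unitaryAntipode, StarMemClass.coe_star, StarMemClass.coe_star, coe_unitaryAntipode,
      star_conjOp])
  scaling_zero x := Subtype.ext (by
    rw [coe_scaling, neg_zero, modU_zero, one_mul, mul_one])
  scaling_add s t x := Subtype.ext (by
    rw [coe_scaling, coe_scaling, coe_scaling, modU_add, neg_add_rev, modU_add]
    simp only [mul_assoc])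
  scaling_continuous x α β := by
    obtain ⟨f, hf⟩ := exists_Lc_of_mem_VN x.2
    obtain ⟨a, b, h⟩ := exists_seq_tendstoUniformlyOn (s := Set.univ)
      (F := fun t : ℝ => (scaling t x : L2 A →L[ℂ] L2 A))
      (fun t _ => norm_modU_conj_le t (x : L2 A →L[ℂ] L2 A)) α β
    rw [tendstoUniformlyOn_univ] at h
    refine h.continuous (Eventually.of_forall fun n => ?_).frequently
    have h1 := differentiable_of_mem_expSpan (modPow_conj_mem_expSpan (Lc f) (haarForm (a n)) (b n))
    have h2 : Continuous fun t : ℝ => Complex.I * (t : ℂ) := by fun_prop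
    convert h1.continuous.comp h2 using 1
    ext t
    rw [coe_scaling, mul_apply_eq_comp, mul_apply_eq_comp, modU_Lam, hf, modU_Lam, inner_Lam]
    simp [haarForm_apply]
  antipode_eq ξ η := by
    obtain ⟨F, hbd, hholo, hreal, hi⟩ := exists_strip_continuation ξ η
    have hzero : (F 0 : L2 A →L[ℂ] L2 A) = leftSlice ξ η (Wstar A) := by
      have h := hreal 0
      rwa [Complex.ofReal_zero, neg_zero, modU_zero, one_mul, mul_one] at h
    refine ⟨F, ⟨‖ξ‖ * ‖η‖, fun z h1 h2 => hbd z ⟨h1, h2⟩⟩, fun α β => (hholo α β).1,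
      fun α β => (hholo α β).2, fun t => Subtype.ext ?_, ?_, ?_⟩
    · rw [hreal, coe_scaling, hzero]
    · rw [hzero, rightSlice_What]
    -- `J (J L J)* J = L*` for the slice `L` of `W*` with exchanged vectors, and `L*` is the slice
    -- of `W`.
    · rw [coe_unitaryAntipode, hi, star_conjOp, conjOp_conjOp, rightSlice_adjoint_What, leftSlice_W,
        ContinuousLinearMap.star_eq_adjoint]

/-- The powers `D^{it}` preserve each block, so they commute with `x`. The conjugation `J` maps the
block of `μ` into that of its conjugate, where `x` is the same real scalar, so `J x* J = x`. -/
theorem isSymmetricWeight_of_isConj {w : Irr A → ℝ} (hw : ∀ μ, 0 < w μ)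
    (hweight : IsWeight (diagOp w)) (h : ∀ μ μ' : Irr A, IsConj μ μ' → w μ = w μ') :
    IsSymmetricWeight (diagOp w) := by
  obtain ⟨x, hxVN, hx, -⟩ := hweight.inverse
  have hx' := hx.isBlockScalar hw
  refine ⟨hweight, ⟨x, hxVN⟩, hx, unitaryAntipode A, scaling, isAntipodeDecomposition,
    fun t => Subtype.ext ?_, Subtype.ext ?_⟩
  · refine clm_ext_block fun μ a ha => ?_
    rw [coe_scaling, mul_apply_eq_comp, mul_apply_eq_comp, modU_Lam,
      hx' μ _ (modPow_mem_starCoeffs _ ha), map_smul, modU_Lam, ← modPow_add, hx' μ a ha]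
    simp [modPow_zero]
  · rw [coe_unitaryAntipode]
    refine clm_ext_block fun μ a ha => ?_
    obtain ⟨μ', hμ⟩ := exists_isConj μ
    have hstar : star x = x := by
      ext ξ
      refine ext_inner_left ℂ fun η => ?_
      rw [ContinuousLinearMap.star_eq_adjoint, ContinuousLinearMap.adjoint_inner_right,
        hx'.inner_apply]
    have hmem : conjAlg a ∈ starCoeffs μ' := by
      rw [isConj_coeffs hμ]
      exact mem_starCoeffs.1 (modPow_mem_starCoeffs _ ha)
    change conjOp (star x) (Lam a) = x (Lam a)
    rw [hstar, conjOp_apply, modJ_Lam, hx' μ' _ hmem, map_smulₛₗ, modJ_Lam, conjAlg_conjAlg,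
      hx' μ a ha, Complex.conj_ofReal]
    simp only [h μ μ' hμ]

end CompactQuantumGroup

/-! ### Characterisation of central and of symmetric central weights -/

theorem mainTheorem5 {A : Type*} [Ring A] [StarRing A] [HopfAlgebra ℂ A] [StarModule ℂ A]
    [CompactQuantumGroup A] (w : CompactQuantumGroup.Irr A → ℝ) (hw : ∀ μ, 0 < w μ) :
    (CompactQuantumGroup.IsCentralWeight (CompactQuantumGroup.diagOp w) ↔
      (∀ μ, 1 ≤ w μ) ∧ ∀ lam μ ν : CompactQuantumGroup.Irr A, CompactQuantumGroup.SubTensor ν lam μ → w ν ≤ w lam * w μ) ∧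
    (CompactQuantumGroup.IsCentralWeight (CompactQuantumGroup.diagOp w) →
      (CompactQuantumGroup.IsSymmetricWeight (CompactQuantumGroup.diagOp w) ↔ ∀ μ μ' : CompactQuantumGroup.Irr A, CompactQuantumGroup.IsConj μ μ' → w μ = w μ')) := by
  have h := CompactQuantumGroup.isCentralWeight_diagOp_iff hw
  exact ⟨h, fun hc => ⟨fun hs _ _ hμ => hs.eq_of_isConj hw hμ,
    CompactQuantumGroup.isSymmetricWeight_of_isConj hw hc.1⟩⟩
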